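/- **Conventions.** Rings are commutative and Noetherian. For a ring $R$, $R^{red}=R/\mathrm{nil}(R)$, and the normalization $\overline R$ is the integral closure of $R^{red}$ in its total quotient ring; $\nu:R\to R^{red}\hookrightarrow\overline R$. $R$ is normal if all its local rings are integrally closed domains. $R^{>1}$ (resp. $R^{1}$) is $R$ modulo the intersection of the minimal primes $P$ with $\dim R/P>1$ (resp. $\dim R/P=1$); the empty intersection is $R$. For $X=\operatorname{Spec}R$ write $X^{red},X^{>1},X^1,\overline X$ for the spectra of $R^{red},R^{>1},R^1,\overline R$. A point is an isolated non-normal singularity if it has an open neighbourhood all of whose other points are normal. For a field $k$ and a local $k$-algebra $(B,\mathfrak m)$ put $\varepsilon_k(B)=\dim_k H^0_{\mathfrak m}(B)$ and $\delta_k(B)=\dim_k(\overline B/B^{red})-\varepsilon_k(B)$. For a $k$-algebra $B$, $\varepsilon_k(B)$ and $\delta_k(B)$ are the sums of the local invariants over all closed points of $\operatorname{Spec}B$ (normal points of positive dimension contribute $0$; an isolated reduced point $x$ contributes $\dim_k k(x)$ to $\varepsilon$ and $-\dim_k k(x)$ to $\delta$). **Theorem 2.5.** Let $\varphi:A\to R$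 be a flat morphism of rings, $A$ a PID, such that $\overline R$ is finite over $R$. Let $X=\operatorname{Spec}R$, $S=\operatorname{Spec}A$, $f=\operatorname{Spec}\varphi$, and write $Y_s$ for the fibre over $s$ of an $S$-scheme $Y$. Assume that $\operatorname{Coker}(\nu)$ and $\operatorname{Ker}(R\to\overline{R^{>1}})$ are finite over $A$, and that for each $s\in f(X)$ the normalization of $X_s$ is finite over $X_s$ and $X_s$ is normal outside finitely many isolated non-normal singularities, at which the residue fields are finite over $k(s)$. Assume moreover that every closed point of $\overline{X^{>1}}$ lying over a point of $S$ other than the generic point has codimension at least $2$ in $\overline{X^{>1}}$. Then $\overline X\to S$ is flat, $\overline{X^{>1}}=\overline X^{>1}$ over $X$, and $\delta_{k(s)}$ and $\varepsilon_{k(s)}$ of $X_s$, $(X^{red})_s$, $(X^{>1})_s$, $(\overline X)_s$ and $(\overline X^{>1})_s$ are finite for each $s\in f(X)$. Moreover, each $s\in f(X)$ has an open neighbourhood $V\subset S$ such that for $U=V\cap f(X)$: 1. For $t\in U$, $$\begin{aligned}\delta_{k(s)}(X_s)-\delta_{k(t)}(X_t)&=\delta_{k(s)}((X^{red})_s)-\delta_{k(t)}((X^{red})_t)=\delta_{k(s)}((X^{>1})_s)-\delta_{k(t)}((X^{>1})_t)\\&=\delta_{k(s)}((\overline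 X)_s)-\delta_{k(t)}((\overline X)_t)=\delta_{k(s)}((\overline X^{>1})_s)-\delta_{k(t)}((\overline X^{>1})_t).\end{aligned}$$ 2. For every $t\in U\smallsetminus\{s\}$ such that $(\overline{X^{>1}})_t$ is normal, $\delta_{k(s)}(X_s)-\delta_{k(t)}(X_t)=\delta_{k(s)}((\overline{X^{>1}})_s)\ge 0$. 3. The generic point $\eta$ of $S$ lies in $U$, and $\delta_{k(s)}(X_s)-\delta_{k(\eta)}(X_\eta)=\delta_{k(s)}((\overline{X^{>1}})_s)\ge 0$. 4. For $t\in U\smallsetminus\{s\}$, $\varepsilon_{k(s)}(X_s)-\varepsilon_{k(t)}(X_t)=\varepsilon_{k(s)}((X^{>1})_s)\ge 0$. 5. $(\overline{X^{>1}})_t=(\overline X^{>1})_t$ is reduced for every $t\in U$, and $(X^{>1})_t$ is reduced for $t\in U\smallsetminus\{s\}$. If $X$ is reduced and the generic fibre of $X^1\to S$ is separable over $k(\eta)$ (e.g. if $X$ has no $1$-dimensional components, or $\operatorname{char}k(\eta)=0$), then $X_t$ is reduced for $t\in U\smallsetminus\{s\}$. -/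

import Mathlib

noncomputable section

namespace INNS

universe u v

section Rings

variable (R : Type u) [CommRing R]

/-- The reduction `R ⧸ nil(R)`. -/
abbrev Red : Type u := R ⧸ nilradical R

/-- The normalization of `R`: the integral closure of the reduction of `R` in its total quotient
ring (for a ring that is not a domain, `FractionRing` inverts all nonzerodivisors). The structure
map of the `R`-algebra `Normalization R` is the composition of the projection to the reduction
with the inclusion. -/
abbrev Normalization : Type u := integralClosure (Red R) (FractionRing (Red R))

/-- The cokernel of the normalization map `R → Normalization R`, as an `R`-module. -/
abbrev NormCoker : Type u :=
  Normalization R ⧸ LinearMap.range (Algebra.linearMap R (Normalization R))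

/-- The intersection of the minimal primes `P` with `dim R/P > i` (it is `R` if there are none). -/
def dimGTIdeal (i : ℕ) : Ideal R :=
  sInf {P | P ∈ minimalPrimes R ∧ (i : WithBot ℕ∞) < ringKrullDim (R ⧸ P)}

/-- The intersection of the minimal primes `P` with `dim R/P = i` (it is `R` if there are none). -/
def dimEqIdeal (i : ℕ) : Ideal R :=
  sInf {P | P ∈ minimalPrimes R ∧ ringKrullDim (R ⧸ P) = (i : WithBot ℕ∞)}

/-- The coordinate ring of the union of the irreducible components of dimension `> i`,
with its reduced structure. -/
abbrev PartGT (i : ℕ) : Type u := R ⧸ dimGTIdeal R i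

/-- The coordinate ring of the union of the irreducible components of dimension `i`,
with its reduced structure. -/
abbrev PartEq (i : ℕ) : Type u := R ⧸ dimEqIdeal R i

variable {R}

/-- The local ring at `p` is normal, i.e. an integrally closed domain. -/
def IsNormalAt (p : PrimeSpectrum R) : Prop :=
  IsDomain (Localization.AtPrime p.asIdeal) ∧
    IsIntegrallyClosed (Localization.AtPrime p.asIdeal)

/-- `p` has an open neighbourhood whose points other than `p` are all normal. -/
def IsIsolatedNonnormalPoint (p : PrimeSpectrum R) : Prop :=
  ∃ U : Set (PrimeSpectrum R), IsOpen U ∧ p ∈ U ∧ ∀ q ∈ U, q ≠ p → IsNormalAt q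

variable (R)

/-- All local rings of `R` are normal domains. -/
def IsNormalRing : Prop := ∀ p : PrimeSpectrum R, IsNormalAt p

/-- The set of points at which the local ring is not normal. -/
def nonNormalLocus : Set (PrimeSpectrum R) := {p | ¬ IsNormalAt p}

end Rings

section LocalInvariants

variable (k : Type v) [Field k] (R : Type u) [CommRing R] [IsLocalRing R] [Algebra k R]

/-- The zeroth local cohomology `H⁰_𝔪(R)`: the elements killed by some power of `𝔪`. -/
abbrev HZero : Submodule R R := Ideal.primaryComponent R (IsLocalRing.maximalIdeal R)

/-- The `ε`-invariant of a local `k`-algebra (with value `0` if it is infinite). -/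
def epsilonLocal : ℕ := Module.finrank k (HZero R)

/-- The `δ`-invariant `dim_k (R̄ / R^red) - ε_k(R)` of a local `k`-algebra (meaningful when both
dimensions are finite). -/
def deltaLocal : ℤ := (Module.finrank k (NormCoker R) : ℤ) - (epsilonLocal k R : ℤ)

end LocalInvariants

section GlobalInvariants

variable (k : Type v) [Field k] (R : Type u) [CommRing R] [Algebra k R]

/-- The total `ε`-invariant. The sum is over all closed points: normal points of positive dimension
contribute `0`, and an isolated reduced point `m` contributes `dim_k k(m)`. -/
def epsilon : ℕ := ∑ᶠ m : MaximalSpectrum R, epsilonLocal k (Localization.AtPrime m.asIdeal)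

/-- The total `δ`-invariant, again summed over all closed points: normal points of positive
dimension contribute `0`, and an isolated reduced point `m` contributes `-dim_k k(m)`. -/
def delta : ℤ := ∑ᶠ m : MaximalSpectrum R, deltaLocal k (Localization.AtPrime m.asIdeal)

/-- `ε_k(R) < ∞`: all the local dimensions are finite and only finitely many are nonzero. -/
def EpsilonFinite : Prop :=
  (∀ m : MaximalSpectrum R, Module.Finite k (HZero (Localization.AtPrime m.asIdeal))) ∧
    {m : MaximalSpectrum R | epsilonLocal k (Localization.AtPrime m.asIdeal) ≠ 0}.Finite

/-- `δ_k(R) < ∞`: all the dimensions of `R̄_m / R_m^red` are finite and only finitely many are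
nonzero, and `ε_k(R)` is finite. -/
def DeltaFinite : Prop :=
  (∀ m : MaximalSpectrum R, Module.Finite k (NormCoker (Localization.AtPrime m.asIdeal))) ∧
    {m : MaximalSpectrum R |
      Module.finrank k (NormCoker (Localization.AtPrime m.asIdeal)) ≠ 0}.Finite ∧
    EpsilonFinite k R

end GlobalInvariants

section Families

variable {A : Type u} [CommRing A] (s : PrimeSpectrum A)
variable (B : Type v) [CommRing B] [Algebra A B]

/-- The coordinate ring `k(s) ⊗_A B` of the fibre of `Spec B → Spec A` over `s`. -/
abbrev FiberRing : Type (max u v) := s.asIdeal.Fiber B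

/-- `δ_{k(s)}` of the fibre over `s`. -/
abbrev deltaFiber : ℤ := delta s.asIdeal.ResidueField (FiberRing s B)

/-- `ε_{k(s)}` of the fibre over `s`. -/
abbrev epsilonFiber : ℕ := epsilon s.asIdeal.ResidueField (FiberRing s B)

/-- The invariants `δ_{k(s)}` and `ε_{k(s)}` of the fibre over `s` are finite. -/
abbrev FiberInvariantsFinite : Prop :=
  DeltaFinite s.asIdeal.ResidueField (FiberRing s B) ∧
    EpsilonFinite s.asIdeal.ResidueField (FiberRing s B)

variable (A)

/-- The image of `Spec B → Spec A`. -/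
def specImage : Set (PrimeSpectrum A) := Set.range (PrimeSpectrum.comap (algebraMap A B))

/-- The normalization of every nonempty fibre is finite over the fibre, and every nonempty fibre is
normal outside finitely many isolated non-normal points, whose residue fields are finite over the
residue field of the base. -/
def FibersHaveINNS : Prop :=
  ∀ s ∈ specImage A B,
    Module.Finite (FiberRing s B) (Normalization (FiberRing s B)) ∧
    (nonNormalLocus (FiberRing s B)).Finite ∧
    ∀ p ∈ nonNormalLocus (FiberRing s B),
      IsIsolatedNonnormalPoint p ∧
      Module.Finite s.asIdeal.ResidueField p.asIdeal.ResidueField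

end Families

end INNS

end

/-! Write B for the normalization of R^{>1}. Each algebra C under comparison (R, R^red, R^{>1}, R̄,
R̄^{>1} and B itself) maps to B with kernel and cokernel finite over A, and every invariant of a
fibre C_s is read off from the map C_s → B_s.

The fibres B_s are reduced and have no closed point of depth zero. Hence an element of C_s killed by
a power of a maximal ideal at that point dies in B_s, while the finite-dimensional kernel is locally
killed by such powers. So ε(C_s) = dim ker(C_s → B_s). Away from isolated points C_s and B_s share
their normalization, and this gives δ(C_s) = dim(B̄_s / B_s) + dim coker(C_s → B_s) − dim ker(C_s →
B_s), where B̄_s is the normalization of B_s (`delta_eq_of_algHom`). The last two terms form the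
index of a map of torsion-free A-modules with finite kernel and cokernel; by
`exists_index_baseChange` it does not depend on s. Thus δ(C_s) = δ(B_s) + const, which is (1). Since
δ(B_s) = dim(B̄_s / B_s) ≥ 0 vanishes whenever B_s is normal, in particular on the generic fibre,
which is a localization of B, (2) and (3) follow.

Depth of B_s at closed points: over a nonzero prime (ϖ), B is integrally closed and its closed
points there have height at least 2, which excludes depth zero in B/ϖB
(`fiber_eq_zero_of_isMaximal_smul`). On the generic fibre, a closed point of depth zero would be a
component of Spec B of dimension at most 1, and there are none
(`fiber_bot_eq_zero_of_isMaximal_smul`). Reducedness of B_s and finiteness of B̄_s / B_s come from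
R_s, which is normal outside finitely many closed points: R_s → B_s is an isomorphism at every
non-closed point.

For (4) and (5): R^{>1} → B is injective with finite cokernel, hence injective on all fibres outside
the zeros of some d ≠ 0 (`exists_ne_zero_injective_baseChange`), and the kernels for R and for
R^{>1} differ by a constant dimension. When A is not a field, the low-dimensional part of a reduced
R is R^1, finite over A; if it is generically separable it is unramified outside finitely many
points, which makes R_t reduced there. -/

noncomputable section

namespace INNS

open nonZeroDivisors TensorProduct

universe u v w

/-! ### Dimension of a finite-dimensional module as a sum over maximal ideals -/

section LocalizedFinrank

variable (k : Type*) [Field k] {C : Type*} [CommRing C] [Algebra k C]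

/-- The `k`-dimensions of the localizations of `N` at the maximal ideals of `C` are finite, almost
all zero, and add up to the `k`-dimension of `N`. -/
def LocalizationsAddUp (N : Type*) [AddCommGroup N] [Module C N] [Module k N] : Prop :=
  (∀ m : MaximalSpectrum C, Module.Finite k (Localization.AtPrime m.asIdeal ⊗[C] N)) ∧
  {m : MaximalSpectrum C |
    Module.finrank k (Localization.AtPrime m.asIdeal ⊗[C] N) ≠ 0}.Finite ∧
  ∑ᶠ m : MaximalSpectrum C, Module.finrank k (Localization.AtPrime m.asIdeal ⊗[C] N) =
    Module.finrank k N

variable {k}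

lemma finrank_eq_add_of_exact {V₁ V₂ V₃ : Type*} [AddCommGroup V₁] [AddCommGroup V₂]
    [AddCommGroup V₃] [Module k V₁] [Module k V₂] [Module k V₃] [Module.Finite k V₁]
    [Module.Finite k V₃] (f : V₁ →ₗ[k] V₂) (g : V₂ →ₗ[k] V₃) (hf : Function.Injective f)
    (hg : Function.Surjective g) (hfg : Function.Exact f g) :
    Module.Finite k V₂ ∧ Module.finrank k V₂ = Module.finrank k V₁ + Module.finrank k V₃ := by
  have h1 : Module.Finite k (LinearMap.range f) := inferInstance
  have h2 : Module.Finite k (V₂ ⧸ LinearMap.range f) := by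
    have e : (V₂ ⧸ LinearMap.range f) ≃ₗ[k] V₃ :=
      (Submodule.quotEquivOfEq _ _ (LinearMap.exact_iff.mp hfg).symm).trans
        (g.quotKerEquivOfSurjective hg)
    exact Module.Finite.equiv e.symm
  have h3 : Module.Finite k V₂ := Module.Finite.of_submodule_quotient (LinearMap.range f)
  refine ⟨h3, ?_⟩
  have := LinearMap.finrank_range_add_finrank_ker g
  rw [LinearMap.range_eq_top.mpr hg, finrank_top, LinearMap.exact_iff.mp hfg,
    LinearMap.finrank_range_of_inj hf] at this
  omega

lemma LocalizationsAddUp.of_exact {N₁ N₂ N₃ : Type*} [AddCommGroup N₁] [AddCommGroup N₂]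
    [AddCommGroup N₃] [Module C N₁] [Module C N₂] [Module C N₃] [Module k N₁] [Module k N₂]
    [Module k N₃] [IsScalarTower k C N₁] [IsScalarTower k C N₂] [IsScalarTower k C N₃]
    [Module.Finite k N₁] [Module.Finite k N₃]
    (f : N₁ →ₗ[C] N₂) (g : N₂ →ₗ[C] N₃) (hf : Function.Injective f)
    (hg : Function.Surjective g) (hfg : Function.Exact f g)
    (h₁ : LocalizationsAddUp k (C := C) N₁) (h₃ : LocalizationsAddUp k (C := C) N₃) :
    LocalizationsAddUp k (C := C) N₂ := by
  have key (m : MaximalSpectrum C) := by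
    have := h₁.1 m
    have := h₃.1 m
    exact finrank_eq_add_of_exact (k := k)
      (((AlgebraTensorModule.lTensor (Localization.AtPrime m.asIdeal)
        (Localization.AtPrime m.asIdeal) f).restrictScalars k))
      (((AlgebraTensorModule.lTensor (Localization.AtPrime m.asIdeal)
        (Localization.AtPrime m.asIdeal) g).restrictScalars k))
      (Module.Flat.lTensor_preserves_injective_linearMap f hf)
      (LinearMap.lTensor_surjective _ hg) (lTensor_exact _ hfg hg)
  refine ⟨fun m ↦ (key m).1, ?_, ?_⟩
  · refine (h₁.2.1.union h₃.2.1).subset fun m hm ↦ ?_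
    simp only [Set.mem_union, Set.mem_ofPred_eq, (key m).2] at hm ⊢
    omega
  · rw [finsum_congr fun m ↦ (key m).2, finsum_add_distrib h₁.2.1 h₃.2.1, h₁.2.2, h₃.2.2]
    exact (finrank_eq_add_of_exact (f.restrictScalars k) (g.restrictScalars k) hf hg hfg).2.symm

/-- Here N is C/I for a maximal ideal I. At any other maximal ideal some element of I becomes
invertible and kills N; elements outside I already act bijectively on N, so N is its own
localization at I. -/
lemma LocalizationsAddUp.of_simple {N : Type*} [AddCommGroup N] [Module C N] [Module k N]
    [IsScalarTower k C N] [Module.Finite k N] [IsSimpleModule C N] :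
    LocalizationsAddUp k (C := C) N := by
  obtain ⟨I, hI, ⟨e⟩⟩ := isSimpleModule_iff_quot_maximal.mp ‹IsSimpleModule C N›
  have hmem (c : C) (hc : c ∈ I) (x : N) : c • x = 0 := by
    apply e.injective
    obtain ⟨y, hy⟩ := Ideal.Quotient.mk_surjective (e x)
    rw [map_smul, ← hy, map_zero]
    change Ideal.Quotient.mk I (c * y) = 0
    exact Ideal.Quotient.eq_zero_iff_mem.mpr (I.mul_mem_right _ hc)
  let m₀ : MaximalSpectrum C := ⟨I, hI⟩
  have hne (m : MaximalSpectrum C) (hm : m ≠ m₀) :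
      Subsingleton (Localization.AtPrime m.asIdeal ⊗[C] N) := by
    obtain ⟨u, huI, hum⟩ : ∃ u ∈ I, u ∉ m.asIdeal := by
      by_contra! h
      exact hm (MaximalSpectrum.ext (hI.eq_of_le m.isMaximal.ne_top h).symm)
    refine subsingleton_of_forall_eq 0 fun z ↦ ?_
    induction z with
    | zero => rfl
    | add x y hx hy => rw [hx, hy, add_zero]
    | tmul a x =>
      obtain ⟨b, hb⟩ := (IsLocalization.map_units (Localization.AtPrime m.asIdeal)
        (⟨u, hum⟩ : m.asIdeal.primeCompl)).exists_right_inv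
      have hb : u • b = 1 := by rw [Algebra.smul_def]; exact hb
      calc a ⊗ₜ[C] x = (u • (b * a)) ⊗ₜ[C] x := by rw [← smul_mul_assoc, hb, one_mul]
        _ = 0 := by rw [TensorProduct.smul_tmul, hmem u huI, TensorProduct.tmul_zero]
  have : IsLocalizedModule m₀.asIdeal.primeCompl (LinearMap.id : N →ₗ[C] N) := by
    refine ⟨fun u ↦ ?_, fun y ↦ ⟨⟨y, 1⟩, by simp⟩, fun h ↦ ⟨1, by simpa using h⟩⟩
    rw [Module.End.isUnit_iff]
    obtain ⟨v, hv⟩ := Ideal.Quotient.exists_inv (I := I) (a := Ideal.Quotient.mk I u.1)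
      (fun h ↦ u.2 (Ideal.Quotient.eq_zero_iff_mem.mp h))
    obtain ⟨v, rfl⟩ := Ideal.Quotient.mk_surjective v
    have h1 (x : N) : (u.1 * v) • x = x := by
      have : (u.1 * v - 1) • x = 0 := hmem _ (Ideal.Quotient.eq_zero_iff_mem.mp (by simp [hv])) x
      rwa [sub_smul, one_smul, sub_eq_zero] at this
    refine ⟨fun x y hxy ↦ ?_, fun x ↦ ⟨v • x, ?_⟩⟩
    · simp only [Module.algebraMap_end_apply] at hxy
      rw [← h1 x, ← h1 y, mul_comm, mul_smul, mul_smul]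
      exact congrArg _ hxy
    · simp only [Module.algebraMap_end_apply]
      exact (smul_smul _ _ _).trans (h1 x)
  let e₀ : (Localization.AtPrime m₀.asIdeal ⊗[C] N) ≃ₗ[C] N :=
    IsLocalizedModule.linearEquiv m₀.asIdeal.primeCompl
      (TensorProduct.mk C (Localization.AtPrime m₀.asIdeal) N 1) LinearMap.id
  let e₁ := e₀.restrictScalars k
  have hfin (m : MaximalSpectrum C) :
      Module.Finite k (Localization.AtPrime m.asIdeal ⊗[C] N) := by
    by_cases hm : m = m₀
    · subst hm; exact Module.Finite.equiv e₁.symm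
    · have := hne m hm; infer_instance
  refine ⟨hfin, (Set.finite_singleton m₀).subset fun m hm ↦ ?_, ?_⟩
  · by_contra h
    have := hne m h
    exact hm Module.finrank_zero_of_subsingleton
  · rw [finsum_eq_single _ m₀ fun m hm ↦ by
      have := hne m hm; exact Module.finrank_zero_of_subsingleton]
    exact e₁.finrank_eq

lemma LocalizationsAddUp.of_finite (N : Type*) [AddCommGroup N] [Module C N] [Module k N]
    [IsScalarTower k C N] [Module.Finite k N] : LocalizationsAddUp k (C := C) N := by
  have h : IsFiniteLength C N := by
    rw [isFiniteLength_iff_isNoetherian_isArtinian]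
    exact ⟨isNoetherian_of_tower k inferInstance, isArtinian_of_tower k inferInstance⟩
  -- The `k`-structure is generalized so that the induction hypothesis applies to a submodule with
  -- its own `k`-structure.
  suffices H : ∀ [Module k N] [IsScalarTower k C N] [Module.Finite k N],
      LocalizationsAddUp k (C := C) N from H
  induction h with
  | @of_subsingleton M _ _ _ =>
    intro _ _ _
    have h0 (m : MaximalSpectrum C) :=
      Module.finrank_zero_of_subsingleton (R := k) (M := Localization.AtPrime m.asIdeal ⊗[C] M)
    have h1 := Module.finrank_zero_of_subsingleton (R := k) (M := M)
    refine ⟨fun m ↦ inferInstance, by simp [h0], by simp [h0, h1]⟩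
  | @of_simple_quotient M _ _ N _ _ ih =>
    intro _ _ _
    have : Module.Finite k N := Module.Finite.of_injective (N.subtype.restrictScalars k)
      N.injective_subtype
    have : Module.Finite k (M ⧸ N) := Module.Finite.of_surjective (N.mkQ.restrictScalars k)
      N.mkQ_surjective
    exact .of_exact N.subtype N.mkQ N.injective_subtype N.mkQ_surjective
      (LinearMap.exact_subtype_mkQ N) ih .of_simple

/-- Version of `LocalizationsAddUp` for arbitrary models of the localizations. -/
lemma finsum_finrank_isLocalizedModule (N : Type*) [AddCommGroup N] [Module C N] [Module k N]
    [IsScalarTower k C N] [Module.Finite k N] (N' : MaximalSpectrum C → Type*)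
    [∀ m, AddCommGroup (N' m)] [∀ m, Module C (N' m)] [∀ m, Module k (N' m)]
    [∀ m, IsScalarTower k C (N' m)] (f : ∀ m, N →ₗ[C] N' m)
    (hf : ∀ m, IsLocalizedModule m.asIdeal.primeCompl (f m)) :
    (∀ m, Module.Finite k (N' m)) ∧ {m | Module.finrank k (N' m) ≠ 0}.Finite ∧
      ∑ᶠ m, Module.finrank k (N' m) = Module.finrank k N := by
  have h := LocalizationsAddUp.of_finite (k := k) (C := C) N
  let e (m : MaximalSpectrum C) : (Localization.AtPrime m.asIdeal ⊗[C] N) ≃ₗ[k] N' m :=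
    (IsLocalizedModule.linearEquiv m.asIdeal.primeCompl
      (TensorProduct.mk C (Localization.AtPrime m.asIdeal) N 1) (f m)).restrictScalars k
  have he (m) := (e m).finrank_eq
  simp only [LocalizationsAddUp, he] at h
  exact ⟨fun m ↦ have := h.1 m; Module.Finite.equiv (e m), h.2⟩

end LocalizedFinrank

/-! ### Criteria that identify or cover a normalization -/

section Normalization

/-- In a ring equal to its total quotient ring m consists of zero divisors, so m is the annihilator
of some x. If x lay in p ⊆ m then x² = 0, against reducedness; so x ∉ p, and mx = 0 ⊆ p gives m ⊆ p.
This makes total quotient rings of reduced Noetherian rings zero-dimensional, hence Artinian. -/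
lemma mem_minimalPrimes_of_isMaximal_of_isFractionRing {K : Type*} [CommRing K]
    [IsNoetherianRing K] [IsReduced K] [IsFractionRing K K] (p m : Ideal K) [p.IsPrime]
    [m.IsMaximal] (h : p ≤ m) : p = m := by
  obtain ⟨_, x, hx⟩ := isAssociatedPrime_iff.mp
    (AssociatedPrimes.mem_iff.mp (Ideal.IsMaximal.mem_associatedPrimes_of_isFractionRing K m))
  have hmem (a : K) : a ∈ m ↔ a * x = 0 := by
    rw [hx]; simp [Submodule.mem_colon_singleton]
  have hx0 : x ≠ 0 := by
    rintro rfl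
    exact (Ideal.IsPrime.ne_top ‹_›) ((Ideal.eq_top_iff_one m).mpr ((hmem 1).mpr (by simp)))
  refine le_antisymm h fun a ha ↦ ?_
  have hxp : x ∉ p := fun hxp ↦ hx0 (by
    have := (hmem x).mp (h hxp)
    exact IsReduced.eq_zero x ⟨2, by rw [pow_two]; exact this⟩)
  have : a * x ∈ p := by rw [(hmem a).mp ha]; exact p.zero_mem
  exact ((Ideal.IsPrime.mem_or_mem ‹_› this).resolve_right hxp)

instance isArtinianRing_fractionRing (R : Type*) [CommRing R] [IsNoetherianRing R] [IsReduced R] :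
    IsArtinianRing (FractionRing R) := by
  have : IsNoetherianRing (FractionRing R) :=
    IsLocalization.isNoetherianRing R⁰ (FractionRing R) inferInstance
  have : Ring.KrullDimLE 0 (FractionRing R) := Ring.krullDimLE_zero_iff.mpr fun p hp ↦ by
    obtain ⟨m, hm, hpm⟩ := Ideal.exists_le_maximal p hp.ne_top
    rwa [mem_minimalPrimes_of_isMaximal_of_isFractionRing p m hpm]
  exact IsNoetherianRing.isArtinianRing_of_krullDimLE_zero

instance isReduced_red (R : Type*) [CommRing R] : IsReduced (Red R) :=
  (Ideal.isRadical_iff_quotient_reduced _).mp (Ideal.radical_isRadical _)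

lemma red_mk_eq_zero {R : Type*} [CommRing R] {x : R} :
    algebraMap R (Red R) x = 0 ↔ IsNilpotent x := by
  rw [Ideal.Quotient.algebraMap_eq, Ideal.Quotient.eq_zero_iff_mem, mem_nilradical]

lemma red_mk_mem_nonZeroDivisors {R : Type*} [CommRing R] {x : R} :
    algebraMap R (Red R) x ∈ (Red R)⁰ ↔ ∀ y : R, IsNilpotent (x * y) → IsNilpotent y := by
  rw [mem_nonZeroDivisors_iff_right]
  constructor
  · intro h y hy
    rw [← red_mk_eq_zero] at hy ⊢
    exact h _ (by rw [mul_comm, ← map_mul, hy])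
  · intro h y hy
    obtain ⟨y, rfl⟩ := Ideal.Quotient.mk_surjective y
    change algebraMap R (Red R) y = 0
    change algebraMap R (Red R) y * _ = 0 at hy
    rw [← map_mul, mul_comm, red_mk_eq_zero] at hy
    exact red_mk_eq_zero.mpr (h y hy)

/-- By `hker` and `hunit` the total quotient ring of the reduction of L embeds in Q. Since E is
integral over L and integrally closed in Q, it is the integral closure of L there and receives the
normalization; `hsurj` writes each element of E as a fraction over L, so nothing is missed. -/
theorem exists_normalization_bijective {L E Q : Type*} [CommRing L] [CommRing E] [CommRing Q]
    [Algebra L E] [Algebra E Q] [Algebra L Q] [IsScalarTower L E Q] [IsReduced E]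
    [IsIntegrallyClosedIn E Q] [Algebra.IsIntegral L E]
    (hker : ∀ x : L, algebraMap L E x = 0 → IsNilpotent x)
    (hunit : ∀ r : L, algebraMap L (Red L) r ∈ (Red L)⁰ → IsUnit (algebraMap L Q r))
    (hsurj : ∀ e : E, ∃ c l : L, algebraMap L (Red L) c ∈ (Red L)⁰ ∧
      algebraMap L E l = algebraMap L E c * e) :
    ∃ f : Normalization L →ₐ[L] E, Function.Bijective f := by
  have hinj : Function.Injective (algebraMap E Q) := IsIntegralClosure.algebraMap_injective E E Q
  let g : Red L →ₐ[L] Q := Ideal.Quotient.liftₐ (nilradical L) (Algebra.ofId L Q) fun a ha ↦ by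
    have : IsNilpotent (algebraMap L E a) := (mem_nilradical.mp ha).map _
    rw [Algebra.ofId_apply, IsScalarTower.algebraMap_apply L E Q, this.eq_zero, map_zero]
  have hgmk (a : L) : g (algebraMap L (Red L) a) = algebraMap L Q a := g.commutes a
  have hginj : Function.Injective g := by
    rw [injective_iff_map_eq_zero]
    intro a ha
    obtain ⟨a, rfl⟩ := Ideal.Quotient.mk_surjective a
    change g (algebraMap L (Red L) a) = 0 at ha
    rw [hgmk, IsScalarTower.algebraMap_apply L E Q] at ha
    exact red_mk_eq_zero.mpr (hker a (hinj (by rw [ha, map_zero])))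
  have hgunit (y : (Red L)⁰) : IsUnit (g y) := by
    obtain ⟨y, hy⟩ := y
    obtain ⟨a, rfl⟩ := Ideal.Quotient.mk_surjective y
    change IsUnit (g (algebraMap L (Red L) a))
    rw [hgmk]; exact hunit a hy
  let j : FractionRing (Red L) →ₐ[L] Q := IsLocalization.liftAlgHom (M := (Red L)⁰) (f := g) hgunit
  have hj (a : Red L) : j (algebraMap _ _ a) = g a := by
    simp [j]
  have hjinj : Function.Injective j := by
    rw [injective_iff_map_eq_zero]
    intro x hx
    obtain ⟨a, b, rfl⟩ := IsLocalization.exists_mk'_eq (Red L)⁰ x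
    have h1 : j (IsLocalization.mk' _ a b) * g b = g a := by
      rw [← hj, ← hj, ← map_mul, IsLocalization.mk'_spec]
    rw [hx, zero_mul] at h1
    have : a = 0 := hginj (by rw [← h1, map_zero])
    rw [this, IsLocalization.mk'_zero]
  have hIC : IsIntegralClosure E L Q := IsIntegralClosure.of_isIntegrallyClosedIn
  have hLint (x : FractionRing (Red L)) : IsIntegral (Red L) x ↔ IsIntegral L x :=
    ⟨fun h ↦ isIntegral_trans x h, fun h ↦ h.tower_top⟩
  have hex (x : Normalization L) : ∃ e : E, algebraMap E Q e = j x := by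
    apply hIC.isIntegral_iff.mp
    exact ((hLint x.1).mp x.2).map j
  choose f hf using hex
  let F : Normalization L →ₐ[L] E :=
    { toFun := f
      map_one' := hinj (by rw [hf]; simp)
      map_mul' := fun x y ↦ hinj (by simp [hf])
      map_zero' := hinj (by rw [hf]; simp)
      map_add' := fun x y ↦ hinj (by simp [hf])
      commutes' := fun r ↦ hinj (by
        rw [hf, ← IsScalarTower.algebraMap_apply L E Q]
        exact j.commutes r) }
  refine ⟨F, ?_, ?_⟩
  · intro x y hxy
    apply Subtype.ext
    apply hjinj
    rw [← hf, ← hf]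
    exact congrArg _ hxy
  · intro e
    obtain ⟨c, l, hc, hl⟩ := hsurj e
    let x : FractionRing (Red L) := IsLocalization.mk' _ (algebraMap L (Red L) l)
      (⟨algebraMap L (Red L) c, hc⟩ : (Red L)⁰)
    have hx : j x = algebraMap E Q e := by
      apply (hunit c hc).mul_left_injective
      simp only
      have hxc : x * algebraMap _ _ (algebraMap L (Red L) c) =
          algebraMap _ _ (algebraMap L (Red L) l) := IsLocalization.mk'_spec _ _ _
      rw [← hgmk c, ← hj, ← map_mul, hxc, hj, hgmk, hj, hgmk,
        IsScalarTower.algebraMap_apply L E Q, hl, IsScalarTower.algebraMap_apply L E Q, map_mul,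
        mul_comm]
    have hxi : IsIntegral (Red L) x := by
      rw [hLint, ← isIntegral_algHom_iff j hjinj, hx]
      exact (Algebra.IsIntegral.isIntegral e).algebraMap
    exact ⟨⟨x, hxi⟩, hinj (by rw [← hx]; exact hf _)⟩

/-- A reduced Artinian ring is a product of fields, hence von Neumann regular. The proof stabilizes
the powers of z and removes the remaining nilpotent. -/
lemma exists_eq_mul_self_mul {K : Type*} [CommRing K] [IsArtinianRing K] [IsReduced K] (z : K) :
    ∃ w, z = z * z * w := by
  obtain ⟨n, w, hw⟩ := IsArtinian.exists_pow_succ_smul_dvd z (1 : K)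
  refine ⟨w, ?_⟩
  simp only [smul_eq_mul, mul_one] at hw
  have h : (z - z * z * w) ^ (n + 1) = 0 := by
    have : z - z * z * w = z * (1 - z * w) := by ring
    rw [this, mul_pow, pow_succ (1 - z * w)]
    have h2 : z ^ (n + 1) * (1 - z * w) = 0 := by
      have : z ^ (n + 1) * (1 - z * w) = z * (z ^ n - z ^ (n + 1) * w) := by ring
      rw [this, hw]; simp
    linear_combination (1 - z * w) ^ n * h2
  exact sub_eq_zero.mp (pow_eq_zero_iff (Nat.succ_ne_zero n) |>.mp h)

open Polynomial in
-- By `hreg` the total quotient rings map to each other, and the common denominator in `hcond` makes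
-- that map surjective. An integral element then has some lift, which an idempotent corrects to an
-- integral one: geometrically, it is extended by zero to the remaining components.
theorem exists_normalization_surjective {C C' : Type*} [CommRing C] [CommRing C'] [Algebra C C']
    [IsNoetherianRing C] [Algebra.IsIntegral C C']
    (hreg : ∀ r : C, algebraMap C (Red C) r ∈ (Red C)⁰ →
      algebraMap C' (Red C') (algebraMap C C' r) ∈ (Red C')⁰)
    (hcond : ∃ c : C, algebraMap C' (Red C') (algebraMap C C' c) ∈ (Red C')⁰ ∧
      ∀ y : C', ∃ l, algebraMap C C' l = algebraMap C C' c * y) :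
    ∃ f : Normalization C →ₐ[C] Normalization C', Function.Surjective f := by
  let K := FractionRing (Red C)
  let K' := FractionRing (Red C')
  have hinj' : Function.Injective (algebraMap (Red C') K') := IsFractionRing.injective _ _
  have hCK' (r : C) : algebraMap C K' r =
      algebraMap (Red C') K' (algebraMap C' (Red C') (algebraMap C C' r)) := rfl
  let g : Red C →ₐ[C] K' := Ideal.Quotient.liftₐ (nilradical C) (Algebra.ofId C K') fun a ha ↦ by
    exact ((mem_nilradical.mp ha).map (Algebra.ofId C K')).eq_zero
  have hgmk (a : C) : g (algebraMap C (Red C) a) = algebraMap C K' a := g.commutes a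
  have hgunit (y : (Red C)⁰) : IsUnit (g y) := by
    obtain ⟨y, hy⟩ := y
    obtain ⟨a, rfl⟩ := Ideal.Quotient.mk_surjective y
    change IsUnit (g (algebraMap C (Red C) a))
    rw [hgmk, hCK']
    exact IsLocalization.map_units K' (⟨_, hreg a hy⟩ : (Red C')⁰)
  let j : K →ₐ[C] K' := IsLocalization.liftAlgHom (M := (Red C)⁰) (f := g) hgunit
  have hjC (r : C) : j (algebraMap C K r) = algebraMap C K' r := j.commutes r
  -- a nonzerodivisor of `K'` in the range of `j` is invertible in the range
  have : IsArtinianRing j.range := by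
    have h : IsArtinianRing K := inferInstance
    exact Function.Surjective.isArtinianRing (f := j.rangeRestrict) j.rangeRestrict_surjective
  have hinv (x y : K') (hx : x ∈ j.range) (hxr : IsUnit x) (hxy : x * y ∈ j.range) :
      y ∈ j.range := by
    have : IsUnit (⟨x, hx⟩ : j.range) := by
      refine IsArtinianRing.isUnit_of_mem_nonZeroDivisors
        (mem_nonZeroDivisors_iff_right.mpr fun z hz ↦ Subtype.ext ?_)
      exact (hxr.mul_left_eq_zero).mp (congrArg Subtype.val hz)
    obtain ⟨v, hv⟩ := this.exists_right_inv
    have hv' : x * v.1 = 1 := congrArg Subtype.val hv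
    have : y = v.1 * (x * y) := by linear_combination (-y) * hv'
    rw [this]
    exact mul_mem v.2 hxy
  have hC (r : C) : algebraMap C K' r ∈ j.range := ⟨algebraMap C K r, hjC r⟩
  have hC' (y : C') : algebraMap C' K' y ∈ j.range := by
    obtain ⟨c, hc, hcy⟩ := hcond
    obtain ⟨l, hl⟩ := hcy y
    refine hinv (algebraMap C K' c) _ (hC c)
      (IsLocalization.map_units K' (⟨_, hc⟩ : (Red C')⁰)) ?_
    have : algebraMap C K' c * algebraMap C' K' y = algebraMap C K' l := by
      rw [IsScalarTower.algebraMap_apply C C' K', IsScalarTower.algebraMap_apply C C' K',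
        ← map_mul, hl]
    rw [this]; exact hC l
  have hjsurj (y : K') : ∃ x, j x = y := by
    obtain ⟨a, b, rfl⟩ := IsLocalization.exists_mk'_eq (Red C')⁰ y
    have hR (a : Red C') : algebraMap _ K' a ∈ j.range := by
      obtain ⟨a, rfl⟩ := Ideal.Quotient.mk_surjective a
      exact hC' a
    refine hinv (algebraMap _ K' b.1) _ (hR _) (IsLocalization.map_units K' b) ?_
    rw [mul_comm, IsLocalization.mk'_spec]; exact hR _
  have hint (x : K) (hx : IsIntegral (Red C) x) : IsIntegral (Red C') (j x) :=
    ((isIntegral_trans (R := C) x hx).map j).tower_top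
  let F : Normalization C →ₐ[C] Normalization C' :=
    { toFun := fun x ↦ ⟨j x, hint x x.2⟩
      map_one' := Subtype.ext (map_one j)
      map_mul' := fun x y ↦ Subtype.ext (map_mul j _ _)
      map_zero' := Subtype.ext (map_zero j)
      map_add' := fun x y ↦ Subtype.ext (map_add j _ _)
      commutes' := fun r ↦ Subtype.ext (j.commutes r) }
  refine ⟨F, fun ⟨y, hy⟩ ↦ ?_⟩
  have : Algebra.IsIntegral C (Red C') := Algebra.IsIntegral.trans (R := C) C'
  obtain ⟨p, hp, hpy⟩ : IsIntegral C y := isIntegral_trans (R := C) y hy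
  change aeval y p = 0 at hpy
  obtain ⟨q, rfl⟩ := hjsurj y
  obtain ⟨w, hw⟩ := exists_eq_mul_self_mul (aeval q p)
  have hjz : j (aeval q p) = 0 := by rw [← aeval_algHom_apply, hpy]
  -- The value z of p at the lift q maps to 0 and satisfies z = z²w, so e = 1 − zw is an idempotent
  -- that kills z and maps to 1. Then eq still lifts y, and it is a root of the monic polynomial X·p
  -- because e·p(eq) = e·p(q) = 0.
  let e : K := 1 - aeval q p * w
  have he : e * e = e := by
    simp only [e]; linear_combination (-w) * hw
  have hez : e * aeval q p = 0 := by
    simp only [e]; linear_combination hw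
  have hje : j e = 1 := by simp [e, hjz]
  have hpow (n : ℕ) : e * (e * q) ^ n = e * q ^ n := by
    induction n with
    | zero => simp
    | succ n ih => rw [pow_succ, ← mul_assoc, ih, pow_succ]; linear_combination (q ^ n * q) * he
  have hep : e * aeval (e * q) p = e * aeval q p := by
    rw [aeval_eq_sum_range, aeval_eq_sum_range, Finset.mul_sum, Finset.mul_sum]
    refine Finset.sum_congr rfl fun i _ ↦ ?_
    rw [mul_smul_comm, mul_smul_comm, hpow]
  have hroot : aeval (e * q) (X * p) = 0 := by
    rw [map_mul, aeval_X, mul_right_comm, hep, hez, zero_mul]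
  have hxC : IsIntegral C (e * q) := ⟨X * p, monic_X.mul hp, hroot⟩
  exact ⟨⟨e * q, hxC.tower_top⟩, Subtype.ext (by change j (e * q) = j q; rw [map_mul, hje, one_mul])⟩

end Normalization

/-! ### The local invariants via a map to a normal algebra of positive depth -/

section Local

/-- The zero divisors on E are the union of finitely many associated primes, so this is prime
avoidance. -/
lemma exists_mem_forall_smul_eq_zero {C E : Type*} [CommRing C] [IsNoetherianRing C]
    [AddCommGroup E] [Module C E] [Module.Finite C E] (I : Ideal C)
    (h : ∀ p ∈ associatedPrimes C E, ¬ I ≤ p) : ∃ c ∈ I, ∀ x : E, c • x = 0 → x = 0 := by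
  by_contra! H
  have hsub : (I : Set C) ⊆ ⋃ p ∈ associatedPrimes C E, (id p : Ideal C) := by
    intro c hc
    obtain ⟨x, hx, hx0⟩ := H c hc
    have := biUnion_associatedPrimes_eq_zero_divisors C E
    simp only [id]
    rw [this]
    exact ⟨x, hx0, hx⟩
  obtain ⟨p, hp, hle⟩ := (I.subset_union_prime_finite (associatedPrimes.finite C E) (f := id) 0 0
    fun _ h _ _ ↦ h.isPrime).1 hsub
  exact h p hp hle

/-- V has finite length over L, so the submodules given by the powers of the maximal ideal
stabilize, and Nakayama makes the stable one zero. -/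
lemma exists_pow_maximalIdeal_smul_eq_zero (k : Type*) {L V : Type*} [Field k] [CommRing L]
    [IsLocalRing L] [Algebra k L] [AddCommGroup V] [Module L V] [Module k V]
    [IsScalarTower k L V] [Module.Finite k V] :
    ∃ n, ∀ a ∈ IsLocalRing.maximalIdeal L ^ n, ∀ v : V, a • v = 0 := by
  have : IsArtinian L V := isArtinian_of_tower k inferInstance
  have : IsNoetherian L V := isNoetherian_of_tower k inferInstance
  let f : ℕ →o (Submodule L V)ᵒᵈ :=
    ⟨fun n ↦ OrderDual.toDual (IsLocalRing.maximalIdeal L ^ n • (⊤ : Submodule L V)),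
      fun a b hab ↦ Submodule.smul_mono_left (Ideal.pow_le_pow_right hab)⟩
  obtain ⟨n, hn⟩ := IsArtinian.monotone_stabilizes f
  have h1 : IsLocalRing.maximalIdeal L ^ n • (⊤ : Submodule L V) =
      IsLocalRing.maximalIdeal L ^ (n + 1) • (⊤ : Submodule L V) := hn (n + 1) (Nat.le_succ n)
  have h2 : IsLocalRing.maximalIdeal L ^ n • (⊤ : Submodule L V) = ⊥ := by
    refine Submodule.eq_bot_of_le_smul_of_le_jacobson_bot (IsLocalRing.maximalIdeal L) _
      (IsNoetherian.noetherian _) ?_ (IsLocalRing.maximalIdeal_le_jacobson _)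
    rw [← Submodule.mul_smul, ← pow_succ']
    exact h1.le
  refine ⟨n, fun a ha v ↦ ?_⟩
  have : a • v ∈ IsLocalRing.maximalIdeal L ^ n • (⊤ : Submodule L V) :=
    Submodule.smul_mem_smul ha trivial
  rwa [h2] at this

lemma eq_zero_of_pow_smul_eq_zero {L E : Type*} [CommRing L] [AddCommGroup E] [Module L E]
    (m : Ideal L) (h : ∀ x : E, (∀ a ∈ m, a • x = 0) → x = 0) (n : ℕ) :
    ∀ x : E, (∀ a ∈ m ^ n, a • x = 0) → x = 0 := by
  induction n with
  | zero => intro x hx; simpa using hx 1 (by simp)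
  | succ n ih =>
    refine fun x hx ↦ h x fun b hb ↦ ih _ fun a ha ↦ ?_
    rw [smul_smul]
    exact hx _ (by rw [pow_succ]; exact Ideal.mul_mem_mul ha hb)

lemma mem_hZero_iff {L : Type*} [CommRing L] [IsLocalRing L] {x : L} :
    x ∈ HZero L ↔ ∃ n, ∀ a ∈ IsLocalRing.maximalIdeal L ^ n, a * x = 0 := by
  rw [HZero, Ideal.primaryComponent_mem]
  simp [Submodule.mem_torsionBySet_iff]

variable {k L E Q : Type*} [Field k] [CommRing L] [IsLocalRing L] [IsNoetherianRing L]
  [Algebra k L] [CommRing E] [Algebra L E] [Algebra k E] [IsScalarTower k L E] [IsReduced E]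
  [Module.Finite L E] [CommRing Q] [Algebra E Q] [IsIntegrallyClosedIn E Q]

variable (k Q) in
-- The kernel is finite-dimensional, so a power of the maximal ideal kills it; conversely E has no
-- torsion for such powers, so `HZero L` dies in E. The cokernel is also killed by a power, which
-- contains an E-regular element c: this c is a common denominator for E over L, and E becomes the
-- normalization of L.
theorem hZero_eq_ker_and_normCoker_equiv
    (h0 : ∀ x : E, (∀ a ∈ IsLocalRing.maximalIdeal L, a • x = 0) → x = 0)
    (hker : Module.Finite k (LinearMap.ker (Algebra.linearMap L E)))
    (hcoker : Module.Finite k (E ⧸ LinearMap.range (Algebra.linearMap L E)))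
    (hQ : ∀ c ∈ E⁰, IsUnit (algebraMap E Q c)) :
    (∀ x : L, x ∈ HZero L ↔ algebraMap L E x = 0) ∧
      Nonempty (NormCoker L ≃ₗ[L] E ⧸ LinearMap.range (Algebra.linearMap L E)) := by
  have h0' := eq_zero_of_pow_smul_eq_zero (IsLocalRing.maximalIdeal L) h0
  obtain ⟨n₁, hn₁⟩ := exists_pow_maximalIdeal_smul_eq_zero k
    (L := L) (V := LinearMap.ker (Algebra.linearMap L E))
  obtain ⟨n₂, hn₂⟩ := exists_pow_maximalIdeal_smul_eq_zero k
    (L := L) (V := E ⧸ LinearMap.range (Algebra.linearMap L E))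
  have hkerm (x : L) (hx : algebraMap L E x = 0) :
      ∀ a ∈ IsLocalRing.maximalIdeal L ^ n₁, a * x = 0 := fun a ha ↦
    congrArg Subtype.val (hn₁ a ha ⟨x, hx⟩)
  have hcokm (e : E) (a : L) (ha : a ∈ IsLocalRing.maximalIdeal L ^ n₂) :
      ∃ l, algebraMap L E l = algebraMap L E a * e := by
    have := hn₂ a ha (Submodule.Quotient.mk e)
    rw [← Submodule.Quotient.mk_smul, Submodule.Quotient.mk_eq_zero] at this
    obtain ⟨l, hl⟩ := this
    exact ⟨l, by rw [← Algebra.smul_def]; exact hl⟩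
  refine ⟨fun x ↦ ⟨fun hx ↦ ?_, fun hx ↦ mem_hZero_iff.mpr ⟨n₁, hkerm x hx⟩⟩, ?_⟩
  · obtain ⟨n, hn⟩ := mem_hZero_iff.mp hx
    refine h0' n _ fun a ha ↦ ?_
    rw [Algebra.smul_def, ← map_mul, hn a ha, map_zero]
  -- A nilpotent maximal ideal is treated apart: E is then 0, the kernel is all of L and is not nil
  -- unless L = 0, so E need not be the normalization. Still, both cokernels vanish, since
  -- nonzerodivisors of the reduction come from units of L.
  by_cases hnil : ∃ n, IsLocalRing.maximalIdeal L ^ n = ⊥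
  · obtain ⟨n, hn⟩ := hnil
    have hE : Subsingleton E := subsingleton_of_forall_eq 0 fun x ↦ h0' n x fun a ha ↦ by
      rw [hn, Ideal.mem_bot] at ha
      rw [ha, zero_smul]
    have hsurj : Function.Surjective (algebraMap L (Normalization L)) := by
      intro y
      have hunit (z : L) (hz : algebraMap L (Red L) z ∈ (Red L)⁰) : IsUnit z := by
        by_contra hzu
        have hz1 : z ^ n = 0 := by
          have := Ideal.pow_mem_pow ((IsLocalRing.mem_maximalIdeal z).mpr hzu) n
          rwa [hn] at this
        have := red_mk_mem_nonZeroDivisors.mp hz 1 (by rw [mul_one]; exact ⟨n, hz1⟩)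
        rw [IsNilpotent] at this
        simp at this
      obtain ⟨a, b, hab⟩ := IsLocalization.exists_mk'_eq (Red L)⁰ y.1
      obtain ⟨b, hb⟩ := b
      obtain ⟨a, rfl⟩ := Ideal.Quotient.mk_surjective a
      obtain ⟨b, rfl⟩ := Ideal.Quotient.mk_surjective b
      obtain ⟨v, hv⟩ := (hunit b hb).exists_right_inv
      refine ⟨a * v, Subtype.ext ?_⟩
      change algebraMap (Red L) (FractionRing (Red L)) (algebraMap L (Red L) (a * v)) = y.1
      rw [← hab, IsLocalization.eq_mk'_iff_mul_eq, ← map_mul]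
      congr 1
      change algebraMap L (Red L) (a * v) * algebraMap L (Red L) b = algebraMap L (Red L) a
      rw [← map_mul, mul_assoc, mul_comm v, hv, mul_one]
    have : Subsingleton (NormCoker L) :=
      Submodule.Quotient.subsingleton_iff.mpr (LinearMap.range_eq_top.mpr hsurj)
    have : Subsingleton (E ⧸ LinearMap.range (Algebra.linearMap L E)) :=
      (Submodule.mkQ_surjective _).subsingleton
    exact ⟨0, 0, fun _ ↦ Subsingleton.elim _ _, fun _ ↦ Subsingleton.elim _ _⟩
  · have hnil' (x : L) (hx : algebraMap L E x = 0) : IsNilpotent x := by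
      have hx1 := hkerm x hx
      by_cases hxu : IsUnit x
      · refine absurd ⟨n₁, (Submodule.eq_bot_iff _).mpr fun a ha ↦ ?_⟩ hnil
        exact hxu.mul_left_eq_zero.mp (hx1 a ha)
      · exact ⟨n₁ + 1, by
          rw [pow_succ]
          exact hx1 _ (Ideal.pow_mem_pow ((IsLocalRing.mem_maximalIdeal x).mpr hxu) n₁)⟩
    obtain ⟨c, hc, hcreg⟩ : ∃ c ∈ IsLocalRing.maximalIdeal L ^ n₂, ∀ x : E, c • x = 0 → x = 0 := by
      refine exists_mem_forall_smul_eq_zero _ fun p hp hle ↦ ?_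
      have hprime := hp.isPrime
      obtain ⟨_, x, hx⟩ := isAssociatedPrime_iff.mp (AssociatedPrimes.mem_iff.mp hp)
      -- A prime containing a power of the maximal ideal is the maximal ideal, which is not
      -- associated to E by `h0`.
      have hx0 : x = 0 := h0 x fun a ha ↦ by
        have : a ∈ p := hprime.le_of_pow_le hle ha
        rw [hx, Submodule.mem_colon_singleton] at this
        simpa using this
      apply hprime.ne_top
      rw [hx, hx0]
      simp
    have hred (r : L) (hr : ∀ e : E, algebraMap L E r * e = 0 → e = 0) :
        algebraMap L (Red L) r ∈ (Red L)⁰ := by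
      refine red_mk_mem_nonZeroDivisors.mpr fun y hy ↦ hnil' y (hr _ ?_)
      rw [← map_mul]
      exact (hy.map _).eq_zero
    have hcreg' (x : E) (hx : algebraMap L E c * x = 0) : x = 0 :=
      hcreg x (by rw [Algebra.smul_def]; exact hx)
    let alg : Algebra L Q := ((algebraMap E Q).comp (algebraMap L E)).toAlgebra
    have tower : IsScalarTower L E Q := .of_algebraMap_eq' rfl
    obtain ⟨f, hf⟩ := exists_normalization_bijective (L := L) (E := E) (Q := Q) hnil'
      (fun r hr ↦ by
        rw [IsScalarTower.algebraMap_apply L E Q]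
        -- A nonzerodivisor r of the reduction stays regular on E: if re = 0, then ce comes from
        -- some l with rl nilpotent, so l is nilpotent, ce = 0 and e = 0.
        refine hQ _ (mem_nonZeroDivisors_iff_right.mpr fun e he ↦ hcreg' e ?_)
        obtain ⟨l, hl⟩ := hcokm e c hc
        rw [← hl]
        refine ((red_mk_mem_nonZeroDivisors.mp hr l (hnil' _ ?_)).map (algebraMap L E)).eq_zero
        rw [map_mul, hl, mul_left_comm, mul_comm _ e, he, mul_zero])
      (fun e ↦ by
        obtain ⟨l, hl⟩ := hcokm e c hc
        exact ⟨c, l, hred c hcreg', hl⟩)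
    let e : Normalization L ≃ₐ[L] E := AlgEquiv.ofBijective f hf
    refine ⟨Submodule.Quotient.equiv _ _ e.toLinearEquiv ?_⟩
    ext x
    simp only [Submodule.mem_map, LinearMap.mem_range, Algebra.linearMap_apply]
    constructor
    · rintro ⟨_, ⟨r, rfl⟩, rfl⟩
      exact ⟨r, (e.commutes r).symm⟩
    · rintro ⟨r, rfl⟩
      exact ⟨_, ⟨r, rfl⟩, e.commutes r⟩

end Local

/-! ### Localizing integral closures, and summing the local invariants -/

section LocalizedNormal

lemma algebraMap_localization_injective {D Q : Type*} [CommRing D] [CommRing Q] [Algebra D Q]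
    (M : Submonoid D) (hinj : Function.Injective (algebraMap D Q)) : Function.Injective
      (algebraMap (Localization M) (Localization (Algebra.algebraMapSubmonoid Q M))) := by
  have : IsLocalization (Submonoid.map (algebraMap D Q) M)
      (Localization (Algebra.algebraMapSubmonoid Q M)) :=
    inferInstanceAs (IsLocalization (Algebra.algebraMapSubmonoid Q M) _)
  exact IsLocalization.map_injective_of_injective M (Localization M)
    (Localization (Algebra.algebraMapSubmonoid Q M)) hinj

/-- Three denominators are cleared: m₁ moves the element into the image of Q, m₂ makes it integral
over D inside the localization, and m₃ makes that integrality hold already in Q. The submonoid may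
contain zero divisors. -/
lemma isIntegrallyClosedIn_localization {D Q : Type*} [CommRing D] [CommRing Q] [Algebra D Q]
    [IsIntegrallyClosedIn D Q] (M : Submonoid D) :
    IsIntegrallyClosedIn (Localization M) (Localization (Algebra.algebraMapSubmonoid Q M)) := by
  have hinj : Function.Injective (algebraMap D Q) := IsIntegralClosure.algebraMap_injective D D Q
  refine isIntegrallyClosedIn_iff.mpr
    ⟨algebraMap_localization_injective M hinj, fun {s} hs ↦ ?_⟩
  obtain ⟨⟨x, _, m₁, hm₁, rfl⟩, e⟩ := IsLocalization.surj (Algebra.algebraMapSubmonoid Q M) s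
  obtain ⟨⟨m₂, hm₂⟩, hm₂s⟩ := IsIntegral.exists_multiple_integral_of_isLocalization M _ hs
  simp only [Submonoid.smul_def, Algebra.smul_def] at hm₂s
  simp only [← IsScalarTower.algebraMap_apply] at e
  obtain ⟨m₃, hm₃, hm₃s⟩ := IsLocalization.exists_isIntegral_smul_of_isIntegral_map
    (Sₘ := Localization (Algebra.algebraMapSubmonoid Q M)) M (x := m₂ • x) <| by
      simp only [Algebra.smul_def, map_mul, ← IsScalarTower.algebraMap_apply, ← e, ← mul_assoc]
      exact hm₂s.mul isIntegral_algebraMap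
  obtain ⟨d, hd⟩ := IsIntegralClosure.isIntegral_iff (A := D).mp hm₃s
  refine ⟨IsLocalization.mk' (Localization M) d
    (⟨m₃ * m₂ * m₁, mul_mem (mul_mem hm₃ hm₂) hm₁⟩ : M), ?_⟩
  have hunit : IsUnit (algebraMap D (Localization (Algebra.algebraMapSubmonoid Q M))
      (m₃ * m₂ * m₁)) := by
    rw [IsScalarTower.algebraMap_apply D (Localization M)]
    exact (IsLocalization.map_units (Localization M)
      (⟨m₃ * m₂ * m₁, mul_mem (mul_mem hm₃ hm₂) hm₁⟩ : M)).map _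
  apply hunit.mul_left_injective
  simp only
  rw [IsScalarTower.algebraMap_apply D (Localization M), ← map_mul,
    IsLocalization.mk'_spec (Localization M) d
      (⟨m₃ * m₂ * m₁, mul_mem (mul_mem hm₃ hm₂) hm₁⟩ : M),
    ← IsScalarTower.algebraMap_apply, ← IsScalarTower.algebraMap_apply,
    IsScalarTower.algebraMap_apply D Q, hd]
  simp only [Algebra.smul_def, map_mul, ← IsScalarTower.algebraMap_apply]
  rw [← e]
  ring

/-- The localization of Q is Artinian, so it suffices that c stays a nonzerodivisor; up to units
every element there comes from D, where the hypothesis on c applies. -/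
lemma isUnit_algebraMap_localization {D Q : Type*} [CommRing D] [CommRing Q] [Algebra D Q]
    [IsFractionRing D Q] [IsArtinianRing Q] (M : Submonoid D) (c : Localization M)
    (hc : c ∈ (Localization M)⁰) :
    IsUnit (algebraMap (Localization M) (Localization (Algebra.algebraMapSubmonoid Q M)) c) := by
  refine IsArtinianRing.isUnit_of_mem_nonZeroDivisors
    (mem_nonZeroDivisors_iff_right.mpr fun z hz ↦ ?_)
  obtain ⟨q, ⟨_, t, ht, rfl⟩, rfl⟩ :=
    IsLocalization.exists_mk'_eq (Algebra.algebraMapSubmonoid Q M) z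
  obtain ⟨d, e, rfl⟩ := IsLocalization.exists_mk'_eq D⁰ q
  have hinj : Function.Injective
      (algebraMap (Localization M) (Localization (Algebra.algebraMapSubmonoid Q M))) :=
    algebraMap_localization_injective M (IsFractionRing.injective D Q)
  have h1 : algebraMap (Localization M) (Localization (Algebra.algebraMapSubmonoid Q M))
      (algebraMap D _ d) = IsLocalization.mk' _ (IsLocalization.mk' Q d e)
        (⟨algebraMap D Q t, t, ht, rfl⟩ : Algebra.algebraMapSubmonoid Q M) *
        algebraMap Q _ (algebraMap D Q t) * algebraMap Q _ (algebraMap D Q e.1) := by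
    rw [IsLocalization.mk'_spec _ (IsLocalization.mk' Q d e)
        (⟨algebraMap D Q t, t, ht, rfl⟩ : Algebra.algebraMapSubmonoid Q M), ← map_mul,
      IsLocalization.mk'_spec, ← IsScalarTower.algebraMap_apply, ← IsScalarTower.algebraMap_apply]
  have h2 : algebraMap D (Localization M) d * c = 0 := by
    apply hinj
    rw [map_mul, map_zero, h1]
    linear_combination algebraMap Q _ (algebraMap D Q t) * algebraMap Q _ (algebraMap D Q e.1) * hz
  have h3 : algebraMap D (Localization M) d = 0 := (mem_nonZeroDivisors_iff_right.mp hc) _ h2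
  rw [IsLocalization.mk'_eq_zero_iff]
  obtain ⟨⟨u, hu⟩, hud⟩ := (IsLocalization.map_eq_zero_iff M _ _).mp h3
  refine ⟨⟨algebraMap D Q u, u, hu, rfl⟩, ?_⟩
  have h4 : algebraMap D Q u * (IsLocalization.mk' Q d e * algebraMap D Q e) = 0 := by
    rw [IsLocalization.mk'_spec, ← map_mul, hud, map_zero]
  rw [← mul_assoc] at h4
  exact (IsLocalization.map_units Q e).mul_left_eq_zero.mp h4

/-- Kernel and cokernel commute with localization at the maximal ideals of C, the local theorem
identifies them with the local invariants, and finite-dimensional modules are the sums of their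
localizations. -/
theorem deltaFinite_of_algebraMap_of_isIntegrallyClosedIn {k C D : Type*} (Q : Type*) [Field k]
    [CommRing C] [IsNoetherianRing C] [Algebra k C] [CommRing D] [Algebra k D] [Algebra C D]
    [IsScalarTower k C D] [IsReduced D] [CommRing Q] [Algebra D Q] [IsIntegrallyClosedIn D Q]
    [IsArtinianRing Q] [IsFractionRing D Q]
    (hker : Module.Finite k (LinearMap.ker (Algebra.linearMap C D)))
    (hcoker : Module.Finite k (D ⧸ LinearMap.range (Algebra.linearMap C D)))
    (h0 : ∀ m : Ideal C, m.IsMaximal → ∀ x : D, (∀ a ∈ m, a • x = 0) → x = 0) :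
    DeltaFinite k C ∧
      epsilon k C = Module.finrank k (LinearMap.ker (Algebra.linearMap C D)) ∧
      delta k C = Module.finrank k (D ⧸ LinearMap.range (Algebra.linearMap C D)) -
        Module.finrank k (LinearMap.ker (Algebra.linearMap C D)) := by
  have hCD : Module.Finite C D := by
    have : Module.Finite C (D ⧸ LinearMap.range (Algebra.linearMap C D)) :=
      Module.Finite.of_restrictScalars_finite k C _
    exact Module.Finite.of_submodule_quotient (LinearMap.range (Algebra.linearMap C D))
  let E (m : MaximalSpectrum C) := Localization (Algebra.algebraMapSubmonoid D m.asIdeal.primeCompl)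
  have htower (m : MaximalSpectrum C) :
      IsScalarTower k (Localization.AtPrime m.asIdeal) (E m) := by
    refine .of_algebraMap_eq fun r ↦ ?_
    rw [IsScalarTower.algebraMap_apply k C (Localization.AtPrime m.asIdeal),
      ← IsScalarTower.algebraMap_apply C, ← IsScalarTower.algebraMap_apply k C]
  let f' (m : MaximalSpectrum C) : D →ₗ[C] E m := (IsScalarTower.toAlgHom C D (E m)).toLinearMap
  let f (m : MaximalSpectrum C) : C →ₗ[C] Localization.AtPrime m.asIdeal :=
    Algebra.linearMap C (Localization.AtPrime m.asIdeal)
  have hmap (m : MaximalSpectrum C) (x : Localization.AtPrime m.asIdeal) :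
      IsLocalizedModule.map m.asIdeal.primeCompl (f m) (f' m) (Algebra.linearMap C D) x =
        algebraMap _ (E m) x := by
    have : IsLocalizedModule.map m.asIdeal.primeCompl (f m) (f' m) (Algebra.linearMap C D) =
        (Algebra.linearMap (Localization.AtPrime m.asIdeal) (E m)).restrictScalars C := by
      refine IsLocalizedModule.linearMap_ext m.asIdeal.primeCompl (f m) (f' m) ?_
      refine LinearMap.ext fun c ↦ ?_
      rw [LinearMap.comp_apply, LinearMap.comp_apply, IsLocalizedModule.map_apply]
      change algebraMap D (E m) (algebraMap C D c) =
        algebraMap (Localization.AtPrime m.asIdeal) (E m) (algebraMap C _ c)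
      rw [← IsScalarTower.algebraMap_apply, ← IsScalarTower.algebraMap_apply]
    rw [this]; rfl
  -- the kernels and cokernels localize
  let K (m : MaximalSpectrum C) :=
    LinearMap.ker (Algebra.linearMap (Localization.AtPrime m.asIdeal) (E m))
  let N (m : MaximalSpectrum C) :=
    E m ⧸ LinearMap.range (Algebra.linearMap (Localization.AtPrime m.asIdeal) (E m))
  have hK (m : MaximalSpectrum C) : ∃ g : LinearMap.ker (Algebra.linearMap C D) →ₗ[C] K m,
      IsLocalizedModule m.asIdeal.primeCompl g := by
    have := LinearMap.toKerLocalized_isLocalizedModule (Localization.AtPrime m.asIdeal)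
      m.asIdeal.primeCompl (f m) (f' m) (Algebra.linearMap C D)
    have heq : LinearMap.ker (IsLocalizedModule.map m.asIdeal.primeCompl (f m) (f' m)
        (Algebra.linearMap C D)) = (K m).restrictScalars C := by
      ext x
      rw [LinearMap.mem_ker, hmap, Submodule.restrictScalars_mem, LinearMap.mem_ker]
      rfl
    exact ⟨_, IsLocalizedModule.of_linearEquiv m.asIdeal.primeCompl
      (LinearMap.toKerIsLocalized m.asIdeal.primeCompl (f m) (f' m) (Algebra.linearMap C D))
      (LinearEquiv.ofEq _ _ heq)⟩
  have hN (m : MaximalSpectrum C) :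
      ∃ g : (D ⧸ LinearMap.range (Algebra.linearMap C D)) →ₗ[C] N m,
        IsLocalizedModule m.asIdeal.primeCompl g := by
    have h := IsLocalizedModule.toLocalizedQuotient' (Localization.AtPrime m.asIdeal)
      m.asIdeal.primeCompl (f' m) (LinearMap.range (Algebra.linearMap C D))
    have heq : (LinearMap.range (Algebra.linearMap C D)).localized'
        (Localization.AtPrime m.asIdeal) m.asIdeal.primeCompl (f' m) =
        LinearMap.range (Algebra.linearMap (Localization.AtPrime m.asIdeal) (E m)) := by
      rw [LinearMap.localized'_range_eq_range_localizedMap (Localization.AtPrime m.asIdeal)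
        m.asIdeal.primeCompl (f m) (f' m)]
      ext x
      refine exists_congr fun y ↦ ?_
      change IsLocalizedModule.map m.asIdeal.primeCompl (f m) (f' m) (Algebra.linearMap C D) y = x ↔
        algebraMap _ (E m) y = x
      rw [hmap]
    exact ⟨_, IsLocalizedModule.of_linearEquiv m.asIdeal.primeCompl
      (Submodule.toLocalizedQuotient' (Localization.AtPrime m.asIdeal) m.asIdeal.primeCompl (f' m)
        (LinearMap.range (Algebra.linearMap C D)))
      ((Submodule.quotEquivOfEq _ _ heq).restrictScalars C)⟩
  choose gK hgK using hK
  choose gN hgN using hN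
  have HK := finsum_finrank_isLocalizedModule (k := k) _ (fun m ↦ K m) gK hgK
  have HN := finsum_finrank_isLocalizedModule (k := k) _ (fun m ↦ N m) gN hgN
  have core (m : MaximalSpectrum C) := by
    have : Module.Finite (Localization.AtPrime m.asIdeal) (E m) :=
      Module.Finite.of_isLocalization C D m.asIdeal.primeCompl
    have : IsNoetherianRing (Localization.AtPrime m.asIdeal) :=
      IsLocalization.isNoetherianRing m.asIdeal.primeCompl _ inferInstance
    have := isIntegrallyClosedIn_localization (D := D) (Q := Q)
      (Algebra.algebraMapSubmonoid D m.asIdeal.primeCompl)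
    refine hZero_eq_ker_and_normCoker_equiv k (Localization (Algebra.algebraMapSubmonoid Q
      (Algebra.algebraMapSubmonoid D m.asIdeal.primeCompl)))
      (L := Localization.AtPrime m.asIdeal) (E := E m) ?_ (HK.1 m) (HN.1 m)
      (isUnit_algebraMap_localization _)
    intro x hx
    obtain ⟨d, ⟨_, t, ht, rfl⟩, rfl⟩ :=
      IsLocalization.exists_mk'_eq (Algebra.algebraMapSubmonoid D m.asIdeal.primeCompl) x
    obtain ⟨S, hS⟩ := (isNoetherianRing_iff_ideal_fg C).mp inferInstance m.asIdeal
    have hloc (a : C) (ha : a ∈ m.asIdeal) : ∃ u ∈ m.asIdeal.primeCompl, u • a • d = 0 := by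
      have h1 := hx (algebraMap C _ a) (by
        rw [← Localization.AtPrime.map_eq_maximalIdeal]
        exact Ideal.mem_map_of_mem _ ha)
      rw [algebraMap_smul, ← algebraMap_smul D a, Algebra.smul_def,
        IsLocalization.mul_mk'_eq_mk'_of_mul, IsLocalization.mk'_eq_zero_iff] at h1
      obtain ⟨⟨_, u, hu, rfl⟩, h2⟩ := h1
      refine ⟨u, hu, ?_⟩
      rw [Algebra.smul_def, Algebra.smul_def]
      simpa using h2
    -- The denominator u depends on a; finite generation of the maximal ideal allows one u for all
    -- a, so that ud is killed by the whole ideal.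
    obtain ⟨u, hu, hud⟩ : ∃ u ∈ m.asIdeal.primeCompl, ∀ a ∈ m.asIdeal, u • a • d = 0 := by
      have hS' (a : C) : ∃ u ∈ m.asIdeal.primeCompl, a ∈ m.asIdeal → u • a • d = 0 := by
        by_cases ha : a ∈ m.asIdeal
        · obtain ⟨u, hu, h⟩ := hloc a ha
          exact ⟨u, hu, fun _ ↦ h⟩
        · exact ⟨1, one_mem _, fun h ↦ absurd h ha⟩
      choose u hu hud using hS'
      classical
      refine ⟨∏ a ∈ S, u a, prod_mem fun a _ ↦ hu a, fun a ha ↦ ?_⟩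
      rw [← hS] at ha
      induction ha using Submodule.span_induction with
      | mem x hx =>
        rw [← Finset.prod_erase_mul _ _ hx, mul_smul,
          hud x (by rw [← hS]; exact Ideal.subset_span hx), smul_zero]
      | zero => simp
      | add x y _ _ hx hy => rw [add_smul, smul_add, hx, hy, add_zero]
      | smul b x _ hx => rw [smul_assoc, smul_comm, hx, smul_zero]
    have hz : u • d = 0 := h0 m.asIdeal m.isMaximal _ fun a ha ↦ by
      rw [smul_comm]; exact hud a ha
    rw [IsLocalization.mk'_eq_zero_iff]
    exact ⟨⟨_, u, hu, rfl⟩, by simpa [Algebra.smul_def] using hz⟩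
  let eK (m : MaximalSpectrum C) : K m ≃ₗ[k] HZero (Localization.AtPrime m.asIdeal) :=
    (LinearEquiv.ofEq (K m) (HZero (Localization.AtPrime m.asIdeal)) (by
      ext x; exact ((core m).1 x).symm)).restrictScalars k
  let eN (m : MaximalSpectrum C) : NormCoker (Localization.AtPrime m.asIdeal) ≃ₗ[k] N m :=
    (core m).2.some.restrictScalars k
  have hepsl (m : MaximalSpectrum C) :
      epsilonLocal k (Localization.AtPrime m.asIdeal) = Module.finrank k (K m) :=
    (eK m).finrank_eq.symm
  have hnl (m : MaximalSpectrum C) :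
      Module.finrank k (NormCoker (Localization.AtPrime m.asIdeal)) = Module.finrank k (N m) :=
    (eN m).finrank_eq
  have hefin : EpsilonFinite k C := by
    refine ⟨fun m ↦ ?_, ?_⟩
    · have := HK.1 m
      exact Module.Finite.equiv (eK m)
    · simp only [hepsl]; exact HK.2.1
  refine ⟨⟨fun m ↦ ?_, ?_, hefin⟩, ?_, ?_⟩
  · have := HN.1 m
    exact Module.Finite.equiv (eN m).symm
  · simp only [hnl]; exact HN.2.1
  · rw [epsilon, finsum_congr hepsl, HK.2.2]
  · simp only [delta, deltaLocal, hepsl, hnl]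
    rw [finsum_sub_distrib, ← HK.2.2, ← HN.2.2]
    · congr 1
      · exact (map_finsum (Nat.castAddMonoidHom ℤ) HN.2.1).symm
      · exact (map_finsum (Nat.castAddMonoidHom ℤ) HK.2.1).symm
    · exact HN.2.1.subset fun m hm ↦ by simpa [Function.mem_support] using hm
    · exact HK.2.1.subset fun m hm ↦ by simpa [Function.mem_support] using hm

end LocalizedNormal

/-! ### The invariants via a map to a reduced algebra of positive depth -/

section DeltaComparison

lemma isFractionRing_integralClosure (L : Type*) [CommRing L] [IsNoetherianRing L]
    [IsReduced L] : IsFractionRing (integralClosure L (FractionRing L)) (FractionRing L) := by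
  refine ⟨⟨fun d ↦ ?_, fun q ↦ ?_, fun {x y} h ↦ ⟨1, by simpa using h⟩⟩⟩
  · refine IsArtinianRing.isUnit_of_mem_nonZeroDivisors
      (mem_nonZeroDivisors_iff_right.mpr fun q hq ↦ ?_)
    obtain ⟨a, b, rfl⟩ := IsLocalization.exists_mk'_eq L⁰ q
    rw [IsLocalization.mk'_eq_zero_iff]
    refine ⟨1, ?_⟩
    change _ * d.1.1 = 0 at hq
    have h1 : algebraMap L (FractionRing L) a * d.1.1 = 0 := by
      rw [← IsLocalization.mk'_spec (FractionRing L) a b]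
      linear_combination algebraMap L (FractionRing L) b.1 * hq
    have h2 : algebraMap L (integralClosure L (FractionRing L)) a = 0 :=
      mem_nonZeroDivisors_iff_right.mp d.2 _ (Subtype.ext h1)
    have h3 : algebraMap L (FractionRing L) a = 0 := congrArg Subtype.val h2
    rw [Submonoid.coe_one, one_mul]
    exact IsFractionRing.injective L (FractionRing L) (by rw [h3, map_zero])
  · obtain ⟨a, b, rfl⟩ := IsLocalization.exists_mk'_eq L⁰ q
    refine ⟨⟨algebraMap L _ a, ⟨algebraMap L _ b, ?_⟩⟩, IsLocalization.mk'_spec _ a b⟩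
    refine mem_nonZeroDivisors_iff_right.mpr fun z hz ↦ Subtype.ext ?_
    exact (IsLocalization.map_units (FractionRing L) b).mul_left_eq_zero.mp
      (congrArg Subtype.val hz)

instance isReduced_normalization (B : Type*) [CommRing B] : IsReduced (Normalization B) :=
  isReduced_of_injective (algebraMap (Normalization B) (FractionRing (Red B))) Subtype.val_injective

lemma normalization_algebraMap_eq_zero {B : Type*} [CommRing B] {x : B} :
    algebraMap B (Normalization B) x = 0 ↔ IsNilpotent x := by
  rw [← red_mk_eq_zero]
  refine ⟨fun h ↦ IsFractionRing.injective (Red B) (FractionRing (Red B)) ?_, fun h ↦ ?_⟩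
  · rw [map_zero]; exact congrArg Subtype.val h
  · rw [IsScalarTower.algebraMap_apply B (Red B), h, map_zero]

/-- A nonzero x killed by m has its annihilator inside an associated prime P of B. By integrality P
lies over m and is maximal, so B would have a nonzero element killed by a maximal ideal. -/
lemma eq_zero_of_isMaximal_smul_eq_zero {C B : Type*} [CommRing C] [CommRing B] [Algebra C B]
    [IsNoetherianRing B] [Algebra.IsIntegral C B]
    (h0 : ∀ m : Ideal B, m.IsMaximal → ∀ x : B, (∀ a ∈ m, a * x = 0) → x = 0)
    (m : Ideal C) [m.IsMaximal] (x : B) (hx : ∀ a ∈ m, a • x = 0) : x = 0 := by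
  by_contra hx0
  obtain ⟨P, hP, hle⟩ := exists_le_isAssociatedPrime_of_isNoetherianRing B x hx0
  obtain ⟨_, y, hy⟩ := isAssociatedPrime_iff.mp hP
  have hmP : m ≤ P.comap (algebraMap C B) := fun a ha ↦ hle (by
    rw [Submodule.mem_colon_singleton, smul_eq_mul, ← Algebra.smul_def, hx a ha]
    exact Submodule.zero_mem _)
  have hmax : (P.comap (algebraMap C B)).IsMaximal := by
    rw [← Ideal.IsMaximal.eq_of_le ‹_› (Ideal.IsPrime.ne_top inferInstance) hmP]
    infer_instance
  have : P.IsMaximal := Ideal.isMaximal_of_isIntegral_of_isMaximal_comap P hmax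
  have hy0 : y = 0 := h0 P this y fun a ha ↦ by
    rw [hy, Submodule.mem_colon_singleton] at ha
    simpa using ha
  apply hP.isPrime.ne_top
  rw [hy, hy0]
  simp

/-- The preceding computation is applied to C → B → B̄. As B embeds in B̄ the kernel is unchanged,
and the cokernel is an extension of B̄/B by B/C. -/
theorem delta_eq_of_algHom {k C B : Type*} [Field k] [CommRing C] [IsNoetherianRing C]
    [Algebra k C] [CommRing B] [Algebra k B] [IsReduced B] (φ : C →ₐ[k] B)
    (hker : Module.Finite k (LinearMap.ker φ.toLinearMap))
    (hcoker : Module.Finite k (B ⧸ LinearMap.range φ.toLinearMap))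
    (h0 : ∀ m : Ideal B, m.IsMaximal → ∀ x : B, (∀ a ∈ m, a * x = 0) → x = 0)
    (hN : Module.Finite k (NormCoker B)) :
    DeltaFinite k C ∧
      epsilon k C = Module.finrank k (LinearMap.ker φ.toLinearMap) ∧
      delta k C = Module.finrank k (B ⧸ LinearMap.range φ.toLinearMap) +
        Module.finrank k (NormCoker B) - Module.finrank k (LinearMap.ker φ.toLinearMap) := by
  algebraize [φ.toRingHom]
  have htower : IsScalarTower k C B := .of_algebraMap_eq fun r ↦ (φ.commutes r).symm
  have e₁ : (B ⧸ LinearMap.range (Algebra.linearMap C B)) ≃ₗ[k]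
      B ⧸ LinearMap.range φ.toLinearMap :=
    (Submodule.Quotient.restrictScalarsEquiv k (LinearMap.range (Algebra.linearMap C B))).symm.trans
      (Submodule.quotEquivOfEq _ _ (by ext; rfl))
  have hfin₁ : Module.Finite k (B ⧸ LinearMap.range (Algebra.linearMap C B)) :=
    Module.Finite.equiv e₁.symm
  have hCB : Module.Finite C B := by
    have : Module.Finite C (B ⧸ LinearMap.range (Algebra.linearMap C B)) :=
      Module.Finite.of_restrictScalars_finite k C _
    exact Module.Finite.of_submodule_quotient (LinearMap.range (Algebra.linearMap C B))
  have hBn : IsNoetherianRing B := IsNoetherianRing.of_finite C B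
  have hinj : Function.Injective (algebraMap B (Normalization B)) := by
    rw [injective_iff_map_eq_zero]
    exact fun x hx ↦ (normalization_algebraMap_eq_zero.mp hx).eq_zero
  have hkereq : (LinearMap.ker (Algebra.linearMap C (Normalization B))).restrictScalars k =
      LinearMap.ker φ.toLinearMap := by
    ext x
    rw [Submodule.restrictScalars_mem, LinearMap.mem_ker, LinearMap.mem_ker,
      Algebra.linearMap_apply, IsScalarTower.algebraMap_apply C B]
    exact map_eq_zero_iff _ hinj
  let e₀ : LinearMap.ker (Algebra.linearMap C (Normalization B)) ≃ₗ[k]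
      LinearMap.ker φ.toLinearMap := LinearEquiv.ofEq _ _ hkereq
  let f : (B ⧸ LinearMap.range (Algebra.linearMap C B)) →ₗ[C]
      Normalization B ⧸ LinearMap.range (Algebra.linearMap C (Normalization B)) :=
    Submodule.mapQ _ _ (IsScalarTower.toAlgHom C B (Normalization B)).toLinearMap (by
      rintro _ ⟨c, rfl⟩
      exact ⟨c, rfl⟩)
  let g : (Normalization B ⧸ LinearMap.range (Algebra.linearMap C (Normalization B))) →ₗ[C]
      NormCoker B :=
    Submodule.liftQ _ ((LinearMap.range (Algebra.linearMap B (Normalization B))).mkQ.restrictScalars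
      C) (by
      rintro _ ⟨c, rfl⟩
      exact (Submodule.Quotient.mk_eq_zero _).mpr ⟨algebraMap C B c, rfl⟩)
  have hf : Function.Injective f := by
    rw [injective_iff_map_eq_zero]
    intro x hx
    obtain ⟨x, rfl⟩ := Submodule.Quotient.mk_surjective _ x
    obtain ⟨c, hc⟩ := (Submodule.Quotient.mk_eq_zero _).mp hx
    exact (Submodule.Quotient.mk_eq_zero _).mpr ⟨c, hinj hc⟩
  have hg : Function.Surjective g := by
    intro x
    obtain ⟨x, rfl⟩ := Submodule.Quotient.mk_surjective _ x
    exact ⟨Submodule.Quotient.mk x, rfl⟩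
  have hfg : Function.Exact f g := by
    intro x
    obtain ⟨x, rfl⟩ := Submodule.Quotient.mk_surjective _ x
    constructor
    · intro hx
      obtain ⟨b, hb⟩ := (Submodule.Quotient.mk_eq_zero _).mp hx
      exact ⟨Submodule.Quotient.mk b, congrArg Submodule.Quotient.mk hb⟩
    · rintro ⟨y, hy⟩
      obtain ⟨y, rfl⟩ := Submodule.Quotient.mk_surjective _ y
      rw [← hy]
      exact (Submodule.Quotient.mk_eq_zero _).mpr ⟨y, rfl⟩
  obtain ⟨hfin, hrank⟩ := finrank_eq_add_of_exact (k := k) (f.restrictScalars k)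
    (g.restrictScalars k) hf hg hfg
  have hfr := isFractionRing_integralClosure (Red B)
  obtain ⟨h1, h2, h3⟩ := deltaFinite_of_algebraMap_of_isIntegrallyClosedIn (k := k) (C := C)
    (D := Normalization B) (FractionRing (Red B)) (Module.Finite.equiv e₀.symm) hfin
    -- Positive depth passes from B to its normalization: a regular denominator b carries x into B.
    (fun m hm x hx ↦ by
      obtain ⟨a, b, hab⟩ := IsLocalization.exists_mk'_eq (Red B)⁰ x.1
      obtain ⟨a, rfl⟩ := Ideal.Quotient.mk_surjective a
      have hxa : algebraMap (Red B) (Normalization B) b * x = algebraMap B (Normalization B) a := by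
        apply Subtype.ext
        change algebraMap (Red B) (FractionRing (Red B)) b * x.1 = _
        rw [← hab, IsLocalization.mk'_spec']
        rfl
      have ha : a = 0 := eq_zero_of_isMaximal_smul_eq_zero (C := C) h0 m a fun c hc ↦ by
        apply hinj
        rw [Algebra.smul_def, map_mul, ← hxa, mul_left_comm, ← IsScalarTower.algebraMap_apply C B,
          ← Algebra.smul_def c x, hx c hc, mul_zero, map_zero]
      rw [ha, map_zero] at hxa
      apply Subtype.ext
      exact (IsLocalization.map_units (FractionRing (Red B)) b).mul_right_eq_zero.mp
        (congrArg Subtype.val hxa))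
  refine ⟨h1, h2.trans e₀.finrank_eq, ?_⟩
  rw [h3, e₀.finrank_eq, hrank, e₁.finrank_eq]
  push_cast
  ring

end DeltaComparison

/-! ### Kernels and cokernels over a principal ideal domain after base change to fields -/

section BaseChange

/-- The hypotheses say that 0 → V → M ⊕ F → N → 0 is exact. Hence ker f ≅ ker v and coker f ≅ coker
v, so f has the same index as the map v of finite-dimensional spaces. -/
lemma finrank_coker_add_finrank {k V M F N : Type*} [Field k] [AddCommGroup V] [AddCommGroup M]
    [AddCommGroup F] [AddCommGroup N] [Module k V] [Module k M] [Module k F] [Module k N]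
    [Module.Finite k V] [Module.Finite k F] (u : V →ₗ[k] M) (v : V →ₗ[k] F) (f : M →ₗ[k] N)
    (p : F →ₗ[k] N) (hinj : ∀ x, u x = 0 → v x = 0 → x = 0) (hcomp : ∀ x, f (u x) + p (v x) = 0)
    (hexact : ∀ m y, f m + p y = 0 → ∃ x, u x = m ∧ v x = y)
    (hsurj : ∀ n, ∃ m y, f m + p y = n) :
    Module.Finite k (LinearMap.ker f) ∧ Module.Finite k (N ⧸ LinearMap.range f) ∧
      Module.finrank k (N ⧸ LinearMap.range f) + Module.finrank k V =
        Module.finrank k (LinearMap.ker f) + Module.finrank k F := by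
  let q : F →ₗ[k] N ⧸ LinearMap.range f := (LinearMap.range f).mkQ ∘ₗ p
  have hq : Function.Surjective q := by
    intro n
    obtain ⟨n, rfl⟩ := Submodule.Quotient.mk_surjective _ n
    obtain ⟨m, y, rfl⟩ := hsurj n
    refine ⟨y, ?_⟩
    change Submodule.Quotient.mk (p y) = _
    rw [Submodule.Quotient.eq]
    exact ⟨-m, by rw [map_neg]; abel⟩
  have hkerq : LinearMap.ker q = LinearMap.range v := by
    ext y
    rw [LinearMap.mem_ker]
    constructor
    · intro hy
      obtain ⟨m, hm⟩ := (Submodule.Quotient.mk_eq_zero _).mp hy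
      obtain ⟨x, -, hx⟩ := hexact (-m) y (by rw [map_neg, hm]; abel)
      exact ⟨x, hx⟩
    · rintro ⟨x, rfl⟩
      refine (Submodule.Quotient.mk_eq_zero _).mpr ⟨-u x, ?_⟩
      rw [map_neg, neg_eq_iff_add_eq_zero]
      exact hcomp x
  let w : LinearMap.ker v →ₗ[k] LinearMap.ker f :=
    (u ∘ₗ (LinearMap.ker v).subtype).codRestrict _ fun x ↦ by
      have := hcomp x
      rw [LinearMap.mem_ker.mp x.2, map_zero, add_zero] at this
      exact this
  have hw : Function.Bijective w := by
    constructor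
    · rw [injective_iff_map_eq_zero]
      intro x hx
      exact Subtype.ext (hinj x (congrArg Subtype.val hx) x.2)
    · rintro ⟨m, hm⟩
      obtain ⟨x, hx, hx'⟩ := hexact m 0 (by rw [LinearMap.mem_ker.mp hm, map_zero, add_zero])
      exact ⟨⟨x, hx'⟩, Subtype.ext hx⟩
  let e := LinearEquiv.ofBijective w hw
  have h1 := e.finrank_eq
  have h2 := LinearMap.finrank_range_add_finrank_ker v
  have h3 := LinearMap.finrank_range_add_finrank_ker q
  rw [hkerq, LinearMap.range_eq_top.mpr hq, finrank_top] at h3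
  exact ⟨Module.Finite.equiv e, Module.Finite.of_surjective q hq, by omega⟩

variable {A : Type u} [CommRing A] [IsDomain A] [IsPrincipalIdealRing A]
  {M : Type v} {N : Type w} [AddCommGroup M] [AddCommGroup N] [Module A M] [Module A N]
  [Module.IsTorsionFree A M]

/-- The index of the base changes of a map with finite kernel and cokernel to fields is
constant. -/
theorem exists_index_baseChange [Module.IsTorsionFree A N] (f : M →ₗ[A] N)
    (hker : Module.Finite A (LinearMap.ker f))
    (hcoker : Module.Finite A (N ⧸ LinearMap.range f)) :
    ∃ c : ℤ, ∀ (k : Type u) [Field k] [Algebra A k],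
      Module.Finite k (LinearMap.ker (f.baseChange k)) ∧
      Module.Finite k ((k ⊗[A] N) ⧸ LinearMap.range (f.baseChange k)) ∧
      (Module.finrank k ((k ⊗[A] N) ⧸ LinearMap.range (f.baseChange k)) : ℤ) -
        Module.finrank k (LinearMap.ker (f.baseChange k)) = c := by
  -- Lifting generators of the cokernel gives a surjection M ⊕ Aⁿ → N. Its kernel K is an extension
  -- of a submodule of Aⁿ by ker f, so it is finite, and free because it is torsion-free. As N is
  -- flat the sequence survives base change, and the index is n − rank K for every field.
  obtain ⟨n, g, hg⟩ := Module.Finite.exists_fin' A (N ⧸ LinearMap.range f)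
  obtain ⟨p, hp⟩ := Module.projective_lifting_property (LinearMap.range f).mkQ g
    (Submodule.mkQ_surjective _)
  let h : M × (Fin n → A) →ₗ[A] N := f.coprod p
  have hh : Function.Surjective h := by
    intro y
    obtain ⟨x, hx⟩ := hg (Submodule.Quotient.mk y)
    rw [← hp] at hx
    obtain ⟨m, hm⟩ := (Submodule.Quotient.eq _).mp hx
    exact ⟨(-m, x), by simp [h, LinearMap.coprod_apply, hm]⟩
  let K := LinearMap.ker h
  let u : K →ₗ[A] M := LinearMap.fst A M (Fin n → A) ∘ₗ K.subtype
  let v : K →ₗ[A] (Fin n → A) := LinearMap.snd A M (Fin n → A) ∘ₗ K.subtype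
  have hKfin : Module.Finite A K := by
    have h1 : Module.Finite A (LinearMap.ker v) := by
      let w : LinearMap.ker f →ₗ[A] LinearMap.ker v :=
        { toFun := fun x ↦ ⟨⟨(x.1, 0), by
            simp [K, h, LinearMap.coprod_apply]⟩, by
            simp [v]⟩
          map_add' := fun x y ↦ by ext <;> simp
          map_smul' := fun a x ↦ by ext <;> simp }
      refine Module.Finite.of_surjective w fun ⟨⟨⟨m, y⟩, hx⟩, hy⟩ ↦ ?_
      have hy : y = 0 := hy
      subst hy
      exact ⟨⟨m, by simpa [K, h, LinearMap.coprod_apply] using hx⟩, rfl⟩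
    have h2 : Module.Finite A (K ⧸ LinearMap.ker v) :=
      Module.Finite.equiv v.quotKerEquivRange.symm
    exact Module.Finite.of_submodule_quotient (LinearMap.ker v)
  have hKtf : Module.IsTorsionFree A (M × (Fin n → A)) := inferInstance
  have hKfree : Module.Free A K := inferInstance
  refine ⟨n - Module.finrank A K, fun k _ _ ↦ ?_⟩
  have hinj : Function.Injective (K.subtype.baseChange k) :=
    LinearMap.lTensor_injective_of_exact_of_flat h hh K.subtype K.injective_subtype
      (LinearMap.exact_subtype_ker_map h) k
  have hex : Function.Exact (K.subtype.baseChange k) (h.baseChange k) :=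
    lTensor_exact k (LinearMap.exact_subtype_ker_map h) hh
  have hhk : Function.Surjective (h.baseChange k) := LinearMap.lTensor_surjective k hh
  let i₁ := (LinearMap.inl A M (Fin n → A)).baseChange k
  let i₂ := (LinearMap.inr A M (Fin n → A)).baseChange k
  let p₁ := (LinearMap.fst A M (Fin n → A)).baseChange k
  let p₂ := (LinearMap.snd A M (Fin n → A)).baseChange k
  have hu (x) : u.baseChange k x = p₁ (K.subtype.baseChange k x) := by
    simp only [u, p₁, LinearMap.baseChange_comp, LinearMap.comp_apply]
  have hv (x) : v.baseChange k x = p₂ (K.subtype.baseChange k x) := by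
    simp only [v, p₂, LinearMap.baseChange_comp, LinearMap.comp_apply]
  have hid (z : k ⊗[A] (M × (Fin n → A))) : i₁ (p₁ z) + i₂ (p₂ z) = z := by
    induction z with
    | zero => simp
    | add x y hx hy => rw [map_add, map_add, map_add, map_add, add_add_add_comm, hx, hy]
    | tmul a x => simp [i₁, i₂, p₁, p₂, ← TensorProduct.tmul_add]
  have hh1 (m) : h.baseChange k (i₁ m) = f.baseChange k m := by
    rw [← LinearMap.comp_apply, ← LinearMap.baseChange_comp, LinearMap.coprod_inl]
  have hh2 (y) : h.baseChange k (i₂ y) = p.baseChange k y := by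
    rw [← LinearMap.comp_apply, ← LinearMap.baseChange_comp, LinearMap.coprod_inr]
  have h11 (m) : p₁ (i₁ m) = m := by
    rw [← LinearMap.comp_apply, ← LinearMap.baseChange_comp, LinearMap.fst_comp_inl]; simp
  have h12 (m) : p₁ (i₂ m) = 0 := by
    rw [← LinearMap.comp_apply, ← LinearMap.baseChange_comp, LinearMap.fst_comp_inr]; simp
  have h21 (m) : p₂ (i₁ m) = 0 := by
    rw [← LinearMap.comp_apply, ← LinearMap.baseChange_comp, LinearMap.snd_comp_inl]; simp
  have h22 (m) : p₂ (i₂ m) = m := by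
    rw [← LinearMap.comp_apply, ← LinearMap.baseChange_comp, LinearMap.snd_comp_inr]; simp
  obtain ⟨r1, r2, r3⟩ := finrank_coker_add_finrank (u.baseChange k) (v.baseChange k)
    (f.baseChange k) (p.baseChange k)
    (fun x hx hx' ↦ by
      rw [hu] at hx
      rw [hv] at hx'
      apply hinj
      rw [← hid (K.subtype.baseChange k x), hx, hx']; simp)
    (fun x ↦ by
      rw [hu, hv, ← hh1, ← hh2, ← map_add, hid]
      exact hex.apply_apply_eq_zero x)
    (fun m y hmy ↦ by
      rw [← hh1, ← hh2, ← map_add] at hmy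
      obtain ⟨x, hx⟩ := (hex _).mp hmy
      exact ⟨x, by rw [hu, hx, map_add, h11, h12, add_zero],
        by rw [hv, hx, map_add, h21, h22, zero_add]⟩)
    (fun y ↦ by
      obtain ⟨z, rfl⟩ := hhk y
      exact ⟨p₁ z, p₂ z, by rw [← hh1, ← hh2, ← map_add, hid]⟩)
  refine ⟨r1, r2, ?_⟩
  rw [Module.finrank_baseChange, Module.finrank_baseChange, Module.finrank_fin_fun] at r3
  omega

/-- An injective map with finite cokernel stays injective after base change to a field away from
a nonzero element. -/
theorem exists_ne_zero_injective_baseChange (f : M →ₗ[A] N) (hf : Function.Injective f)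
    (hcoker : Module.Finite A (N ⧸ LinearMap.range f)) :
    ∃ d : A, d ≠ 0 ∧ ∀ (k : Type u) [Field k] [Algebra A k], algebraMap A k d ≠ 0 →
      Function.Injective (f.baseChange k) := by
  let C := N ⧸ LinearMap.range f
  let T := Submodule.torsion A C
  have hT : Module.Finite A T := inferInstance
  obtain ⟨d, hd, hd0⟩ := Submodule.annihilator_top_inter_nonZeroDivisors
    (R := A) (M := T) (Submodule.torsion_isTorsion)
  have hdT (x : C) (hx : x ∈ T) : d • x = 0 := by
    have := Submodule.mem_annihilator.mp hd ⟨x, hx⟩ trivial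
    exact congrArg Subtype.val this
  -- Let M' be the preimage in N of the torsion T of the cokernel. N/M' is torsion-free, hence flat,
  -- so M' ⊆ N stays injective after any base change. Since dM' ⊆ f(M), the map M → M' has a left
  -- inverse up to d, so it stays injective wherever d is invertible.
  let q : N →ₗ[A] C ⧸ T := T.mkQ ∘ₗ (LinearMap.range f).mkQ
  have hq : Function.Surjective q :=
    (Submodule.mkQ_surjective _).comp (Submodule.mkQ_surjective _)
  let M' := LinearMap.ker q
  have hfM' (x : M) : f x ∈ M' := by
    have h0 : (LinearMap.range f).mkQ (f x) = 0 := (Submodule.Quotient.mk_eq_zero _).mpr ⟨x, rfl⟩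
    change T.mkQ ((LinearMap.range f).mkQ (f x)) = 0
    rw [h0, map_zero]
  let f' : M →ₗ[A] M' := f.codRestrict M' hfM'
  have hex (x : M') : ∃ y, f y = d • x.1 := by
    have h1 : (LinearMap.range f).mkQ x.1 ∈ T := (Submodule.Quotient.mk_eq_zero T).mp x.2
    have h2 := hdT _ h1
    rw [← map_smul] at h2
    exact (Submodule.Quotient.mk_eq_zero _).mp h2
  choose g hg using hex
  let g' : M' →ₗ[A] M :=
    { toFun := g
      map_add' := fun x y ↦ hf (by rw [map_add, hg, hg, hg, Submodule.coe_add, smul_add])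
      map_smul' := fun a x ↦ hf (by
        rw [RingHom.id_apply, map_smul, hg, hg, Submodule.coe_smul, smul_comm]) }
  have hgf : g' ∘ₗ f' = d • LinearMap.id := by
    ext x
    exact hf (by
      change f (g (f' x)) = f (d • x)
      rw [hg, map_smul]; rfl)
  refine ⟨d, nonZeroDivisors.ne_zero hd0, fun k _ _ hdk ↦ ?_⟩
  have h1 : Function.Injective (M'.subtype.baseChange k) :=
    LinearMap.lTensor_injective_of_exact_of_flat q hq M'.subtype M'.injective_subtype
      (LinearMap.exact_subtype_ker_map q) k
  have h2 : Function.Injective (f'.baseChange k) := by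
    rw [injective_iff_map_eq_zero]
    intro x hx
    have h3 : (g' ∘ₗ f').baseChange k x = 0 := by
      rw [LinearMap.baseChange_comp, LinearMap.comp_apply, hx, map_zero]
    rw [hgf, LinearMap.baseChange_smul, LinearMap.smul_apply, LinearMap.baseChange_id,
      LinearMap.id_apply, ← algebraMap_smul k d] at h3
    exact (smul_eq_zero_iff_right hdk).mp h3
  have h4 : f = M'.subtype ∘ₗ f' := by ext; rfl
  rw [h4, LinearMap.baseChange_comp]
  exact h1.comp h2

end BaseChange

/-! ### Consequences of normality outside closed points with finite residue field -/

section NormalLocus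

lemma isMaximal_of_finite_quotient {k C : Type*} [Field k] [CommRing C] [Algebra k C]
    (p : Ideal C) [p.IsPrime] [Module.Finite k (C ⧸ p)] : p.IsMaximal :=
  Ideal.Quotient.maximal_of_isField p (isField_of_isIntegral_of_isField' (Field.toIsField k))

lemma finite_quotient_of_finite_residueField {k C : Type*} [Field k] [CommRing C] [Algebra k C]
    (p : Ideal C) [p.IsPrime] [Module.Finite k p.ResidueField] : Module.Finite k (C ⧸ p) :=
  Module.Finite.of_injective (IsScalarTower.toAlgHom k (C ⧸ p) p.ResidueField).toLinearMap
    p.injective_algebraMap_quotient_residueField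

/-- C/Ann(N) embeds in End_k(N), so it is finite-dimensional. If Ann(N) ⊆ p, then C/p is a
finite-dimensional domain, that is, a field. -/
lemma exists_notMem_forall_smul_eq_zero (k : Type*) {C N : Type*} [Field k] [CommRing C]
    [Algebra k C] [AddCommGroup N] [Module C N] [Module k N] [IsScalarTower k C N]
    [Module.Finite k N] (p : Ideal C) [p.IsPrime] (hp : ¬ p.IsMaximal) :
    ∃ u, u ∉ p ∧ ∀ x : N, u • x = 0 := by
  by_contra! H
  apply hp
  let f : C →ₐ[k] Module.End k N := Algebra.lsmul k k N
  have hle : ∀ a : C, f.toLinearMap a = 0 → a ∈ p := fun a ha ↦ by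
    by_contra hap
    obtain ⟨x, hx⟩ := H a hap
    exact hx (LinearMap.congr_fun ha x)
  have : Module.Finite k (C ⧸ LinearMap.ker f.toLinearMap) :=
    Module.Finite.equiv f.toLinearMap.quotKerEquivRange.symm
  have : Module.Finite k (C ⧸ p) := by
    let g : (C ⧸ LinearMap.ker f.toLinearMap) →ₗ[k] C ⧸ p :=
      Submodule.liftQ _ (Ideal.Quotient.mkₐ k p).toLinearMap
        fun a ha ↦ Ideal.Quotient.eq_zero_iff_mem.mpr (hle a ha)
    refine Module.Finite.of_surjective g fun x ↦ ?_
    obtain ⟨x, rfl⟩ := Ideal.Quotient.mk_surjective x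
    exact ⟨Submodule.Quotient.mk x, rfl⟩
  exact isMaximal_of_finite_quotient (k := k) p

/-- Induction along a filtration with quotients C/p, where p runs through primes of the support. -/
lemma finite_of_forall_mem_support {k C : Type*} [Field k] [CommRing C] [IsNoetherianRing C]
    [Algebra k C] (N : Type*) [AddCommGroup N] [Module C N] [Module k N] [IsScalarTower k C N]
    (hN : Module.Finite C N)
    (h : ∀ p ∈ Module.support C N, Module.Finite k (C ⧸ p.asIdeal)) : Module.Finite k N := by
  suffices H : (∀ p ∈ Module.support C N, Module.Finite k (C ⧸ p.asIdeal)) →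
      ∀ [Module k N] [IsScalarTower k C N], Module.Finite k N from H h
  clear h
  induction hN using IsNoetherianRing.induction_on_isQuotientEquivQuotientPrime C with
  | subsingleton N => intro _ _ _; infer_instance
  | quotient N p e =>
    intro h _ _
    have : p ∈ Module.support C N := by
      rw [e.support_eq, Module.support_eq_zeroLocus, Ideal.annihilator_quotient]
      exact fun x hx ↦ hx
    have := h p this
    exact Module.Finite.equiv (e.restrictScalars k).symm
  | exact N₁ N₂ N₃ f g hf hg hfg h₁ h₃ =>
    intro h _ _
    let := Module.compHom N₁ (algebraMap k C)
    let := Module.compHom N₃ (algebraMap k C)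
    have : IsScalarTower k C N₁ := .of_algebraMap_smul fun r x ↦ rfl
    have : IsScalarTower k C N₃ := .of_algebraMap_smul fun r x ↦ rfl
    have := h₁ fun p hp ↦ h p (Module.support_subset_of_injective f hf hp)
    have := h₃ fun p hp ↦ h p (Module.support_subset_of_surjective g hg hp)
    exact (finrank_eq_add_of_exact (f.restrictScalars k) (g.restrictScalars k) hf hg hfg).1

/-- Nonzerodivisors of the reduction do not vanish in the domain C_p, so the normalization maps to
its fraction field; by integrality the image of y lies in C_p. The rest descends this equation from
C_p to C. -/
lemma IsNormalAt.exists_smul_eq_algebraMap {C : Type*} [CommRing C] {p : PrimeSpectrum C}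
    (hp : IsNormalAt p) (y : Normalization C) :
    ∃ u ∉ p.asIdeal, ∃ r : C, u • y = algebraMap C (Normalization C) r := by
  obtain ⟨hdom, hic⟩ := hp
  let L := Localization.AtPrime p.asIdeal
  let F := FractionRing L
  let g : Red C →ₐ[C] L := Ideal.Quotient.liftₐ (nilradical C) (Algebra.ofId C L) fun a ha ↦
    ((mem_nilradical.mp ha).map (Algebra.ofId C L)).eq_zero
  have hg (a : C) : g (algebraMap C (Red C) a) = algebraMap C L a := g.commutes a
  have hreg (b : C) (hb : algebraMap C (Red C) b ∈ (Red C)⁰) : algebraMap C L b ≠ 0 := by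
    intro h
    obtain ⟨⟨u, hu⟩, hub⟩ := (IsLocalization.map_eq_zero_iff p.asIdeal.primeCompl L b).mp h
    have := red_mk_mem_nonZeroDivisors.mp hb u (by rw [mul_comm]; exact ⟨1, by simpa using hub⟩)
    exact hu (nilradical_le_prime p.asIdeal (mem_nilradical.mpr this))
  let g' : Red C →ₐ[C] F := (IsScalarTower.toAlgHom C L F).comp g
  have hg' (a : C) : g' (algebraMap C (Red C) a) = algebraMap L F (algebraMap C L a) :=
    congrArg (algebraMap L F) (hg a)
  have hgunit (b : (Red C)⁰) : IsUnit (g' b) := by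
    obtain ⟨b, hb⟩ := b
    obtain ⟨b, rfl⟩ := Ideal.Quotient.mk_surjective b
    change IsUnit (g' (algebraMap C (Red C) b))
    rw [hg']
    exact IsLocalization.map_units F (⟨_, mem_nonZeroDivisors_of_ne_zero (hreg b hb)⟩ : L⁰)
  let j : FractionRing (Red C) →ₐ[C] F :=
    IsLocalization.liftAlgHom (M := (Red C)⁰) (f := g') hgunit
  have hj (a : Red C) : j (algebraMap _ _ a) = g' a := by simp [j]
  have hyint : IsIntegral C y.1 := isIntegral_trans (A := Red C) y.1 y.2
  obtain ⟨l, hl⟩ := hic.isIntegral_iff.mp ((hyint.map j).tower_top (A := L))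
  obtain ⟨r, ⟨v, hv⟩, rfl⟩ := IsLocalization.exists_mk'_eq p.asIdeal.primeCompl l
  obtain ⟨a, ⟨b, hb⟩, hab⟩ := IsLocalization.exists_mk'_eq (Red C)⁰ y.1
  obtain ⟨a, rfl⟩ := Ideal.Quotient.mk_surjective a
  obtain ⟨b, rfl⟩ := Ideal.Quotient.mk_surjective b
  have h1 : y.1 * algebraMap _ _ (algebraMap C (Red C) b) =
      algebraMap _ _ (algebraMap C (Red C) a) := by
    rw [← hab]
    exact IsLocalization.mk'_spec _ _ _
  have h2 : algebraMap C L r * algebraMap C L b = algebraMap C L v * algebraMap C L a := by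
    apply IsFractionRing.injective L F
    have h3 := congrArg j h1
    rw [map_mul, hj, hj, hg', hg', ← hl] at h3
    rw [map_mul, map_mul, ← h3, ← mul_assoc, ← map_mul (algebraMap L F) (algebraMap C L v),
      IsLocalization.mk'_spec' L r (⟨v, hv⟩ : p.asIdeal.primeCompl)]
  rw [← map_mul, ← map_mul] at h2
  obtain ⟨⟨w, hw⟩, h3⟩ := (IsLocalization.eq_iff_exists p.asIdeal.primeCompl L).mp h2
  refine ⟨w * v, fun h ↦ (p.isPrime.mem_or_mem h).elim hw hv, w * r, Subtype.ext ?_⟩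
  have hbu := IsLocalization.map_units (FractionRing (Red C))
    (⟨algebraMap C (Red C) b, hb⟩ : (Red C)⁰)
  apply hbu.mul_left_injective
  have h4 : algebraMap C (FractionRing (Red C)) (w * (r * b)) =
    algebraMap C (FractionRing (Red C)) (w * (v * a)) := congrArg _ h3
  simp only [IsScalarTower.algebraMap_apply C (Red C) (FractionRing (Red C)), map_mul] at h4
  have h5 : (w * v) • y.1 = algebraMap (Red C) (FractionRing (Red C)) (algebraMap C (Red C) w) *
      algebraMap (Red C) (FractionRing (Red C)) (algebraMap C (Red C) v) * y.1 := by
    rw [Algebra.smul_def, IsScalarTower.algebraMap_apply C (Red C) (FractionRing (Red C)), map_mul,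
      map_mul]
  change (w * v) • y.1 * _ =
    algebraMap (Red C) (FractionRing (Red C)) (algebraMap C (Red C) (w * r)) * _
  rw [h5, map_mul, map_mul]
  change _ * y.1 * algebraMap _ _ (algebraMap C (Red C) b) =
    _ * algebraMap _ _ (algebraMap C (Red C) b)
  linear_combination algebraMap (Red C) (FractionRing (Red C)) (algebraMap C (Red C) w) *
    algebraMap (Red C) (FractionRing (Red C)) (algebraMap C (Red C) v) * h1 - h4

lemma IsNormalAt.notMem_support_normCoker {C : Type*} [CommRing C] {p : PrimeSpectrum C}
    (hp : IsNormalAt p) : p ∉ Module.support C (NormCoker C) := by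
  rw [Module.notMem_support_iff']
  intro y
  obtain ⟨y, rfl⟩ := Submodule.Quotient.mk_surjective _ y
  obtain ⟨u, hu, r, hr⟩ := hp.exists_smul_eq_algebraMap y
  exact ⟨u, hu, (Submodule.Quotient.mk_eq_zero _).mpr ⟨r, hr.symm⟩⟩

lemma IsNormalRing.subsingleton_normCoker {C : Type*} [CommRing C] (h : IsNormalRing C) :
    Subsingleton (NormCoker C) := by
  rw [← Module.support_eq_empty_iff (R := C)]
  exact Set.eq_empty_iff_forall_notMem.mpr fun p ↦ (h p).notMem_support_normCoker

variable {k C B : Type*} [Field k] [CommRing C] [IsNoetherianRing C] [Algebra k C] [CommRing B]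
  [Algebra k B] [Algebra C B] [IsScalarTower k C B]

/-- An associated prime of the cyclic module Cy is the annihilator of a multiple cy, and `h0`
forbids it to be maximal. It provides a non-closed point at which y does not vanish. -/
lemma exists_prime_iff_smul_eq_zero
    (h0 : ∀ m : Ideal C, m.IsMaximal → ∀ x : B, (∀ a ∈ m, a • x = 0) → x = 0)
    (y : B) (hy : y ≠ 0) :
    ∃ (c : C) (p : PrimeSpectrum C), ¬ p.asIdeal.IsMaximal ∧
      ∀ a : C, a ∈ p.asIdeal ↔ a • c • y = 0 := by
  have hy' : (⟨y, Submodule.mem_span_singleton_self y⟩ : Submodule.span C {y}) ≠ 0 :=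
    fun h ↦ hy (congrArg Subtype.val h)
  obtain ⟨P, hP, -⟩ := exists_le_isAssociatedPrime_of_isNoetherianRing C _ hy'
  have hprime := hP.isPrime
  obtain ⟨_, ⟨x, hx⟩, hPx⟩ := isAssociatedPrime_iff.mp hP
  obtain ⟨c, rfl⟩ := Submodule.mem_span_singleton.mp hx
  have hmem (a : C) : a ∈ P ↔ a • c • y = 0 := by
    rw [hPx, Submodule.mem_colon_singleton, Submodule.mem_bot]
    exact Subtype.ext_iff
  refine ⟨c, ⟨P, hprime⟩, fun hmax ↦ ?_, hmem⟩
  have := h0 P hmax _ fun a ha ↦ (hmem a).mp ha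
  exact hprime.ne_top ((Ideal.eq_top_iff_one P).mpr ((hmem 1).mpr (by rw [this, smul_zero])))

variable (hker : Module.Finite k (LinearMap.ker (Algebra.linearMap C B)))
  (hcoker : Module.Finite k (B ⧸ LinearMap.range (Algebra.linearMap C B)))
  (hZ : ∀ p ∈ nonNormalLocus C, Module.Finite k p.asIdeal.ResidueField)
  (h0 : ∀ m : Ideal C, m.IsMaximal → ∀ x : B, (∀ a ∈ m, a • x = 0) → x = 0)

lemma isNormalAt_of_not_isMaximal {k C : Type*} [Field k] [CommRing C] [Algebra k C]
    (hZ : ∀ p ∈ nonNormalLocus C, Module.Finite k p.asIdeal.ResidueField) (p : PrimeSpectrum C)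
    (hp : ¬ p.asIdeal.IsMaximal) : IsNormalAt p := by
  by_contra h
  have := hZ p h
  have := finite_quotient_of_finite_residueField (k := k) p.asIdeal
  exact hp (isMaximal_of_finite_quotient (k := k) p.asIdeal)

omit [IsNoetherianRing C] in
lemma exists_notMem_smul_eq_algebraMap
    (hcoker : Module.Finite k (B ⧸ LinearMap.range (Algebra.linearMap C B)))
    (p : Ideal C) [p.IsPrime] (hp : ¬ p.IsMaximal) :
    ∃ v ∉ p, ∀ y : B, ∃ r, algebraMap C B r = v • y := by
  obtain ⟨v, hv, h⟩ := exists_notMem_forall_smul_eq_zero k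
    (N := B ⧸ LinearMap.range (Algebra.linearMap C B)) p hp
  exact ⟨v, hv, fun y ↦ (Submodule.Quotient.mk_eq_zero _).mp (h (Submodule.Quotient.mk y))⟩

include hker hcoker hZ h0 in
-- A nonzero nilpotent x has a multiple cx whose annihilator p is a non-maximal prime. There the
-- kernel and cokernel of C → B vanish and C_p is a domain, so x is zero in B_p, contradicting p =
-- Ann(cx).
theorem isReduced_of_isNormalAt : IsReduced B := by
  refine ⟨fun x hx ↦ ?_⟩
  by_contra hx0
  obtain ⟨c, p, hp, hmem⟩ := exists_prime_iff_smul_eq_zero h0 x hx0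
  obtain ⟨u, hu, hu'⟩ := exists_notMem_forall_smul_eq_zero k
    (N := LinearMap.ker (Algebra.linearMap C B)) p.asIdeal hp
  obtain ⟨v, hv, hv'⟩ := exists_notMem_smul_eq_algebraMap hcoker p.asIdeal hp
  obtain ⟨r, hr⟩ := hv' (c • x)
  have hrnil : IsNilpotent (algebraMap C B r) := by
    rw [hr, smul_smul]; exact hx.smul _
  obtain ⟨n, hn⟩ := hrnil
  have h1 : u * r ^ n = 0 :=
    congrArg Subtype.val (hu' ⟨r ^ n, by simpa using hn⟩)
  have h2 : IsNilpotent (u * r) := ⟨n + 1, by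
    rw [mul_pow, pow_succ, pow_succ]; linear_combination u ^ n * r * h1⟩
  have hdom := (isNormalAt_of_not_isMaximal hZ p hp).1
  have h3 := (h2.map (algebraMap C (Localization.AtPrime p.asIdeal))).eq_zero
  obtain ⟨⟨w, hw⟩, h4⟩ :=
    (IsLocalization.map_eq_zero_iff p.asIdeal.primeCompl (Localization.AtPrime p.asIdeal) _).mp h3
  have h5 : w * u * v ∈ p.asIdeal := by
    rw [hmem, mul_smul, ← hr, Algebra.smul_def, ← map_mul, mul_assoc]
    exact (congrArg (algebraMap C B) h4).trans (map_zero _)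
  exact (p.isPrime.mem_or_mem h5).elim
    (fun h ↦ (p.isPrime.mem_or_mem h).elim hw hu) hv

include hker hcoker hZ h0 in
-- The normalization of B is a quotient of that of C, so its cokernel is a quotient of C̄/C. The
-- latter is finite over C and supported at the non-normal points, whose residue fields are finite
-- over k.
theorem finite_normCoker_of_isNormalAt (hfin : Module.Finite C (Normalization C)) :
    Module.Finite k (NormCoker B) := by
  have hred : IsReduced B := isReduced_of_isNormalAt hker hcoker hZ h0
  have hCB : Module.Finite C B := by
    have : Module.Finite C (B ⧸ LinearMap.range (Algebra.linearMap C B)) :=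
      Module.Finite.of_restrictScalars_finite k C _
    exact Module.Finite.of_submodule_quotient (LinearMap.range (Algebra.linearMap C B))
  obtain ⟨f, hf⟩ := exists_normalization_surjective (C := C) (C' := B)
    (fun r hr ↦ red_mk_mem_nonZeroDivisors.mpr fun y hy ↦ by
      by_contra hy0
      have hy0 : y ≠ 0 := fun h ↦ hy0 (by rw [h]; exact IsNilpotent.zero)
      obtain ⟨c, p, hp, hmem⟩ := exists_prime_iff_smul_eq_zero h0 y hy0
      obtain ⟨u, hu, hu'⟩ := exists_notMem_forall_smul_eq_zero k
        (N := LinearMap.ker (Algebra.linearMap C B)) p.asIdeal hp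
      obtain ⟨v, hv, hv'⟩ := exists_notMem_smul_eq_algebraMap hcoker p.asIdeal hp
      obtain ⟨s, hs⟩ := hv' (c • y)
      have h1 : algebraMap C B (r * s) = 0 := by
        rw [map_mul, hs, smul_smul, mul_smul_comm, hy.eq_zero, smul_zero]
      have h2 : u * (r * s) = 0 := congrArg Subtype.val (hu' ⟨r * s, h1⟩)
      have h3 := red_mk_mem_nonZeroDivisors.mp hr (u * s)
        ⟨1, by rw [pow_one]; linear_combination h2⟩
      have h4 := (h3.map (algebraMap C B)).eq_zero
      have h5 : u * v ∈ p.asIdeal := by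
        rw [hmem, mul_smul, ← hs, Algebra.smul_def, ← map_mul, h4]
      exact (p.isPrime.mem_or_mem h5).elim hu hv)
    (by
      -- The annihilator of B/C lies in no associated prime of B, since these are not maximal and a
      -- finite-dimensional module vanishes at such primes. So it contains a B-regular element,
      -- which serves as common denominator.
      obtain ⟨c, hc, hcreg⟩ := exists_mem_forall_smul_eq_zero (C := C) (E := B)
        (Module.annihilator C (B ⧸ LinearMap.range (Algebra.linearMap C B))) fun P hP hle ↦ by
          have hprime := hP.isPrime
          obtain ⟨_, x, hx⟩ := isAssociatedPrime_iff.mp (AssociatedPrimes.mem_iff.mp hP)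
          have hmem (a : C) : a ∈ P ↔ a • x = 0 := by
            rw [hx, Submodule.mem_colon_singleton, Submodule.mem_bot]
          have hmax : ¬ P.IsMaximal := fun hmax ↦ by
            have := h0 P hmax _ fun a ha ↦ (hmem a).mp ha
            exact hprime.ne_top ((Ideal.eq_top_iff_one P).mpr ((hmem 1).mpr (by
              rw [this, smul_zero])))
          obtain ⟨u, hu, h⟩ := exists_notMem_forall_smul_eq_zero k
            (N := B ⧸ LinearMap.range (Algebra.linearMap C B)) P hmax
          exact hu (hle (Module.mem_annihilator.mpr h))
      refine ⟨c, red_mk_mem_nonZeroDivisors.mpr fun y hy ↦ ?_, fun y ↦ ?_⟩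
      · rw [hcreg y (by rw [Algebra.smul_def]; exact hy.eq_zero)]
        exact IsNilpotent.zero
      · have := Module.mem_annihilator.mp hc (Submodule.Quotient.mk y)
        obtain ⟨r, hr⟩ := (Submodule.Quotient.mk_eq_zero _).mp this
        exact ⟨r, by rw [← Algebra.smul_def]; exact hr⟩)
  have hNC : Module.Finite k (NormCoker C) := by
    refine finite_of_forall_mem_support (C := C) _ inferInstance fun p hp ↦ ?_
    have := hZ p fun h ↦ h.notMem_support_normCoker hp
    exact finite_quotient_of_finite_residueField p.asIdeal
  let g : NormCoker C →ₗ[C] NormCoker B :=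
    Submodule.liftQ _ (((LinearMap.range (Algebra.linearMap B (Normalization B))).mkQ.restrictScalars
      C) ∘ₗ f.toLinearMap) (by
      rintro _ ⟨c, rfl⟩
      refine (Submodule.Quotient.mk_eq_zero _).mpr ⟨algebraMap C B c, ?_⟩
      exact (f.commutes c).symm)
  refine Module.Finite.of_surjective (g.restrictScalars k) fun y ↦ ?_
  obtain ⟨y, rfl⟩ := Submodule.Quotient.mk_surjective _ y
  obtain ⟨x, rfl⟩ := hf y
  exact ⟨Submodule.Quotient.mk x, rfl⟩

end NormalLocus

/-! ### Minimal primes of the normalization and the components of dimension > 1 -/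

section MinimalPrimes

lemma exists_smul_eq_algebraMap_normalization {C : Type*} [CommRing C] (x : Normalization C) :
    ∃ c : C, algebraMap C (Red C) c ∈ (Red C)⁰ ∧
      algebraMap C (Normalization C) c ∈ (Normalization C)⁰ ∧
      ∃ b : C, algebraMap C (Normalization C) c * x = algebraMap C (Normalization C) b := by
  obtain ⟨a, ⟨c, hc⟩, hac⟩ := IsLocalization.exists_mk'_eq (Red C)⁰ x.1
  obtain ⟨a, rfl⟩ := Ideal.Quotient.mk_surjective a
  obtain ⟨c, rfl⟩ := Ideal.Quotient.mk_surjective c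
  refine ⟨c, hc, mem_nonZeroDivisors_iff_right.mpr fun y hy ↦ Subtype.ext ?_, a, Subtype.ext ?_⟩
  · have hu := IsLocalization.map_units (FractionRing (Red C)) (⟨_, hc⟩ : (Red C)⁰)
    apply hu.mul_left_injective
    exact (congrArg Subtype.val hy).trans (zero_mul _).symm
  · have := IsLocalization.mk'_spec' (FractionRing (Red C)) (Ideal.Quotient.mk (nilradical C) a)
      ⟨_, hc⟩
    rw [hac] at this
    exact this

/-- The localization of a reduced ring at a minimal prime is zero-dimensional, local and reduced, so
its maximal ideal is zero. -/
lemma exists_notMem_mul_eq_zero_of_mem_minimalPrimes {N : Type*} [CommRing N] [IsReduced N]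
    {P : Ideal N} (hP : P ∈ minimalPrimes N) {b : N} (hb : b ∈ P) : ∃ u ∉ P, u * b = 0 := by
  have := Ideal.IsMinimalPrime.isPrime hP
  have h : IsNilpotent (algebraMap N (Localization.AtPrime P) b) := by
    have hloc := Ring.KrullDimLE.of_isLocalization P hP (Localization.AtPrime P)
    rw [Ring.KrullDimLE.isNilpotent_iff_mem_maximalIdeal]
    exact (IsLocalization.AtPrime.to_map_mem_maximal_iff _ P b).mpr hb
  have : IsReduced (Localization.AtPrime P) := inferInstance
  obtain ⟨⟨u, hu⟩, h⟩ := (IsLocalization.map_eq_zero_iff P.primeCompl _ _).mp h.eq_zero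
  exact ⟨u, hu, h⟩

/-- Some u ∉ P kills the image of a given a in the contraction. Clearing the denominator of u yields
b in C outside the contraction with ba nilpotent, so every smaller prime contains a. -/
lemma comap_mem_minimalPrimes_of_mem_minimalPrimes_normalization {C : Type*} [CommRing C]
    {P : Ideal (Normalization C)} (hP : P ∈ minimalPrimes (Normalization C)) :
    P.comap (algebraMap C (Normalization C)) ∈ minimalPrimes C := by
  have hprime := Ideal.IsMinimalPrime.isPrime hP
  refine ⟨⟨inferInstance, bot_le⟩, fun q ⟨hq, _⟩ hle a ha ↦ ?_⟩
  obtain ⟨u, hu, h⟩ := exists_notMem_mul_eq_zero_of_mem_minimalPrimes hP (Ideal.mem_comap.mp ha)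
  obtain ⟨c, -, hc, b, hb⟩ := exists_smul_eq_algebraMap_normalization u
  have hbP : b ∉ P.comap (algebraMap C (Normalization C)) := fun h ↦ by
    rw [Ideal.mem_comap, ← hb] at h
    exact (hprime.mem_or_mem h).elim
      (fun h ↦ notMem_nonZeroDivisors_of_mem_mem_minimalPrimes h hP hc) hu
  have h1 : b * a ∈ q := by
    refine nilradical_le_prime q (mem_nilradical.mpr ?_)
    rw [← normalization_algebraMap_eq_zero, map_mul, ← hb, mul_assoc, h, mul_zero]
  exact (hq.mem_or_mem h1).resolve_left fun h ↦ hbP (hle h)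

lemma exists_mem_minimalPrimes_normalization_comap_eq {C : Type*} [CommRing C]
    {P : Ideal C} (hP : P ∈ minimalPrimes C) :
    ∃ Q ∈ minimalPrimes (Normalization C), Q.comap (algebraMap C (Normalization C)) = P := by
  have hprime := Ideal.IsMinimalPrime.isPrime hP
  have hker : RingHom.ker (algebraMap C (Normalization C)) ≤ P := fun x hx ↦
    nilradical_le_prime P (mem_nilradical.mpr (normalization_algebraMap_eq_zero.mp hx))
  have hint : Algebra.IsIntegral C (Normalization C) := Algebra.IsIntegral.trans (Red C)
  obtain ⟨Q, -, hQ, hQP⟩ := Ideal.exists_ideal_over_prime_of_isIntegral (S := Normalization C) P ⊥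
    hker
  obtain ⟨Q', hQ', hle⟩ := Ideal.exists_minimalPrimes_le (I := ⊥) (J := Q) bot_le
  refine ⟨Q', hQ', le_antisymm ?_ ?_⟩
  · rw [← hQP]; exact Ideal.comap_mono hle
  · have := comap_mem_minimalPrimes_of_mem_minimalPrimes_normalization hQ'
    exact hP.2 this.1 (by rw [← hQP]; exact Ideal.comap_mono hle)

lemma krullDimLE_one_iff_of_isIntegral {D E : Type*} [CommRing D] [CommRing E] [IsDomain D]
    [IsDomain E] [Algebra D E] [Algebra.IsIntegral D E]
    (hinj : Function.Injective (algebraMap D E)) :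
    Ring.KrullDimLE 1 D ↔ Ring.KrullDimLE 1 E := by
  rw [Ring.krullDimLE_one_iff_of_noZeroDivisors, Ring.krullDimLE_one_iff_of_noZeroDivisors]
  refine ⟨fun H P hP hprime ↦ ?_, fun H p hp hprime ↦ ?_⟩
  · have := H (P.comap (algebraMap D E)) (fun h ↦ hP (Ideal.eq_bot_of_comap_eq_bot (R := D) h))
      inferInstance
    exact Ideal.isMaximal_of_isIntegral_of_isMaximal_comap P this
  · obtain ⟨Q, -, hQ, rfl⟩ := Ideal.exists_ideal_over_prime_of_isIntegral (S := E) p ⊥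
      (by rw [← RingHom.ker, (RingHom.injective_iff_ker_eq_bot _).mp hinj]; exact bot_le)
    have := H Q (fun h ↦ hp (by
      rw [h, ← RingHom.ker, (RingHom.injective_iff_ker_eq_bot _).mp hinj])) hQ
    exact Ideal.isMaximal_comap_of_isIntegral_of_isMaximal Q

lemma one_lt_ringKrullDim_iff {E : Type*} [CommRing E] :
    ((1 : ℕ) : WithBot ℕ∞) < ringKrullDim E ↔ ¬ Ring.KrullDimLE 1 E := by
  rw [Ring.krullDimLE_iff, not_le]

lemma one_lt_ringKrullDim_quotient_comap_iff {C N : Type*} [CommRing C] [CommRing N] [Algebra C N]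
    [Algebra.IsIntegral C N] (P : Ideal N) [P.IsPrime] :
    ((1 : ℕ) : WithBot ℕ∞) < ringKrullDim (C ⧸ P.comap (algebraMap C N)) ↔
      ((1 : ℕ) : WithBot ℕ∞) < ringKrullDim (N ⧸ P) := by
  rw [one_lt_ringKrullDim_iff, one_lt_ringKrullDim_iff, not_iff_not]
  have : (P.comap (algebraMap C N)).IsPrime := inferInstance
  exact krullDimLE_one_iff_of_isIntegral (D := C ⧸ P.comap (algebraMap C N)) (E := N ⧸ P)
    Ideal.algebraMap_quotient_injective

lemma isRadical_dimGTIdeal (C : Type*) [CommRing C] (i : ℕ) : (dimGTIdeal C i).IsRadical := by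
  intro x ⟨n, hx⟩
  rw [dimGTIdeal, Submodule.mem_sInf] at hx ⊢
  exact fun P hP ↦ (Ideal.IsMinimalPrime.isPrime hP.1).mem_of_pow_mem n (hx P hP)

instance isReduced_partGT (C : Type*) [CommRing C] (i : ℕ) : IsReduced (PartGT C i) :=
  (Ideal.isRadical_iff_quotient_reduced _).mp (isRadical_dimGTIdeal C i)

lemma partGT_algebraMap_eq_zero {C : Type*} [CommRing C] {i : ℕ} {x : C} :
    algebraMap C (PartGT C i) x = 0 ↔ x ∈ dimGTIdeal C i := Ideal.Quotient.eq_zero_iff_mem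

lemma notMem_of_mem_nonZeroDivisors_red {C : Type*} [CommRing C] {r : C}
    (hr : algebraMap C (Red C) r ∈ (Red C)⁰) {P : Ideal C} (hP : P ∈ minimalPrimes C) : r ∉ P := by
  intro h
  have hprime := Ideal.IsMinimalPrime.isPrime hP
  have hP' : P ∈ (nilradical C).minimalPrimes := by
    rwa [nilradical, Ideal.radical_minimalPrimes]
  obtain ⟨y, hy, hry⟩ := Ideal.exists_mul_mem_of_mem_minimalPrimes hP' h
  exact hy (mem_nilradical.mpr (red_mk_mem_nonZeroDivisors.mp hr y (mem_nilradical.mp hry)))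

lemma partGT_mem_nonZeroDivisors {C : Type*} [CommRing C] {i : ℕ} {r : C}
    (hr : algebraMap C (Red C) r ∈ (Red C)⁰) : algebraMap C (PartGT C i) r ∈ (PartGT C i)⁰ := by
  refine mem_nonZeroDivisors_iff_right.mpr fun y hy ↦ ?_
  obtain ⟨y, rfl⟩ := Ideal.Quotient.mk_surjective y
  change algebraMap C (PartGT C i) y * _ = 0 at hy
  change algebraMap C (PartGT C i) y = 0
  rw [← map_mul, partGT_algebraMap_eq_zero, dimGTIdeal, Submodule.mem_sInf] at hy
  rw [partGT_algebraMap_eq_zero, dimGTIdeal, Submodule.mem_sInf]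
  exact fun P hP ↦ ((Ideal.IsMinimalPrime.isPrime hP.1).mem_or_mem (hy P hP)).resolve_right
    (notMem_of_mem_nonZeroDivisors_red hr hP.1)

lemma red_mk_mem_nonZeroDivisors_iff_of_isReduced {C : Type*} [CommRing C] [IsReduced C] {r : C} :
    algebraMap C (Red C) r ∈ (Red C)⁰ ↔ r ∈ C⁰ := by
  rw [red_mk_mem_nonZeroDivisors, mem_nonZeroDivisors_iff_left]
  simp only [isNilpotent_iff_eq_zero]

lemma exists_normalization_partGT_surjective (C : Type*) [CommRing C] [IsNoetherianRing C]
    (i : ℕ) :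
    ∃ f : Normalization C →ₐ[C] Normalization (PartGT C i), Function.Surjective f :=
  exists_normalization_surjective
    (fun _ hr ↦ red_mk_mem_nonZeroDivisors_iff_of_isReduced.mpr (partGT_mem_nonZeroDivisors hr))
    ⟨1, by simp only [map_one]; exact one_mem _, fun y ↦ by
      obtain ⟨y, rfl⟩ := Ideal.Quotient.mk_surjective y
      exact ⟨y, by rw [map_one, one_mul]; rfl⟩⟩

/-- Writing cx = b with c outside all minimal primes reduces membership of x to that of b in C.
Minimal primes of C and of its normalization lie over each other, and integrality preserves the
condition that the quotient has dimension > 1. -/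
lemma ker_normalization_partGT_one {C : Type*} [CommRing C]
    (f : Normalization C →ₐ[C] Normalization (PartGT C 1)) :
    RingHom.ker f = dimGTIdeal (Normalization C) 1 := by
  have hint : Algebra.IsIntegral C (Normalization C) := Algebra.IsIntegral.trans (Red C)
  ext x
  obtain ⟨c, hc, hcN, b, hb⟩ := exists_smul_eq_algebraMap_normalization x
  have hN (y : C) : algebraMap C (Normalization (PartGT C 1)) y =
    algebraMap (PartGT C 1) _ (algebraMap C (PartGT C 1) y) := rfl
  have h1 : f x = 0 ↔ b ∈ dimGTIdeal C 1 := by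
    have h2 : algebraMap C (Normalization (PartGT C 1)) c * f x =
      algebraMap C (Normalization (PartGT C 1)) b := by
      rw [← f.commutes, ← f.commutes, ← map_mul, hb]
    have h3 : f x = 0 ↔ algebraMap C (Normalization (PartGT C 1)) b = 0 := by
      rw [← h2]
      refine ⟨fun h ↦ by rw [h, mul_zero], fun h ↦ ?_⟩
      have hu := IsLocalization.map_units (FractionRing (Red (PartGT C 1)))
        (⟨_, red_mk_mem_nonZeroDivisors_iff_of_isReduced.mpr
          (partGT_mem_nonZeroDivisors (i := 1) hc)⟩ : (Red (PartGT C 1))⁰)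
      apply Subtype.ext
      exact hu.mul_right_injective ((congrArg Subtype.val h).trans (mul_zero _).symm)
    rw [h3, hN, normalization_algebraMap_eq_zero, isNilpotent_iff_eq_zero,
      partGT_algebraMap_eq_zero]
  rw [RingHom.mem_ker, h1, dimGTIdeal, dimGTIdeal, Submodule.mem_sInf, Submodule.mem_sInf]
  have h4 (P : Ideal (Normalization C)) (hP : P ∈ minimalPrimes (Normalization C)) :
      x ∈ P ↔ b ∈ P.comap (algebraMap C (Normalization C)) := by
    have hprime := Ideal.IsMinimalPrime.isPrime hP
    rw [Ideal.mem_comap, ← hb, hprime.mul_mem_iff_mem_or_mem, or_iff_right]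
    exact fun h ↦ notMem_nonZeroDivisors_of_mem_mem_minimalPrimes h hP hcN
  constructor
  · rintro H P ⟨hP, hdim⟩
    have hprime := Ideal.IsMinimalPrime.isPrime hP
    exact (h4 P hP).mpr (H _ ⟨comap_mem_minimalPrimes_of_mem_minimalPrimes_normalization hP,
      (one_lt_ringKrullDim_quotient_comap_iff P).mpr hdim⟩)
  · rintro H P ⟨hP, hdim⟩
    obtain ⟨Q, hQ, rfl⟩ := exists_mem_minimalPrimes_normalization_comap_eq hP
    have hprime := Ideal.IsMinimalPrime.isPrime hQ
    exact (h4 Q hQ).mp (H Q ⟨hQ, (one_lt_ringKrullDim_quotient_comap_iff Q).mp hdim⟩)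

theorem nonempty_normalization_partGT_algEquiv (C : Type*) [CommRing C] [IsNoetherianRing C] :
    Nonempty (Normalization (PartGT C 1) ≃ₐ[C] PartGT (Normalization C) 1) := by
  obtain ⟨f, hf⟩ := exists_normalization_partGT_surjective C 1
  exact ⟨(Ideal.quotientKerAlgEquivOfSurjective hf).symm.trans
    (Ideal.quotientEquivAlgOfEq C (ker_normalization_partGT_one f))⟩

lemma exists_mem_minimalPrimes_le_of_dimGTIdeal_le {C : Type*} [CommRing C] [IsNoetherianRing C]
    {i : ℕ} {P : Ideal C} [hP : P.IsPrime] (hle : dimGTIdeal C i ≤ P) :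
    ∃ Q ∈ minimalPrimes C, (i : WithBot ℕ∞) < ringKrullDim (C ⧸ Q) ∧ Q ≤ P := by
  have hS : {P | P ∈ minimalPrimes C ∧ (i : WithBot ℕ∞) < ringKrullDim (C ⧸ P)}.Finite :=
    (minimalPrimes.finite_of_isNoetherianRing C).subset fun _ h ↦ h.1
  obtain ⟨Q, hQ, hQP⟩ := (Ideal.IsPrime.inf_le' hP (s := hS.toFinset) (f := id)).mp (by
    refine le_trans (le_of_eq ?_) hle
    rw [Finset.inf_id_eq_sInf, Set.Finite.coe_toFinset]
    rfl)
  rw [Set.Finite.mem_toFinset] at hQ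
  exact ⟨Q, hQ.1, hQ.2, hQP⟩

/-- The components of `Spec R^{>1}` are components of `Spec R` of dimension `> 1`. -/
lemma one_lt_ringKrullDim_of_mem_minimalPrimes_partGT {C : Type*} [CommRing C]
    [IsNoetherianRing C] {P : Ideal (PartGT C 1)} (hP : P ∈ minimalPrimes (PartGT C 1)) :
    ((1 : ℕ) : WithBot ℕ∞) < ringKrullDim (PartGT C 1 ⧸ P) := by
  have hprime := Ideal.IsMinimalPrime.isPrime hP
  have hsurj : Function.Surjective (algebraMap C (PartGT C 1)) := Ideal.Quotient.mk_surjective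
  have hle : dimGTIdeal C 1 ≤ P.comap (algebraMap C (PartGT C 1)) := fun x hx ↦ by
    rw [Ideal.mem_comap, partGT_algebraMap_eq_zero.mpr hx]
    exact zero_mem _
  obtain ⟨Q, hQ, hQdim, hQP⟩ := exists_mem_minimalPrimes_le_of_dimGTIdeal_le hle
  have hQle : dimGTIdeal C 1 ≤ Q := sInf_le ⟨hQ, hQdim⟩
  have hQprime := hQ.isPrime
  have hQ' : (Q.map (algebraMap C (PartGT C 1))).IsPrime :=
    Ideal.map_isPrime_of_surjective (f := algebraMap C (PartGT C 1)) hsurj fun x hx ↦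
      hQle (partGT_algebraMap_eq_zero.mp hx)
  have hcomap : (Q.map (algebraMap C (PartGT C 1))).comap (algebraMap C (PartGT C 1)) = Q := by
    rw [Ideal.comap_map_of_surjective (algebraMap C (PartGT C 1)) hsurj, sup_eq_left]
    intro x hx
    exact hQle (partGT_algebraMap_eq_zero.mp hx)
  have hPQ : P = Q.map (algebraMap C (PartGT C 1)) := by
    have hmap : Q.map (algebraMap C (PartGT C 1)) ≤ P := Ideal.map_le_iff_le_comap.mpr hQP
    exact le_antisymm (hP.2 ⟨hQ', bot_le⟩ hmap) hmap
  have h := hQdim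
  rw [← hcomap] at h
  have hint : Algebra.IsIntegral C (PartGT C 1) :=
    Algebra.isIntegral_of_surjective Ideal.Quotient.mk_surjective
  subst hPQ
  exact (one_lt_ringKrullDim_quotient_comap_iff (C := C) (N := PartGT C 1) _).mp h

lemma one_lt_ringKrullDim_of_mem_minimalPrimes_normalization {C : Type*} [CommRing C]
    [IsNoetherianRing C] {P : Ideal (Normalization (PartGT C 1))}
    (hP : P ∈ minimalPrimes (Normalization (PartGT C 1))) :
    ((1 : ℕ) : WithBot ℕ∞) < ringKrullDim (Normalization (PartGT C 1) ⧸ P) := by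
  have hprime := Ideal.IsMinimalPrime.isPrime hP
  have hint : Algebra.IsIntegral (PartGT C 1) (Normalization (PartGT C 1)) :=
    Algebra.IsIntegral.trans (Red (PartGT C 1))
  exact (one_lt_ringKrullDim_quotient_comap_iff P).mp
    (one_lt_ringKrullDim_of_mem_minimalPrimes_partGT
      (comap_mem_minimalPrimes_of_mem_minimalPrimes_normalization hP))

end MinimalPrimes

/-! ### Torsion-freeness, that is, flatness over A -/

section TorsionFree

variable {A C : Type*} [CommRing A] [IsDomain A] [CommRing C] [Algebra A C]

lemma isTorsionFree_iff_forall_mem_nonZeroDivisors :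
    Module.IsTorsionFree A C ↔ ∀ a : A, a ≠ 0 → algebraMap A C a ∈ C⁰ := by
  rw [Module.isTorsionFree_iff_smul_eq_zero]
  simp only [mem_nonZeroDivisors_iff_left, Algebra.smul_def]
  exact ⟨fun h a ha x hx ↦ (h a x hx).resolve_left ha,
    fun h a x hx ↦ or_iff_not_imp_left.mpr fun ha ↦ h a ha x hx⟩

variable [Module.IsTorsionFree A C]

lemma algebraMap_mem_nonZeroDivisors (C : Type*) [CommRing C] [Algebra A C]
    [Module.IsTorsionFree A C] {a : A} (ha : a ≠ 0) : algebraMap A C a ∈ C⁰ :=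
  isTorsionFree_iff_forall_mem_nonZeroDivisors.mp ‹_› a ha

lemma red_algebraMap_mem_nonZeroDivisors (C : Type*) [CommRing C] [Algebra A C]
    [Module.IsTorsionFree A C] {a : A} (ha : a ≠ 0) :
    algebraMap C (Red C) (algebraMap A C a) ∈ (Red C)⁰ := by
  refine red_mk_mem_nonZeroDivisors.mpr fun y ⟨n, hn⟩ ↦ ⟨n, ?_⟩
  rw [mul_pow, ← map_pow] at hn
  exact mem_nonZeroDivisors_iff_left.mp
    (algebraMap_mem_nonZeroDivisors C (pow_ne_zero n ha)) _ hn

instance isTorsionFree_red : Module.IsTorsionFree A (Red C) :=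
  isTorsionFree_iff_forall_mem_nonZeroDivisors.mpr fun _ ha ↦
    red_algebraMap_mem_nonZeroDivisors C ha

instance isTorsionFree_partGT (i : ℕ) : Module.IsTorsionFree A (PartGT C i) :=
  isTorsionFree_iff_forall_mem_nonZeroDivisors.mpr fun _ ha ↦
    partGT_mem_nonZeroDivisors (red_algebraMap_mem_nonZeroDivisors C ha)

instance isTorsionFree_normalization : Module.IsTorsionFree A (Normalization C) := by
  refine isTorsionFree_iff_forall_mem_nonZeroDivisors.mpr fun a ha ↦
    mem_nonZeroDivisors_iff_right.mpr fun y hy ↦ Subtype.ext ?_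
  exact (IsLocalization.map_units (FractionRing (Red C))
    (⟨_, red_algebraMap_mem_nonZeroDivisors C ha⟩ : (Red C)⁰)).mul_left_injective
      ((congrArg Subtype.val hy).trans (zero_mul _).symm)

end TorsionFree

/-! ### Elements of the fibre rings -/

section Fibers

variable {A : Type*} [CommRing A]

lemma isNoetherianRing_fiber (p : Ideal A) [p.IsPrime] (C : Type*) [CommRing C] [Algebra A C]
    [IsNoetherianRing C] : IsNoetherianRing (p.Fiber C) := by
  have : IsNoetherianRing (C ⊗[A] p.ResidueField) := Algebra.EssFiniteType.isNoetherianRing C _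
  exact isNoetherianRing_of_ringEquiv _
    (Algebra.TensorProduct.comm A C p.ResidueField).toRingEquiv

lemma exists_isUnit_mul_eq_includeRight (p : Ideal A) [p.IsPrime] {C : Type*} [CommRing C]
    [Algebra A C] (x : p.Fiber C) :
    ∃ r ∉ p, IsUnit (algebraMap A (p.Fiber C) r) ∧
      ∃ c : C, algebraMap A (p.Fiber C) r * x = 1 ⊗ₜ c := by
  obtain ⟨r, hr, c, h⟩ := Ideal.Fiber.exists_smul_eq_one_tmul p x
  refine ⟨r, hr, ?_, c, by rw [← Algebra.smul_def, h]⟩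
  rw [IsScalarTower.algebraMap_apply A p.ResidueField]
  exact (IsUnit.mk0 _ fun h ↦ hr (Ideal.algebraMap_residueField_eq_zero.mp h)).map _

lemma one_tmul_bot_eq_zero [IsDomain A] {C : Type*} [AddCommGroup C] [Module A C]
    [Module.Flat A C] {c : C} (h : (1 ⊗ₜ c : (⊥ : Ideal A).Fiber C) = 0) : c = 0 := by
  have hinj : Function.Injective (Algebra.linearMap A (⊥ : Ideal A).ResidueField) :=
    IsFractionRing.injective A (⊥ : Ideal A).ResidueField
  have := Module.Flat.rTensor_preserves_injective_linearMap (M := C) _ hinj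
  have h1 : (Algebra.linearMap A (⊥ : Ideal A).ResidueField).rTensor C (1 ⊗ₜ c) = 0 := by
    rw [LinearMap.rTensor_tmul, Algebra.linearMap_apply, map_one, h]
  have h2 := this (h1.trans (map_zero _).symm)
  simpa using congrArg (TensorProduct.lid A C) h2

lemma surjective_one_tmul (p : Ideal A) [p.IsMaximal] {C : Type*} [CommRing C] [Algebra A C] :
    Function.Surjective (Algebra.TensorProduct.includeRight : C →ₐ[A] p.Fiber C) :=
  TensorProduct.mk_surjective _ _ _ (Ideal.algebraMap_residueField_surjective p)

lemma mem_of_one_tmul_eq_zero (p : Ideal A) [p.IsMaximal] {C : Type*} [CommRing C] [Algebra A C]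
    {c : C} (h : (1 ⊗ₜ c : p.Fiber C) = 0) : c ∈ p.map (algebraMap A C) := by
  let e : (A ⧸ p) ≃ₗ[A] p.ResidueField := LinearEquiv.ofBijective
    (IsScalarTower.toAlgHom A (A ⧸ p) p.ResidueField).toLinearMap
    (Ideal.bijective_algebraMap_quotient_residueField p)
  have h1 : e.rTensor C (1 ⊗ₜ c) = 0 := by
    rw [LinearEquiv.rTensor_tmul, ← h]
    congr 1
    exact map_one (algebraMap (A ⧸ p) p.ResidueField)
  have h2 := congrArg (TensorProduct.quotTensorEquivQuotSMul C p)
    ((LinearEquiv.map_eq_zero_iff _).mp h1)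
  rw [map_zero, ← map_one (Ideal.Quotient.mk p),
    TensorProduct.quotTensorEquivQuotSMul_mk_tmul, one_smul] at h2
  have h3 := (Submodule.Quotient.mk_eq_zero _).mp h2
  rwa [Ideal.smul_top_eq_map] at h3

end Fibers

/-! ### A dimension bound over a principal ideal domain -/

section Dimension

/-- All nonzero primes below a maximal ideal M contract to the same maximal ideal of A, so they
share a nonzero element a of A. Krull's principal ideal theorem shows that M is minimal over a, so
no nonzero prime lies strictly below M. No finiteness of E over A is needed. -/
lemma krullDimLE_one_of_forall_exists_mem {A E : Type*} [CommRing A] [IsDomain A]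
    [IsPrincipalIdealRing A] [CommRing E] [IsDomain E] [IsNoetherianRing E] [Algebra A E]
    (hinj : Function.Injective (algebraMap A E))
    (h : ∀ q : Ideal E, q.IsPrime → q ≠ ⊥ → ∃ a : A, a ≠ 0 ∧ algebraMap A E a ∈ q) :
    Ring.KrullDimLE 1 E := by
  rw [Ring.krullDimLE_one_iff_of_noZeroDivisors]
  intro q hq0 hq
  obtain ⟨M, hM, hqM⟩ := Ideal.exists_le_maximal q hq.ne_top
  have hcomap (q : Ideal E) (hq : q.IsPrime) (hq0 : q ≠ ⊥) (hqM : q ≤ M) :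
      q.comap (algebraMap A E) = M.comap (algebraMap A E) := by
    obtain ⟨a, ha, haq⟩ := h q hq hq0
    have : (q.comap (algebraMap A E)).IsMaximal :=
      IsPrime.to_maximal_ideal fun h ↦ ha (by
        have : a ∈ q.comap (algebraMap A E) := haq
        rwa [h] at this)
    exact this.eq_of_le (Ideal.IsPrime.ne_top inferInstance) (Ideal.comap_mono hqM)
  obtain ⟨a, ha, haq⟩ := h q hq hq0
  let I := Ideal.span {algebraMap A E a}
  have ha0 : algebraMap A E a ≠ 0 := fun h ↦ ha (hinj (h.trans (map_zero _).symm))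
  have hIM : I ≤ M := (Ideal.span_singleton_le_iff_mem _).mpr (hqM haq)
  have hmem (q' : Ideal E) (hq' : q'.IsPrime) (h0 : q' ≠ ⊥) (hle : q' ≤ M) : I ≤ q' := by
    rw [Ideal.span_singleton_le_iff_mem, ← Ideal.mem_comap, hcomap q' hq' h0 hle]
    exact hqM haq
  obtain ⟨P, hP, hMP⟩ : ∃ P ∈ I.minimalPrimes, M ≤ P := by
    -- Otherwise prime avoidance gives f ∈ M outside every minimal prime of (a). A minimal prime of
    -- (f) inside M contains a, hence strictly contains a nonzero minimal prime of (a), and so has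
    -- height at least 2, against Krull.
    by_contra! H
    have h1 : ¬ (M : Set E) ⊆ ⋃ P ∈ I.minimalPrimes, (id P : Ideal E) := fun hsub ↦ by
      obtain ⟨P, hP, hle⟩ := (Ideal.subset_union_prime_finite
        (Ideal.finite_minimalPrimes_of_isNoetherianRing E I) (f := id) 0 0
        fun _ h _ _ ↦ h.isPrime).1 hsub
      exact H P hP hle
    obtain ⟨f, hfM, hf⟩ := Set.not_subset.mp h1
    simp only [id, Set.mem_iUnion, SetLike.mem_coe, exists_prop, not_exists, not_and] at hf
    obtain ⟨P', hP', hP'M⟩ := Ideal.exists_minimalPrimes_le (I := Ideal.span {f}) (J := M)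
      ((Ideal.span_singleton_le_iff_mem _).mpr hfM)
    have hfP' : f ∈ P' := hP'.le (Ideal.mem_span_singleton_self f)
    have hprime' := hP'.isPrime
    obtain ⟨P₀, hP₀, -⟩ := Ideal.exists_minimalPrimes_le hIM
    have hf0 : f ≠ 0 := fun h ↦ hf P₀ hP₀ (by rw [h]; exact zero_mem _)
    obtain ⟨Q, hQ, hQP'⟩ := Ideal.exists_minimalPrimes_le
      (hmem P' hprime' (fun h ↦ hf0 (by rwa [h] at hfP')) hP'M)
    have hQprime := hQ.isPrime
    have hlt : Q < P' := lt_of_le_of_ne hQP' fun h ↦ hf Q hQ (by rwa [h])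
    have hQ0 : ⊥ < Q := bot_lt_iff_ne_bot.mpr fun h ↦ ha0 (by
      have := hQ.le (Ideal.mem_span_singleton_self (algebraMap A E a))
      rwa [h] at this)
    have h2 := Ideal.height_add_one_le_of_lt_of_isPrime hlt
    have h3 := Ideal.height_add_one_le_of_lt_of_isPrime hQ0
    have h4 := Ideal.height_le_one_of_isPrincipal_of_mem_minimalPrimes _ _ hP'
    have h5 : (1 : ℕ∞) + 1 ≤ 1 :=
      (add_le_add_left (le_add_self.trans h3) 1).trans (h2.trans h4)
    exact absurd h5 (by decide)
  have hle : M ≤ q := hMP.trans (hP.2 ⟨hq, hmem q hq hq0 hqM⟩ (by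
    have := hM.eq_of_le hP.isPrime.ne_top hMP
    rwa [← this]))
  rwa [le_antisymm hqM hle]

end Dimension

/-! ### Fibres of B have no closed points of depth zero -/

section FiberDepth

variable {A B : Type*} [CommRing A] [IsDomain A] [IsPrincipalIdealRing A] [CommRing B]
  [IsNoetherianRing B] [Algebra A B] [Module.IsTorsionFree A B]

/-- Up to a unit x comes from y in B, and p = m ∩ B kills y. As B is reduced, p lies in a minimal
prime, hence equals it. Maximality of m makes every larger prime meet A nontrivially, so B/p has
dimension at most 1, contrary to `hmin`. -/
lemma fiber_bot_eq_zero_of_isMaximal_smul [IsReduced B]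
    (hmin : ∀ P ∈ minimalPrimes B, ((1 : ℕ) : WithBot ℕ∞) < ringKrullDim (B ⧸ P))
    (m : Ideal ((⊥ : Ideal A).Fiber B)) (hm : m.IsMaximal) (x : (⊥ : Ideal A).Fiber B)
    (hx : ∀ a ∈ m, a * x = 0) : x = 0 := by
  obtain ⟨r, -, hr, y, hy⟩ := exists_isUnit_mul_eq_includeRight _ x
  rw [← hr.mul_right_eq_zero, hy]
  have hy0 (a : (⊥ : Ideal A).Fiber B) (ha : a ∈ m) : a * (1 ⊗ₜ y) = 0 := by
    rw [← hy, mul_left_comm, hx a ha, mul_zero]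
  suffices y = 0 by rw [this, tmul_zero]
  by_contra hne
  let ι : B →ₐ[A] (⊥ : Ideal A).Fiber B := Algebra.TensorProduct.includeRight
  let p : Ideal B := m.comap ι
  have hιinj (b : B) (h : ι b = 0) : b = 0 := one_tmul_bot_eq_zero h
  have hpy (b : B) (hb : b ∈ p) : b * y = 0 := hιinj _ (by
    rw [map_mul]; exact hy0 _ hb)
  obtain ⟨P, hP, hyP⟩ : ∃ P ∈ minimalPrimes B, y ∉ P := by
    by_contra! H
    have : y ∈ sInf ((⊥ : Ideal B).minimalPrimes) := Submodule.mem_sInf.mpr H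
    rw [Ideal.sInf_minimalPrimes] at this
    exact hne (mem_nilradical.mp this).eq_zero
  have hPprime := hP.isPrime
  have hpP : p ≤ P := fun b hb ↦
    (hPprime.mem_or_mem (by rw [hpy b hb]; exact zero_mem _)).resolve_right hyP
  have hpeq : p = P := le_antisymm hpP (hP.2 ⟨inferInstance, bot_le⟩ hpP)
  have hunit (a : A) (ha : a ≠ 0) : IsUnit (algebraMap A ((⊥ : Ideal A).Fiber B) a) := by
    rw [IsScalarTower.algebraMap_apply A (⊥ : Ideal A).ResidueField]
    exact (IsUnit.mk0 _ fun h ↦ ha (Ideal.algebraMap_residueField_eq_zero.mp h)).map _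
  have hAp (a : A) (ha : algebraMap A B a ∈ p) : a = 0 := by
    by_contra ha0
    refine hm.ne_top (Ideal.eq_top_of_isUnit_mem _ ?_ (hunit a ha0))
    rw [← ι.commutes]; exact ha
  have hmeet (q : Ideal B) (hq : q.IsPrime) (hlt : p < q) :
      ∃ a : A, a ≠ 0 ∧ algebraMap A B a ∈ q := by
    obtain ⟨b, hbq, hbp⟩ := SetLike.exists_of_lt hlt
    -- Since b is invertible modulo m, clearing denominators in fb + n = 1 puts a nonzero element of
    -- A into q.
    obtain ⟨f, hf⟩ := hm.exists_inv (x := ι b) hbp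
    obtain ⟨n, hn, hfn⟩ := hf
    obtain ⟨r₁, h₁, hu₁, c, hc⟩ := exists_isUnit_mul_eq_includeRight _ f
    obtain ⟨r₂, h₂, hu₂, d, hd⟩ := exists_isUnit_mul_eq_includeRight _ n
    refine ⟨r₁ * r₂, mul_ne_zero (fun h ↦ h₁ (by rw [h]; exact zero_mem _))
      (fun h ↦ h₂ (by rw [h]; exact zero_mem _)), ?_⟩
    have hdp : d ∈ p := by
      change (1 ⊗ₜ d : (⊥ : Ideal A).Fiber B) ∈ m
      rw [← hd]; exact m.mul_mem_left _ hn
    have : algebraMap A B (r₁ * r₂) = algebraMap A B r₂ * c * b + algebraMap A B r₁ * d := by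
      rw [← sub_eq_zero]
      apply hιinj
      have hc' : algebraMap A _ r₁ * f = ι c := hc
      have hd' : algebraMap A _ r₂ * n = ι d := hd
      simp only [map_sub, map_add, map_mul, AlgHom.commutes]
      rw [← hc', ← hd']
      linear_combination -(algebraMap A ((⊥ : Ideal A).Fiber B) r₁ * algebraMap A _ r₂) * hfn
    rw [this]
    exact add_mem (q.mul_mem_left _ hbq) (q.mul_mem_left _ (hlt.le hdp))
  refine one_lt_ringKrullDim_iff.mp (hmin P hP) ?_
  rw [← hpeq]
  have hpprime : p.IsPrime := inferInstance
  refine krullDimLE_one_of_forall_exists_mem (A := A) ?_ fun q hq hq0 ↦ ?_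
  · rw [injective_iff_map_eq_zero]
    exact fun a ha ↦ hAp a (Ideal.Quotient.eq_zero_iff_mem.mp ha)
  · have hlt : p < q.comap (Ideal.Quotient.mk p) := by
      refine lt_of_le_of_ne (fun b hb ↦ ?_) fun h ↦ hq0 ?_
      · rw [Ideal.mem_comap, Ideal.Quotient.eq_zero_iff_mem.mpr hb]; exact zero_mem _
      · rw [← Ideal.map_comap_of_surjective _ Ideal.Quotient.mk_surjective q, ← h,
          Ideal.map_quotient_self]
    exact hmeet _ inferInstance hlt

omit [IsNoetherianRing B] [Module.IsTorsionFree A B] in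
-- The determinant trick: y acts on the finitely generated ideal M, which is faithful because it
-- contains a regular element.
lemma isIntegral_of_forall_mul_mem {Q : Type*} [CommRing Q] [Algebra B Q] (y : Q) (M : Ideal B)
    (hM : M.FG) (hinj : Function.Injective (algebraMap B Q))
    (hreg : ∃ a ∈ M, algebraMap B Q a ∈ Q⁰)
    (h : ∀ a ∈ M, ∃ c ∈ M, algebraMap B Q a * y = algebraMap B Q c) : IsIntegral B y := by
  choose g hg using fun a : M ↦ h a.1 a.2
  let φ : Module.End B M :=
    { toFun := fun a ↦ ⟨g a, (hg a).1⟩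
      map_add' := fun a b ↦ Subtype.ext (hinj (by
        change algebraMap B Q (g (a + b)) = algebraMap B Q (g a + g b)
        rw [map_add, ← (hg _).2, ← (hg _).2, ← (hg _).2, Submodule.coe_add, map_add, add_mul]))
      map_smul' := fun r a ↦ Subtype.ext (hinj (by
        change algebraMap B Q (g (r • a)) = algebraMap B Q (r * g a)
        rw [map_mul, ← (hg _).2, ← (hg _).2, Submodule.coe_smul, smul_eq_mul, map_mul,
          mul_assoc])) }
  have hφ (a : M) : algebraMap B Q (φ a).1 = y * algebraMap B Q a.1 := by
    rw [mul_comm]; exact (hg a).2.symm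
  have : Module.Finite B M := Module.Finite.iff_fg.mpr hM
  obtain ⟨p, hp, hp0⟩ := LinearMap.exists_monic_and_aeval_eq_zero B φ
  have hpow (n : ℕ) (a : M) : algebraMap B Q ((φ ^ n) a).1 = y ^ n * algebraMap B Q a.1 := by
    induction n generalizing a with
    | zero => simp
    | succ n ih => rw [pow_succ, Module.End.mul_apply, ih, hφ, pow_succ, mul_assoc]
  have hpoly (p : Polynomial B) (a : M) : algebraMap B Q (Polynomial.aeval φ p a).1 =
      Polynomial.aeval y p * algebraMap B Q a.1 := by
    induction p using Polynomial.induction_on' with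
    | add p q hp hq =>
      rw [map_add, map_add, add_mul, ← hp, ← hq, LinearMap.add_apply, Submodule.coe_add, map_add]
    | monomial n r =>
      rw [Polynomial.aeval_monomial, Polynomial.aeval_monomial, mul_assoc, ← hpow,
        Module.End.mul_apply, Module.algebraMap_end_apply, Submodule.coe_smul, smul_eq_mul, map_mul]
  obtain ⟨a, ha, hreg⟩ := hreg
  refine ⟨p, hp, ?_⟩
  rw [← Polynomial.aeval_def]
  refine mem_nonZeroDivisors_iff_right.mp hreg _ ?_
  rw [← hpoly p ⟨a, ha⟩, hp0]
  simp

/-- Lift x to b and put s = (ϖ), so that Mb ⊆ ϖB and y = b/ϖ satisfies My ⊆ B. If My ⊆ M, then y is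
integral, hence in B, and b vanishes in the fibre. Otherwise M is locally principal and has height
at most 1, contrary to `hdim`. -/
lemma fiber_eq_zero_of_isMaximal_smul {Q : Type*} [CommRing Q] [Algebra B Q]
    [IsIntegrallyClosedIn B Q] (hunit : ∀ a : A, a ≠ 0 → IsUnit (algebraMap B Q (algebraMap A B a)))
    (hdim : ∀ M : Ideal B, M.IsMaximal → M.comap (algebraMap A B) ≠ ⊥ → 2 ≤ M.height)
    (s : Ideal A) [s.IsPrime] (hs : s ≠ ⊥) (m : Ideal (s.Fiber B)) (hm : m.IsMaximal)
    (x : s.Fiber B) (hx : ∀ a ∈ m, a * x = 0) : x = 0 := by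
  have hsmax : s.IsMaximal := IsPrime.to_maximal_ideal hs
  obtain ⟨ϖ, hsϖ⟩ : ∃ ϖ, s = Ideal.span {ϖ} := (IsPrincipalIdealRing.principal s).principal
  have hϖ : ϖ ≠ 0 := fun h ↦ hs (by simp [hsϖ, h])
  have hsurj : Function.Surjective (Algebra.TensorProduct.includeRight : B →ₐ[A] s.Fiber B) :=
    surjective_one_tmul s
  have hϖ0 : algebraMap A (s.Fiber B) ϖ = 0 := by
    rw [IsScalarTower.algebraMap_apply A s.ResidueField,
      Ideal.algebraMap_residueField_eq_zero.mpr 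
        (hsϖ ▸ Ideal.mem_span_singleton_self ϖ), map_zero]
  let ι : B →ₐ[A] s.Fiber B := Algebra.TensorProduct.includeRight
  have hker (b : B) (h : ι b = 0) : ∃ c, b = algebraMap A B ϖ * c := by
    have := mem_of_one_tmul_eq_zero s h
    rw [hsϖ, Ideal.map_span, Set.image_singleton] at this
    exact Ideal.mem_span_singleton.mp this
  obtain ⟨b, rfl⟩ := hsurj x
  let M : Ideal B := m.comap ι
  have hM : M.IsMaximal := Ideal.comap_isMaximal_of_surjective ι hsurj
  have hϖM : algebraMap A B ϖ ∈ M := by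
    rw [Ideal.mem_comap, ι.commutes, hϖ0]; exact zero_mem _
  have hMb (a : B) (ha : a ∈ M) : ∃ c, a * b = algebraMap A B ϖ * c :=
    hker _ (by rw [map_mul]; exact hx _ ha)
  have hinj : Function.Injective (algebraMap B Q) := IsIntegralClosure.algebraMap_injective B B Q
  obtain ⟨u, hu⟩ := hunit ϖ hϖ
  by_cases H : ∀ a ∈ M, ∃ c ∈ M, a * b = algebraMap A B ϖ * c
  · have hint : IsIntegral B (algebraMap B Q b * ↑u⁻¹) := by
      refine isIntegral_of_forall_mul_mem _ M (IsNoetherian.noetherian M) hinj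
        ⟨_, hϖM, (hunit ϖ hϖ).mem_nonZeroDivisors⟩ fun a ha ↦ ?_
      obtain ⟨c, hc, h⟩ := H a ha
      refine ⟨c, hc, ?_⟩
      rw [← mul_assoc, Units.mul_inv_eq_iff_eq_mul, ← map_mul, h, map_mul, hu, mul_comm]
    obtain ⟨c, hc⟩ := IsIntegralClosure.isIntegral_iff (A := B).mp hint
    have : b = algebraMap A B ϖ * c := hinj (by
      rw [map_mul, hc, ← hu, mul_left_comm, Units.mul_inv, mul_one])
    change ι b = 0
    rw [this, map_mul, ι.commutes, hϖ0, zero_mul]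
  · push Not at H
    obtain ⟨a₀, ha₀, H⟩ := H
    obtain ⟨c, hc⟩ := hMb a₀ ha₀
    have hcM : c ∉ M := fun h ↦ H c h hc
    have hmin : M ∈ (Ideal.span {a₀}).minimalPrimes := by
      refine ⟨⟨hM.isPrime, (Ideal.span_singleton_le_iff_mem _).mpr ha₀⟩,
        fun q ⟨hq, haq⟩ hqM a ha ↦ ?_⟩
      obtain ⟨d, hd⟩ := hMb a ha
      have h1 : a * c = a₀ * d := by
        rw [← sub_eq_zero]
        refine mem_nonZeroDivisors_iff_left.mp (algebraMap_mem_nonZeroDivisors B hϖ) _ ?_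
        linear_combination a₀ * hd - a * hc
      refine (hq.mem_or_mem (y := c) ?_).resolve_right fun h ↦ hcM (hqM h)
      rw [h1]
      exact q.mul_mem_right _ (haq (Ideal.mem_span_singleton_self a₀))
    have h1 := Ideal.height_le_one_of_isPrincipal_of_mem_minimalPrimes _ _ hmin
    have h2 := hdim M hM fun h ↦ hϖ (by
      have : ϖ ∈ M.comap (algebraMap A B) := hϖM
      rwa [h] at this)
    exact absurd (h2.trans h1) (by decide)

end FiberDepth

/-! ### Normality of the generic fibre -/

section GenericFiber

variable {A B : Type*} [CommRing A] [IsDomain A] [CommRing B] [Algebra A B]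

/-- The generic fibre is the localization of B at the nonzero elements of A, and being integrally
closed in the total quotient ring survives localization. -/
lemma subsingleton_normCoker_fiber_bot {Q : Type*} [CommRing Q] [Algebra B Q]
    [IsReduced B] [IsIntegrallyClosedIn B Q] [IsFractionRing B Q] [IsArtinianRing Q] :
    Subsingleton (NormCoker ((⊥ : Ideal A).Fiber B)) := by
  let T : Submonoid B := Algebra.algebraMapSubmonoid B A⁰
  let E := Localization T
  let F := (⊥ : Ideal A).Fiber B
  let : Algebra B F := Algebra.TensorProduct.rightAlgebra
  have hloc : IsLocalization T F := IsLocalization.tensorRight (⊥ : Ideal A).ResidueField A⁰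
  let e : F ≃ₐ[B] E := IsLocalization.algEquiv T F E
  let : Algebra F E := e.toRingEquiv.toRingHom.toAlgebra
  let : Algebra F (Localization (Algebra.algebraMapSubmonoid Q T)) :=
    ((algebraMap E (Localization (Algebra.algebraMapSubmonoid Q T))).comp
      (algebraMap F E)).toAlgebra
  have : IsScalarTower F E (Localization (Algebra.algebraMapSubmonoid Q T)) :=
    .of_algebraMap_eq fun _ ↦ rfl
  have hbij : Function.Bijective (algebraMap F E) := e.bijective
  have : Algebra.IsIntegral F E := Algebra.isIntegral_of_surjective hbij.2
  have := isIntegrallyClosedIn_localization (D := B) (Q := Q) T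
  have hF : IsReduced F := isReduced_of_injective (algebraMap F E) hbij.1
  obtain ⟨f, hf⟩ := exists_normalization_bijective (L := F) (E := E)
    (Q := Localization (Algebra.algebraMapSubmonoid Q T))
    (fun x hx ↦ by rw [hbij.1 (hx.trans (map_zero _).symm)]; exact IsNilpotent.zero)
    (fun r hr ↦ isUnit_algebraMap_localization T _ (by
      have hr' := red_mk_mem_nonZeroDivisors_iff_of_isReduced.mp hr
      refine mem_nonZeroDivisors_iff_right.mpr fun z hz ↦ ?_
      obtain ⟨z, rfl⟩ := hbij.2 z
      rw [mem_nonZeroDivisors_iff_right.mp hr' z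
        (hbij.1 (by rw [map_mul, map_zero]; exact hz)), map_zero]))
    (fun y ↦ by
      obtain ⟨z, rfl⟩ := hbij.2 y
      exact ⟨1, z, by rw [map_one]; exact one_mem _, by rw [map_one, one_mul]⟩)
  refine Submodule.Quotient.subsingleton_iff.mpr (LinearMap.range_eq_top.mpr fun y ↦ ?_)
  obtain ⟨z, hz⟩ := hbij.2 (f y)
  exact ⟨z, hf.1 (by rw [Algebra.linearMap_apply, f.commutes, hz])⟩

end GenericFiber

/-! ### Generic separability implies reduced fibres -/

section Unramified

/-- If f is the minimal polynomial of x, then f'(x)dx = d(f(x)) = 0, and the Bézout relation between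
f and f' makes f'(x) a unit. -/
lemma formallyUnramified_of_isSeparable (K E : Type*) [Field K] [CommRing E] [Algebra K E]
    [Algebra.IsSeparable K E] : Algebra.FormallyUnramified K E := by
  refine ⟨Submodule.subsingleton_iff E |>.mp (subsingleton_of_bot_eq_top ?_)⟩
  rw [← KaehlerDifferential.span_range_derivation, eq_comm, Submodule.span_eq_bot]
  rintro _ ⟨x, rfl⟩
  obtain ⟨a, b, hab⟩ := Algebra.IsSeparable.isSeparable K x
  have h1 := congrArg (Polynomial.aeval x) hab
  rw [map_add, map_mul, map_mul, minpoly.aeval, mul_zero, zero_add, map_one] at h1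
  rw [← one_smul E (KaehlerDifferential.D K E x), ← h1, mul_smul, ← Derivation.map_aeval,
    minpoly.aeval, map_zero, smul_zero]

attribute [local instance] Algebra.TensorProduct.rightAlgebra in
-- The differentials of S over A are finite over A and vanish generically, so a single d ≠ 0 kills
-- them. Where d is invertible the fibre is unramified over a field, hence reduced.
lemma exists_ne_zero_isReduced_tensor {A S : Type*} [CommRing A] [IsDomain A] [CommRing S]
    [Algebra A S] [Module.Finite A S] (K : Type*) [Field K] [Algebra A K] [IsFractionRing A K]
    [Algebra.IsSeparable K (K ⊗[A] S)] :
    ∃ d : A, d ≠ 0 ∧ ∀ (k : Type*) [Field k] [Algebra A k], algebraMap A k d ≠ 0 →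
      IsReduced (k ⊗[A] S) := by
  have := formallyUnramified_of_isSeparable K (K ⊗[A] S)
  have hsub : Subsingleton (K ⊗[A] Ω[S⁄A]) :=
    (KaehlerDifferential.tensorKaehlerEquivBase A K S (K ⊗[A] S)).toEquiv.subsingleton
  have hloc : IsLocalizedModule A⁰ (TensorProduct.mk A K (Ω[S⁄A]) 1) :=
    (isLocalizedModule_iff_isBaseChange A⁰ K _).mpr (TensorProduct.isBaseChange A _ K)
  have htors : Module.IsTorsion A (Ω[S⁄A]) := fun {ω} ↦
    (IsLocalizedModule.eq_zero_iff A⁰ (TensorProduct.mk A K (Ω[S⁄A]) 1)).mp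
      (Subsingleton.elim _ _)
  have : Module.Finite A (Ω[S⁄A]) := Module.Finite.trans S _
  obtain ⟨d, hd, hd0⟩ := Submodule.annihilator_top_inter_nonZeroDivisors htors
  refine ⟨d, nonZeroDivisors.ne_zero hd0, fun k _ _ hdk ↦ ?_⟩
  have : Subsingleton (k ⊗[A] Ω[S⁄A]) := by
    refine subsingleton_of_forall_eq 0 fun z ↦ ?_
    induction z with
    | zero => rfl
    | add x y hx hy => rw [hx, hy, add_zero]
    | tmul x ω =>
      have : x = d • (x * (algebraMap A k d)⁻¹) := by
        rw [Algebra.smul_def, mul_left_comm, mul_inv_cancel₀ hdk, mul_one]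
      rw [this, TensorProduct.smul_tmul, Submodule.mem_annihilator.mp hd ω trivial, tmul_zero]
  have : Algebra.FormallyUnramified k (k ⊗[A] S) :=
    ⟨(KaehlerDifferential.tensorKaehlerEquivBase A k S (k ⊗[A] S)).symm.toEquiv.subsingleton⟩
  exact Algebra.FormallyUnramified.isReduced_of_field k (k ⊗[A] S)

end Unramified

/-! ### Components of dimension at most 1 -/

section LowDimension

lemma not_dimGTIdeal_le {C : Type*} [CommRing C] [IsNoetherianRing C] {i : ℕ} {P : Ideal C}
    (hP : P ∈ minimalPrimes C) (hdim : ¬ (i : WithBot ℕ∞) < ringKrullDim (C ⧸ P)) :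
    ¬ dimGTIdeal C i ≤ P := by
  intro hle
  have hprime := hP.isPrime
  obtain ⟨Q, hQ, hQdim, hQP⟩ := exists_mem_minimalPrimes_le_of_dimGTIdeal_le hle
  have : P = Q := le_antisymm (hP.2 ⟨hQ.isPrime, bot_le⟩ hQP) hQP
  exact hdim (this ▸ hQdim)

lemma eq_zero_of_mem_dimGTIdeal {C : Type*} [CommRing C] [IsReduced C] {i : ℕ} {x : C}
    (hx : x ∈ dimGTIdeal C i)
    (h : ∀ P ∈ minimalPrimes C, ¬ (i : WithBot ℕ∞) < ringKrullDim (C ⧸ P) → x ∈ P) : x = 0 := by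
  have : x ∈ sInf ((⊥ : Ideal C).minimalPrimes) := Submodule.mem_sInf.mpr fun P hP ↦ by
    by_cases hdim : (i : WithBot ℕ∞) < ringKrullDim (C ⧸ P)
    · exact Submodule.mem_sInf.mp hx P ⟨hP, hdim⟩
    · exact h P hP hdim
  rw [Ideal.sInf_minimalPrimes] at this
  exact (mem_nilradical.mp this).eq_zero

/-- Prime avoidance gives i in all the large minimal primes and in none of the small ones; as C is
reduced, the annihilator of i is the intersection of the small ones. -/
lemma exists_mul_eq_zero_iff_forall_mem (C : Type*) [CommRing C] [IsNoetherianRing C]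
    [IsReduced C] : ∃ i ∈ dimGTIdeal C 1, ∀ r : C, r * i = 0 ↔
      ∀ P ∈ minimalPrimes C, ¬ ((1 : ℕ) : WithBot ℕ∞) < ringKrullDim (C ⧸ P) → r ∈ P := by
  have hS : {P | P ∈ minimalPrimes C ∧
      ¬ ((1 : ℕ) : WithBot ℕ∞) < ringKrullDim (C ⧸ P)}.Finite :=
    (minimalPrimes.finite_of_isNoetherianRing C).subset fun _ h ↦ h.1
  obtain ⟨i, hi, hnot⟩ : ∃ i ∈ dimGTIdeal C 1, ∀ P ∈ minimalPrimes C,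
      ¬ ((1 : ℕ) : WithBot ℕ∞) < ringKrullDim (C ⧸ P) → i ∉ P := by
    by_contra! H
    obtain ⟨P, hP, hle⟩ := (Ideal.subset_union_prime_finite hS (f := id)
      (I := dimGTIdeal C 1) 0 0 fun _ h _ _ ↦ h.1.isPrime).1 fun i hi ↦ by
        obtain ⟨P, hP, hdim, hiP⟩ := H i hi
        exact Set.mem_biUnion (show P ∈ {P | _ ∧ _} from ⟨hP, not_lt.mpr hdim⟩) hiP
    exact not_dimGTIdeal_le hP.1 hP.2 hle
  refine ⟨i, hi, fun r ↦ ⟨fun h P hP hdim ↦ ?_, fun h ↦ ?_⟩⟩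
  · exact (hP.isPrime.mem_or_mem (by rw [h]; exact zero_mem _)).resolve_right (hnot P hP hdim)
  · exact eq_zero_of_mem_dimGTIdeal (Ideal.mul_mem_left _ _ hi) fun P hP hdim ↦
      Ideal.mul_mem_right _ P (h P hP hdim)

lemma finite_quotient_of_mul_eq_zero {A C : Type*} [CommRing A] [IsNoetherianRing A] [CommRing C]
    [Algebra A C] {I J : Ideal C} (hI : Module.Finite A I) {i : C} (hi : i ∈ I)
    (h : ∀ r, r * i = 0 → r ∈ J) : Module.Finite A (C ⧸ J) := by
  let f : C →ₗ[A] I := (LinearMap.toSpanSingleton C I ⟨i, hi⟩).restrictScalars A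
  have hker : LinearMap.ker f ≤ J.restrictScalars A := fun r hr ↦ h r (congrArg Subtype.val hr)
  have : Module.Finite A (C ⧸ LinearMap.ker f) :=
    Module.Finite.equiv f.quotKerEquivRange.symm
  exact Module.Finite.of_surjective ((LinearMap.ker f).mapQ (J.restrictScalars A) LinearMap.id hker)
    fun x ↦ by
      obtain ⟨x, rfl⟩ := Submodule.Quotient.mk_surjective _ x
      exact ⟨Submodule.Quotient.mk x, rfl⟩

lemma ringKrullDim_eq_one_of_finite {A E : Type*} [CommRing A] [IsDomain A]
    [IsPrincipalIdealRing A] (hA : ¬ IsField A) [CommRing E] [IsDomain E] [Algebra A E]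
    [Module.Finite A E] (hinj : Function.Injective (algebraMap A E)) :
    ringKrullDim E = ((1 : ℕ) : WithBot ℕ∞) := by
  have h1 : Ring.KrullDimLE 1 E := (krullDimLE_one_iff_of_isIntegral hinj).mp
    (Ring.krullDimLE_one_iff_of_noZeroDivisors.mpr fun p hp _ ↦ IsPrime.to_maximal_ideal hp)
  have h0 : ¬ Ring.KrullDimLE 0 E := fun h ↦
    hA (isField_of_isIntegral_of_isField hinj Ring.KrullDimLE.isField_of_isDomain)
  rw [Ring.krullDimLE_iff] at h1 h0
  refine le_antisymm h1 ?_
  simpa using ENat.WithBot.add_one_le_iff.mpr (not_le.mp h0)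

/-- Multiplication by i embeds C modulo the small minimal primes into the A-finite ideal `dimGTIdeal
C 1`. So the small components are finite and torsion-free over A, and have dimension exactly 1
because A is not a field. -/
lemma exists_mul_eq_zero_iff_mem_dimEqIdeal {A C : Type*} [CommRing A] [IsDomain A]
    [IsPrincipalIdealRing A] (hA : ¬ IsField A) [CommRing C] [IsNoetherianRing C] [IsReduced C]
    [Algebra A C] [Module.IsTorsionFree A C] (hfin : Module.Finite A (dimGTIdeal C 1)) :
    (∃ i ∈ dimGTIdeal C 1, ∀ r : C, r * i = 0 ↔ r ∈ dimEqIdeal C 1) ∧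
      ∀ x ∈ dimGTIdeal C 1, x ∈ dimEqIdeal C 1 → x = 0 := by
  obtain ⟨i, hi, h⟩ := exists_mul_eq_zero_iff_forall_mem C
  suffices H : ∀ r : C, r * i = 0 ↔ r ∈ dimEqIdeal C 1 from ⟨⟨i, hi, H⟩, fun x hx hx' ↦
    eq_zero_of_mem_dimGTIdeal hx ((h x).mp ((H x).mpr hx'))⟩
  intro r
  rw [h, dimEqIdeal, Submodule.mem_sInf]
  refine ⟨fun H P ⟨hP, hdim⟩ ↦ H P hP hdim.le.not_gt, fun H P hP hdim ↦ H P ⟨hP, ?_⟩⟩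
  have hprime := hP.isPrime
  have : Module.Finite A (C ⧸ P) :=
    finite_quotient_of_mul_eq_zero hfin hi fun r hr ↦ (h r).mp hr P hP hdim
  refine ringKrullDim_eq_one_of_finite hA ((injective_iff_map_eq_zero _).mpr fun a ha ↦ ?_)
  by_contra ha0
  exact notMem_nonZeroDivisors_of_mem_mem_minimalPrimes (Ideal.Quotient.eq_zero_iff_mem.mp ha) hP
    (algebraMap_mem_nonZeroDivisors C ha0)

/-- A nilpotent of k ⊗ C dies in the reduced k ⊗ C^{>1}, so it comes from k ⊗ I for the kernel I of
C → C^{>1}. It also dies in k ⊗ C^1, and I → C^1, being injective with finite cokernel, stays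
injective for k away from d₂. -/
theorem exists_ne_zero_isReduced_of_isSeparable {A : Type u} {C : Type v} [CommRing A] [IsDomain A]
    [IsPrincipalIdealRing A] (hA : ¬ IsField A) [CommRing C] [IsNoetherianRing C] [IsReduced C]
    [Algebra A C] [Module.IsTorsionFree A C] (hfin : Module.Finite A (dimGTIdeal C 1))
    (K : Type*) [Field K] [Algebra A K] [IsFractionRing A K]
    [Algebra.IsSeparable K (K ⊗[A] PartEq C 1)] :
    ∃ d : A, d ≠ 0 ∧ ∀ (k : Type u) [Field k] [Algebra A k], algebraMap A k d ≠ 0 →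
      IsReduced (k ⊗[A] PartGT C 1) → IsReduced (k ⊗[A] C) := by
  obtain ⟨⟨i, hi, hiff⟩, hinf⟩ := exists_mul_eq_zero_iff_mem_dimEqIdeal hA hfin
  have hfin' : Module.Finite A (PartEq C 1) :=
    finite_quotient_of_mul_eq_zero hfin hi fun r ↦ (hiff r).mp
  obtain ⟨d₁, hd₁, h₁⟩ := exists_ne_zero_isReduced_tensor.{u, v, _, u} (A := A) (S := PartEq C 1) K
  let ι : dimGTIdeal C 1 →ₗ[A] C := ((dimGTIdeal C 1).subtype).restrictScalars A
  let π : C →ₐ[A] PartEq C 1 := Ideal.Quotient.mkₐ A (dimEqIdeal C 1)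
  have : Module.IsTorsionFree A (dimGTIdeal C 1) :=
    inferInstanceAs (Module.IsTorsionFree A ((dimGTIdeal C 1).restrictScalars A))
  have hinj : Function.Injective (π.toLinearMap ∘ₗ ι) := by
    rw [injective_iff_map_eq_zero]
    rintro ⟨x, hx⟩ h
    exact Subtype.ext (hinf x hx (Ideal.Quotient.eq_zero_iff_mem.mp h))
  obtain ⟨d₂, hd₂, h₂⟩ := exists_ne_zero_injective_baseChange (π.toLinearMap ∘ₗ ι) hinj
    inferInstance
  refine ⟨d₁ * d₂, mul_ne_zero hd₁ hd₂, fun k _ _ hdk hred ↦ ⟨fun x hx ↦ ?_⟩⟩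
  rw [map_mul] at hdk
  have hred₁ := h₁ k (left_ne_zero_of_mul hdk)
  have hex : Function.Exact ι (Ideal.Quotient.mkₐ A (dimGTIdeal C 1)).toLinearMap := fun x ↦
    Ideal.Quotient.eq_zero_iff_mem.trans ⟨fun h ↦ ⟨⟨x, h⟩, rfl⟩, fun ⟨y, hy⟩ ↦ hy ▸ y.2⟩
  have hex' := lTensor_exact k hex Ideal.Quotient.mk_surjective
  obtain ⟨y, rfl⟩ := (hex' x).mp
    (hx.map (Algebra.TensorProduct.map (AlgHom.id A k)
      (Ideal.Quotient.mkₐ A (dimGTIdeal C 1)))).eq_zero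
  have h3 := (hx.map (Algebra.TensorProduct.map (AlgHom.id A k) π)).eq_zero
  have h4 : (π.toLinearMap ∘ₗ ι).baseChange k y = 0 := by
    rw [LinearMap.baseChange_comp]
    exact h3
  rw [h₂ k (right_ne_zero_of_mul hdk) (h4.trans (map_zero _).symm), map_zero]

end LowDimension

/-! ### Algebras that can serve as target of the comparison -/

section GoodAlgebra

/-- A reduced algebra without points of depth zero, whose normalization has a finite dimensional
cokernel: the `δ`-invariant of an algebra mapping to it is determined by the index of the map. -/
structure IsGoodAlgebra (k : Type*) (B : Type*) [Field k] [CommRing B] [Algebra k B] : Prop where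
  isReduced : IsReduced B
  eq_zero_of_smul : ∀ m : Ideal B, m.IsMaximal → ∀ x : B, (∀ a ∈ m, a * x = 0) → x = 0
  finite_normCoker : Module.Finite k (NormCoker B)

/-- The dimension of the cokernel of the normalization map. -/
def normCokerRank (k : Type*) (B : Type*) [Field k] [CommRing B] [Algebra k B] : ℕ :=
  Module.finrank k (NormCoker B)

lemma normCokerRank_eq_zero (k : Type*) {B : Type*} [Field k] [CommRing B] [Algebra k B]
    (h : Subsingleton (NormCoker B)) : normCokerRank k B = 0 :=
  Module.finrank_zero_of_subsingleton

theorem IsGoodAlgebra.delta_eq {k C B : Type*} [Field k] [CommRing C] [IsNoetherianRing C]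
    [Algebra k C] [CommRing B] [Algebra k B] (h : IsGoodAlgebra k B) (φ : C →ₐ[k] B)
    (hker : Module.Finite k (LinearMap.ker φ.toLinearMap))
    (hcoker : Module.Finite k (B ⧸ LinearMap.range φ.toLinearMap)) :
    (DeltaFinite k C ∧ EpsilonFinite k C) ∧
      epsilon k C = Module.finrank k (LinearMap.ker φ.toLinearMap) ∧
      delta k C = normCokerRank k B + ((Module.finrank k (B ⧸ LinearMap.range φ.toLinearMap) : ℤ) -
        Module.finrank k (LinearMap.ker φ.toLinearMap)) := by
  have := h.isReduced
  obtain ⟨h1, h2, h3⟩ := delta_eq_of_algHom φ hker hcoker h.eq_zero_of_smul h.finite_normCoker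
  refine ⟨⟨h1, h1.2.2⟩, h2, ?_⟩
  rw [h3, normCokerRank]
  ring

end GoodAlgebra

/-! ### Comparison of fibres and choice of the neighbourhood -/

section FiberComparison

variable {A : Type u} [CommRing A] [IsDomain A] [IsPrincipalIdealRing A]

theorem exists_delta_fiber_eq {C : Type v} {B : Type w} [CommRing C] [IsNoetherianRing C]
    [CommRing B] [Algebra A C] [Algebra A B] [Module.IsTorsionFree A C] [Module.IsTorsionFree A B]
    (φ : C →ₐ[A] B) (hker : Module.Finite A (LinearMap.ker φ.toLinearMap))
    (hcoker : Module.Finite A (B ⧸ LinearMap.range φ.toLinearMap)) :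
    ∃ c : ℤ, (Function.Bijective φ → c = 0) ∧
      ∀ s : PrimeSpectrum A, IsGoodAlgebra s.asIdeal.ResidueField (FiberRing s B) →
        FiberInvariantsFinite s C ∧
        Module.Finite s.asIdeal.ResidueField
          (LinearMap.ker (φ.toLinearMap.baseChange s.asIdeal.ResidueField)) ∧
        epsilonFiber s C = Module.finrank s.asIdeal.ResidueField
          (LinearMap.ker (φ.toLinearMap.baseChange s.asIdeal.ResidueField)) ∧
        deltaFiber s C =
          normCokerRank s.asIdeal.ResidueField (FiberRing s B) + c := by
  obtain ⟨c, hc⟩ := exists_index_baseChange φ.toLinearMap hker hcoker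
  refine ⟨c, fun hφ ↦ ?_, fun s hs ↦ ?_⟩
  -- The index is the same for all fields, so it may be computed at the generic point.
  · obtain ⟨-, -, h⟩ := hc (⊥ : PrimeSpectrum A).asIdeal.ResidueField
    let e := (LinearEquiv.ofBijective φ.toLinearMap hφ).baseChange A
      (⊥ : PrimeSpectrum A).asIdeal.ResidueField C B
    have h1 : LinearMap.ker (φ.toLinearMap.baseChange (⊥ : PrimeSpectrum A).asIdeal.ResidueField) =
      ⊥ := LinearMap.ker_eq_bot.mpr e.injective
    have h2 : LinearMap.range
      (φ.toLinearMap.baseChange (⊥ : PrimeSpectrum A).asIdeal.ResidueField) = ⊤ :=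
      LinearMap.range_eq_top.mpr e.surjective
    have : Subsingleton ((⊥ : PrimeSpectrum A).asIdeal.ResidueField ⊗[A] B ⧸ LinearMap.range
      (φ.toLinearMap.baseChange (⊥ : PrimeSpectrum A).asIdeal.ResidueField)) :=
      Submodule.Quotient.subsingleton_iff.mpr h2
    rw [Module.finrank_zero_of_subsingleton, h1, finrank_bot] at h
    simpa using h.symm
  · have := isNoetherianRing_fiber s.asIdeal C
    obtain ⟨hk, hq, hc⟩ := hc s.asIdeal.ResidueField
    obtain ⟨h1, h2, h3⟩ := hs.delta_eq
      (Algebra.TensorProduct.map (AlgHom.id s.asIdeal.ResidueField s.asIdeal.ResidueField) φ) hk hq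
    refine ⟨h1, hk, h2, h3.trans ?_⟩
    rw [← hc]
    rfl

/-- After base change ker(gf) is an extension of ker g by ker f. Since f is surjective, minus the
dimension of ker f is the index of f, which is constant. -/
lemma exists_finrank_ker_comp_baseChange {M N P : Type*} [AddCommGroup M] [AddCommGroup N]
    [AddCommGroup P] [Module A M] [Module A N] [Module A P] [Module.IsTorsionFree A M]
    [Module.IsTorsionFree A N] (f : M →ₗ[A] N) (g : N →ₗ[A] P) (hf : Function.Surjective f)
    (hker : Module.Finite A (LinearMap.ker f)) :
    ∃ r : ℤ, ∀ (k : Type u) [Field k] [Algebra A k],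
      Module.Finite k (LinearMap.ker (g.baseChange k)) →
      (Module.finrank k (LinearMap.ker ((g ∘ₗ f).baseChange k)) : ℤ) =
        r + Module.finrank k (LinearMap.ker (g.baseChange k)) := by
  have hrange : LinearMap.range f = ⊤ := LinearMap.range_eq_top.mpr hf
  have : Subsingleton (N ⧸ LinearMap.range f) := Submodule.Quotient.subsingleton_iff.mpr hrange
  obtain ⟨c, hc⟩ := exists_index_baseChange f hker inferInstance
  refine ⟨-c, fun k _ _ hg ↦ ?_⟩
  obtain ⟨hk, -, hc⟩ := hc k
  have hsurj : Function.Surjective (f.baseChange k) := LinearMap.lTensor_surjective k hf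
  have : Subsingleton (k ⊗[A] N ⧸ LinearMap.range (f.baseChange k)) :=
    Submodule.Quotient.subsingleton_iff.mpr (LinearMap.range_eq_top.mpr hsurj)
  rw [Module.finrank_zero_of_subsingleton] at hc
  have hle : LinearMap.ker (f.baseChange k) ≤ LinearMap.ker ((g ∘ₗ f).baseChange k) := by
    rw [LinearMap.baseChange_comp]
    exact LinearMap.ker_le_ker_comp _ _
  let p : LinearMap.ker ((g ∘ₗ f).baseChange k) →ₗ[k] LinearMap.ker (g.baseChange k) :=
    (f.baseChange k).restrict fun x hx ↦ by
      rw [LinearMap.mem_ker, LinearMap.baseChange_comp] at hx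
      exact hx
  have hp : Function.Surjective p := fun ⟨y, hy⟩ ↦ by
    obtain ⟨x, rfl⟩ := hsurj y
    exact ⟨⟨x, by rw [LinearMap.mem_ker, LinearMap.baseChange_comp]; exact hy⟩, rfl⟩
  let j : LinearMap.ker (f.baseChange k) →ₗ[k] LinearMap.ker ((g ∘ₗ f).baseChange k) :=
    Submodule.inclusion hle
  have h := finrank_eq_add_of_exact (k := k) (V₁ := LinearMap.ker (f.baseChange k))
    (V₂ := LinearMap.ker ((g ∘ₗ f).baseChange k)) (V₃ := LinearMap.ker (g.baseChange k)) j p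
    (Submodule.inclusion_injective hle) hp (by
      rintro ⟨x, hx⟩
      refine ⟨fun h ↦ ⟨⟨x, congrArg Subtype.val h⟩, rfl⟩, ?_⟩
      rintro ⟨⟨y, hy⟩, h⟩
      obtain rfl : y = x := congrArg Subtype.val h
      exact Subtype.ext hy)
  rw [← hc, Nat.cast_zero, zero_sub, neg_neg, h.2, Nat.cast_add]

/-- For s = (ϖ) write d = ϖⁿe with ϖ not dividing e: on the open set where e is invertible, d can
vanish only at s. -/
lemma exists_isOpen_forall_notMem (s : PrimeSpectrum A) {d : A} (hd : d ≠ 0) :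
    ∃ V : Set (PrimeSpectrum A), IsOpen V ∧ s ∈ V ∧ ⊥ ∈ V ∧
      ∀ t ∈ V, t ≠ s → d ∉ t.asIdeal := by
  by_cases hs : s.asIdeal = ⊥
  · have hs' : s = ⊥ := PrimeSpectrum.ext hs
    subst hs'
    have : (⊥ : PrimeSpectrum A) ∈ PrimeSpectrum.basicOpen d := hd
    exact ⟨_, (PrimeSpectrum.basicOpen d).isOpen, this, this, fun t ht _ ↦ ht⟩
  · obtain ⟨ϖ, hϖ⟩ : ∃ ϖ, s.asIdeal = Ideal.span {ϖ} :=
      (IsPrincipalIdealRing.principal s.asIdeal).principal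
    have hϖ0 : ϖ ≠ 0 := fun h ↦ hs (by simp [hϖ, h])
    have hprime : Prime ϖ := (Ideal.span_singleton_prime hϖ0).mp (hϖ ▸ s.isPrime)
    obtain ⟨e, hde, he⟩ :=
      (FiniteMultiplicity.of_prime_left hprime hd).exists_eq_pow_mul_and_not_dvd
    refine ⟨_, (PrimeSpectrum.basicOpen e).isOpen, ?_, right_ne_zero_of_mul (hde ▸ hd),
      fun t ht hts hmem ↦ ?_⟩
    · change e ∉ s.asIdeal
      rwa [hϖ, Ideal.mem_span_singleton]
    · rw [hde] at hmem
      rcases t.isPrime.mem_or_mem hmem with h | h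
      · have hle : s.asIdeal ≤ t.asIdeal := by
          rw [hϖ, Ideal.span_singleton_le_iff_mem]
          exact t.isPrime.mem_of_pow_mem _ h
        have : s.asIdeal.IsMaximal := IsPrime.to_maximal_ideal hs
        exact hts (PrimeSpectrum.ext (this.eq_of_le t.isPrime.ne_top hle).symm)
      · exact ht h

omit [IsPrincipalIdealRing A] in
lemma bot_mem_specImage {C : Type*} [CommRing C] [Algebra A C] [Module.IsTorsionFree A C]
    [Nontrivial C] : ⊥ ∈ specImage A C := by
  obtain ⟨P, hP⟩ := Ideal.nonempty_minimalPrimes (I := (⊥ : Ideal C)) bot_ne_top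
  have hprime := hP.isPrime
  refine ⟨⟨P, hprime⟩, PrimeSpectrum.ext (eq_bot_iff.mpr fun a ha ↦ ?_)⟩
  by_contra ha0
  exact notMem_nonZeroDivisors_of_mem_mem_minimalPrimes (Ideal.mem_comap.mp ha) hP
    (algebraMap_mem_nonZeroDivisors C ha0)

end FiberComparison

/-! ### Finiteness over A of the kernels and cokernels of the comparison maps -/

section FiniteCokernel

variable {A C B : Type*} {R : Type*} [CommRing A] [IsNoetherianRing A] [CommRing R] [CommRing C]
  [CommRing B] [Algebra A R] [Algebra A C] [Algebra A B] [Algebra R C] [Algebra R B]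
  [IsScalarTower A R C] [IsScalarTower A R B]

/-- The kernel of C → B modulo the image of ker(R → B) embeds in the cokernel of R → C. -/
lemma finite_ker_of_finite_quotient
    (hker : Module.Finite A (RingHom.ker (algebraMap R B)))
    (hcoker : Module.Finite A (C ⧸ LinearMap.range (Algebra.linearMap R C)))
    (ψ : C →ₐ[R] B) : Module.Finite A (LinearMap.ker (ψ.restrictScalars A).toLinearMap) := by
  let K := LinearMap.ker (ψ.restrictScalars A).toLinearMap
  let q : K →ₗ[A] C ⧸ LinearMap.range (Algebra.linearMap R C) :=
    ((LinearMap.range (Algebra.linearMap R C)).mkQ.restrictScalars A) ∘ₗ K.subtype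
  let j : RingHom.ker (algebraMap R B) →ₗ[A] K :=
    LinearMap.codRestrict K
      (((Algebra.linearMap R C) ∘ₗ (RingHom.ker (algebraMap R B)).subtype).restrictScalars A)
      fun x ↦ (ψ.commutes x.1).trans x.2
  have : Module.Finite A (LinearMap.range q) := inferInstance
  have : Module.Finite A (LinearMap.ker q) := by
    have hle : LinearMap.ker q ≤ LinearMap.range j := by
      rintro ⟨x, hx⟩ h
      obtain ⟨r, rfl⟩ := (Submodule.Quotient.mk_eq_zero _).mp h
      exact ⟨⟨r, (ψ.commutes r).symm.trans hx⟩, rfl⟩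
    have : Module.Finite A (LinearMap.range j) := inferInstance
    exact Module.Finite.of_injective (Submodule.inclusion hle) (Submodule.inclusion_injective hle)
  have : Module.Finite A (K ⧸ LinearMap.ker q) := Module.Finite.equiv q.quotKerEquivRange.symm
  exact Module.Finite.of_submodule_quotient (LinearMap.ker q)

omit [IsNoetherianRing A] in
lemma finite_coker_of_finite_quotient
    (hcoker : Module.Finite A (B ⧸ LinearMap.range (Algebra.linearMap R B)))
    (ψ : C →ₐ[R] B) : Module.Finite A (B ⧸ LinearMap.range (ψ.restrictScalars A).toLinearMap) := by
  have hle : (LinearMap.range (Algebra.linearMap R B)).restrictScalars A ≤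
      LinearMap.range (ψ.restrictScalars A).toLinearMap := by
    rintro _ ⟨r, rfl⟩
    exact ⟨algebraMap R C r, ψ.commutes r⟩
  have : Module.Finite A (B ⧸ (LinearMap.range (Algebra.linearMap R B)).restrictScalars A) := hcoker
  exact Module.Finite.of_surjective
    (((LinearMap.range (Algebra.linearMap R B)).restrictScalars A).mapQ _ LinearMap.id hle)
    fun x ↦ by
      obtain ⟨x, rfl⟩ := Submodule.Quotient.mk_surjective _ x
      exact ⟨Submodule.Quotient.mk x, rfl⟩

omit [IsNoetherianRing A] in
lemma finite_quotient_range_of_surjective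
    (hcoker : Module.Finite A (C ⧸ LinearMap.range (Algebra.linearMap R C)))
    (ψ : C →ₐ[R] B) (hψ : Function.Surjective ψ) :
    Module.Finite A (B ⧸ LinearMap.range (Algebra.linearMap R B)) := by
  have hle : LinearMap.range (Algebra.linearMap R C) ≤
      (LinearMap.range (Algebra.linearMap R B)).comap ψ.toLinearMap := by
    rintro _ ⟨r, rfl⟩
    exact ⟨r, (ψ.commutes r).symm⟩
  refine Module.Finite.of_surjective
    (((LinearMap.range (Algebra.linearMap R C)).mapQ _ ψ.toLinearMap hle).restrictScalars A)
    fun x ↦ ?_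
  obtain ⟨x, rfl⟩ := Submodule.Quotient.mk_surjective _ x
  obtain ⟨y, rfl⟩ := hψ x
  exact ⟨Submodule.Quotient.mk y, rfl⟩

end FiniteCokernel

/-! ### Transfer of reducedness and finiteness from fibres of R to fibres of B -/

theorem isGoodAlgebra_of_isNormalAt {k C B : Type*} [Field k] [CommRing C] [IsNoetherianRing C]
    [Algebra k C] [CommRing B] [IsNoetherianRing B] [Algebra k B] (φ : C →ₐ[k] B)
    (hker : Module.Finite k (LinearMap.ker φ.toLinearMap))
    (hcoker : Module.Finite k (B ⧸ LinearMap.range φ.toLinearMap))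
    (hfin : Module.Finite C (Normalization C))
    (hZ : ∀ p ∈ nonNormalLocus C, Module.Finite k p.asIdeal.ResidueField)
    (h0 : ∀ m : Ideal B, m.IsMaximal → ∀ x : B, (∀ a ∈ m, a * x = 0) → x = 0) :
    IsGoodAlgebra k B := by
  algebraize [φ.toRingHom]
  have : IsScalarTower k C B := .of_algebraMap_eq fun x ↦ (φ.commutes x).symm
  have hker' : Module.Finite k (LinearMap.ker (Algebra.linearMap C B)) := hker
  have hcoker' : Module.Finite k (B ⧸ LinearMap.range (Algebra.linearMap C B)) := hcoker
  have : Module.Finite C B := by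
    have : Module.Finite C (B ⧸ LinearMap.range (Algebra.linearMap C B)) :=
      Module.Finite.of_restrictScalars_finite k C _
    exact Module.Finite.of_submodule_quotient (LinearMap.range (Algebra.linearMap C B))
  have h0' (m : Ideal C) (hm : m.IsMaximal) (x : B) (hx : ∀ a ∈ m, a • x = 0) : x = 0 :=
    eq_zero_of_isMaximal_smul_eq_zero h0 m x hx
  exact ⟨isReduced_of_isNormalAt hker' hcoker' hZ h0', h0,
    finite_normCoker_of_isNormalAt hker' hcoker' hZ h0' hfin⟩

/-- The residue field at p carries two k(s)-module structures that are not syntactically equal. They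
agree because a ring homomorphism out of k(s) is determined on A. -/
lemma finite_residueField_of_fiber {A R : Type*} [CommRing A] [CommRing R] [Algebra A R]
    (s : PrimeSpectrum A) (p : PrimeSpectrum (FiberRing s R))
    (h : @Module.Finite s.asIdeal.ResidueField p.asIdeal.ResidueField _ _
      IsLocalRing.ResidueField.instModule) :
    @Module.Finite s.asIdeal.ResidueField p.asIdeal.ResidueField _ _
      (IsLocalRing.instModuleResidueFieldOfAlgebra (Localization.AtPrime p.asIdeal)) := by
  have key : (IsLocalRing.ResidueField.algebra (Localization.AtPrime p.asIdeal) :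
      Algebra s.asIdeal.ResidueField p.asIdeal.ResidueField) =
      IsLocalRing.ResidueField.instAlgebra := by
    refine Algebra.algebra_ext _ _ fun r ↦ RingHom.congr_fun (Ideal.ResidueField.ringHom_ext ?_) r
    ext a
    rfl
  have h2 : @Module.Finite s.asIdeal.ResidueField p.asIdeal.ResidueField _ _
      (IsLocalRing.ResidueField.algebra (Localization.AtPrime p.asIdeal) :
        Algebra s.asIdeal.ResidueField p.asIdeal.ResidueField).toModule := by
    rw [key]
    exact h
  exact h2

/-! ### The fibres of B under the hypotheses of the theorem -/

section Family

variable {A : Type u} {R : Type v} [CommRing A] [IsDomain A] [IsPrincipalIdealRing A]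
  [CommRing R] [IsNoetherianRing R] [Algebra A R] [Module.IsTorsionFree A R]

lemma finite_normalization_partGT (hfin : Module.Finite R (Normalization R)) :
    Module.Finite R (Normalization (PartGT R 1)) := by
  obtain ⟨f, hf⟩ := exists_normalization_partGT_surjective R 1
  exact Module.Finite.of_surjective f.toLinearMap hf

lemma isNoetherianRing_normalization_partGT (hfin : Module.Finite R (Normalization R)) :
    IsNoetherianRing (Normalization (PartGT R 1)) := by
  have := finite_normalization_partGT hfin
  exact IsNoetherianRing.of_finite R (Normalization (PartGT R 1))

variable (hfin : Module.Finite R (Normalization R))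
  (hdim : ∀ M : Ideal (Normalization (PartGT R 1)), M.IsMaximal →
      M.comap (algebraMap A (Normalization (PartGT R 1))) ≠ ⊥ → 2 ≤ M.height)

include hfin hdim in
theorem fiber_normalization_eq_zero_of_smul (s : PrimeSpectrum A)
    (m : Ideal (FiberRing s (Normalization (PartGT R 1)))) (hm : m.IsMaximal)
    (x : FiberRing s (Normalization (PartGT R 1))) (hx : ∀ a ∈ m, a * x = 0) : x = 0 := by
  have := isNoetherianRing_normalization_partGT hfin
  by_cases hs : s.asIdeal = ⊥
  · have hs' : s = ⊥ := PrimeSpectrum.ext hs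
    subst hs'
    exact fiber_bot_eq_zero_of_isMaximal_smul (A := A) (B := Normalization (PartGT R 1))
      (fun P hP ↦ one_lt_ringKrullDim_of_mem_minimalPrimes_normalization hP) m hm x hx
  · refine fiber_eq_zero_of_isMaximal_smul (Q := FractionRing (Red (PartGT R 1))) (fun a ha ↦ ?_)
      hdim s.asIdeal hs m hm x hx
    exact IsLocalization.map_units (FractionRing (Red (PartGT R 1)))
      (⟨_, red_algebraMap_mem_nonZeroDivisors (PartGT R 1) ha⟩ : (Red (PartGT R 1))⁰)

include hfin hdim in
theorem isGoodAlgebra_fiber_normalization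
    (hcoker : Module.Finite A (NormCoker R))
    (hker : Module.Finite A (RingHom.ker (algebraMap R (Normalization (PartGT R 1)))))
    (hfib : FibersHaveINNS A R) (s : PrimeSpectrum A) (hs : s ∈ specImage A R) :
    IsGoodAlgebra s.asIdeal.ResidueField (FiberRing s (Normalization (PartGT R 1))) := by
  have := isNoetherianRing_normalization_partGT hfin
  have := isNoetherianRing_fiber s.asIdeal R
  have := isNoetherianRing_fiber s.asIdeal (Normalization (PartGT R 1))
  obtain ⟨hfinN, -, hZ⟩ := hfib s hs
  obtain ⟨f, hf⟩ := exists_normalization_partGT_surjective R 1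
  have hcoker' := finite_quotient_range_of_surjective (A := A) hcoker f hf
  let φ : R →ₐ[A] Normalization (PartGT R 1) := IsScalarTower.toAlgHom A R _
  obtain ⟨c, hc⟩ := exists_index_baseChange φ.toLinearMap hker hcoker'
  obtain ⟨hk, hq, -⟩ := hc s.asIdeal.ResidueField
  exact isGoodAlgebra_of_isNormalAt
    (Algebra.TensorProduct.map (AlgHom.id s.asIdeal.ResidueField s.asIdeal.ResidueField) φ) hk hq
    hfinN (fun p hp ↦ finite_residueField_of_fiber s p (hZ p hp).2)
    (fiber_normalization_eq_zero_of_smul hfin hdim s)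

omit [IsPrincipalIdealRing A] [Module.IsTorsionFree A R] in
lemma normCokerRank_fiber_bot :
    normCokerRank (⊥ : PrimeSpectrum A).asIdeal.ResidueField
      (FiberRing (⊥ : PrimeSpectrum A) (Normalization (PartGT R 1))) = 0 := by
  have := isFractionRing_integralClosure (Red (PartGT R 1))
  exact normCokerRank_eq_zero _ (subsingleton_normCoker_fiber_bot
    (Q := FractionRing (Red (PartGT R 1))))

end Family

lemma isReduced_tensor_of_algEquiv {A : Type*} {C : Type*} {B : Type*} [CommRing A] [CommRing C]
    [CommRing B] [Algebra A C] [Algebra A B] (e : C ≃ₐ[A] B) (k : Type*) [CommRing k] [Algebra A k]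
    [IsReduced (k ⊗[A] B)] : IsReduced (k ⊗[A] C) :=
  have e' : k ⊗[A] C ≃ₐ[k] k ⊗[A] B := Algebra.TensorProduct.congr AlgEquiv.refl e
  isReduced_of_injective e' e'.injective

/-! ### The invariants of the fibres in the family -/

section Family

variable {A : Type u} {R : Type v} [CommRing A] [IsDomain A] [IsPrincipalIdealRing A]
  [CommRing R] [IsNoetherianRing R] [Algebra A R] [Module.IsTorsionFree A R]
  (hfin : Module.Finite R (Normalization R))
  (hdim : ∀ M : Ideal (Normalization (PartGT R 1)), M.IsMaximal →
      M.comap (algebraMap A (Normalization (PartGT R 1))) ≠ ⊥ → 2 ≤ M.height)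
  (hcoker : Module.Finite A (NormCoker R))
  (hker : Module.Finite A (RingHom.ker (algebraMap R (Normalization (PartGT R 1)))))
  (hfib : FibersHaveINNS A R)

omit [IsDomain A] [IsPrincipalIdealRing A] [Module.IsTorsionFree A R] in
include hcoker in
lemma finite_normalization_partGT_quotient_range : Module.Finite A
    (Normalization (PartGT R 1) ⧸
      LinearMap.range (Algebra.linearMap R (Normalization (PartGT R 1)))) := by
  obtain ⟨f, hf⟩ := exists_normalization_partGT_surjective R 1
  exact finite_quotient_range_of_surjective hcoker f hf

omit [IsDomain A] [IsPrincipalIdealRing A] [IsNoetherianRing R] [Module.IsTorsionFree A R] in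
lemma finite_quotient_range_of_surjective_algebraMap {C : Type*} [CommRing C] [Algebra R C]
    [Algebra A C] [IsScalarTower A R C] (h : Function.Surjective (algebraMap R C)) :
    Module.Finite A (C ⧸ LinearMap.range (Algebra.linearMap R C)) := by
  have : Subsingleton (C ⧸ LinearMap.range (Algebra.linearMap R C)) :=
    Submodule.Quotient.subsingleton_iff.mpr (LinearMap.range_eq_top.mpr h)
  infer_instance

include hfin hdim hcoker hker hfib in
-- The common form of all δ-comparisons: only the constant c depends on C, so it cancels in
-- differences between two fibres.
theorem exists_delta_fiber_eq_normCokerRank_add {C : Type w} [CommRing C] [IsNoetherianRing C]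
    [Algebra A C] [Algebra R C] [IsScalarTower A R C] [Module.IsTorsionFree A C]
    (hC : Module.Finite A (C ⧸ LinearMap.range (Algebra.linearMap R C)))
    (ψ : C →ₐ[R] Normalization (PartGT R 1)) :
    ∃ c : ℤ, (Function.Bijective ψ → c = 0) ∧ ∀ s ∈ specImage A R,
      FiberInvariantsFinite s C ∧
      Module.Finite s.asIdeal.ResidueField (LinearMap.ker
        ((ψ.restrictScalars A).toLinearMap.baseChange s.asIdeal.ResidueField)) ∧
      epsilonFiber s C = Module.finrank s.asIdeal.ResidueField (LinearMap.ker
        ((ψ.restrictScalars A).toLinearMap.baseChange s.asIdeal.ResidueField)) ∧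
      deltaFiber s C = normCokerRank s.asIdeal.ResidueField
        (FiberRing s (Normalization (PartGT R 1))) + c := by
  have h := finite_normalization_partGT_quotient_range (A := A) (R := R) hcoker
  obtain ⟨c, hbij, hc⟩ := exists_delta_fiber_eq (A := A) (ψ.restrictScalars A)
    (finite_ker_of_finite_quotient hker hC ψ)
    (finite_coker_of_finite_quotient (A := A) (R := R) (B := Normalization (PartGT R 1)) h ψ)
  exact ⟨c, hbij, fun s hs ↦
    hc s (isGoodAlgebra_fiber_normalization hfin hdim hcoker hker hfib s hs)⟩

/-- The map `R^{>1} → (R^{>1})‾`. -/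
def partGTToNormalization (R : Type v) [CommRing R] :
    PartGT R 1 →ₐ[R] Normalization (PartGT R 1) :=
  IsScalarTower.toAlgHom R (PartGT R 1) (Normalization (PartGT R 1))

omit [IsNoetherianRing R] in
lemma partGTToNormalization_injective : Function.Injective (partGTToNormalization R) :=
  (injective_iff_map_eq_zero _).mpr fun _ hx ↦
    (normalization_algebraMap_eq_zero.mp hx).eq_zero

omit [IsDomain A] [IsPrincipalIdealRing A] [IsNoetherianRing R] [Module.IsTorsionFree A R] in
include hker in
lemma finite_dimGTIdeal_one : Module.Finite A (dimGTIdeal R 1) := by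
  have h : RingHom.ker (algebraMap R (Normalization (PartGT R 1))) = dimGTIdeal R 1 := by
    ext x
    have := map_eq_zero_iff _ (partGTToNormalization_injective (R := R))
      (x := algebraMap R (PartGT R 1) x)
    rw [RingHom.mem_ker, ← partGT_algebraMap_eq_zero, ← this]
    rfl
  rwa [← h]

include hfin hdim hcoker hker hfib in
-- Both ε-invariants are dimensions of kernels of maps to the fibre of B, and one of these maps is
-- the other precomposed with the surjection from R.
theorem exists_epsilon_fiber_eq_add : ∃ r : ℤ, ∀ s ∈ specImage A R,
    (epsilonFiber s R : ℤ) = r + epsilonFiber s (PartGT R 1) := by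
  obtain ⟨c, -, hc⟩ := exists_delta_fiber_eq_normCokerRank_add hfin hdim hcoker hker hfib
    (C := R) (finite_quotient_range_of_surjective_algebraMap Function.surjective_id)
    (Algebra.ofId R _)
  obtain ⟨c', -, hc'⟩ := exists_delta_fiber_eq_normCokerRank_add hfin hdim hcoker hker hfib
    (C := PartGT R 1)
    (finite_quotient_range_of_surjective_algebraMap Ideal.Quotient.mk_surjective)
    (partGTToNormalization R)
  obtain ⟨r, hr⟩ := exists_finrank_ker_comp_baseChange
    (Ideal.Quotient.mkₐ A (dimGTIdeal R 1)).toLinearMap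
    ((partGTToNormalization R).restrictScalars A).toLinearMap Ideal.Quotient.mk_surjective (by
      have h : LinearMap.ker (Ideal.Quotient.mkₐ A (dimGTIdeal R 1)).toLinearMap =
        (dimGTIdeal R 1).restrictScalars A :=
        Submodule.ext fun x ↦ Ideal.Quotient.eq_zero_iff_mem
      rw [h]
      exact finite_dimGTIdeal_one hker)
  refine ⟨r, fun s hs ↦ ?_⟩
  obtain ⟨-, -, h1, -⟩ := hc s hs
  obtain ⟨-, h2, h3, -⟩ := hc' s hs
  rw [h1, h3]
  exact hr s.asIdeal.ResidueField h2

include hfin hdim hcoker hker hfib in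
theorem exists_ne_zero_epsilon_fiber_partGT_eq_zero : ∃ d : A, d ≠ 0 ∧
    ∀ t ∈ specImage A R, d ∉ t.asIdeal →
      epsilonFiber t (PartGT R 1) = 0 ∧ IsReduced (FiberRing t (PartGT R 1)) := by
  obtain ⟨c', -, hc'⟩ := exists_delta_fiber_eq_normCokerRank_add hfin hdim hcoker hker hfib
    (C := PartGT R 1)
    (finite_quotient_range_of_surjective_algebraMap Ideal.Quotient.mk_surjective)
    (partGTToNormalization R)
  have h := finite_normalization_partGT_quotient_range (A := A) (R := R) hcoker
  obtain ⟨d, hd, h⟩ := exists_ne_zero_injective_baseChange (A := A)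
    ((partGTToNormalization R).restrictScalars A).toLinearMap partGTToNormalization_injective
    (finite_coker_of_finite_quotient (A := A) (R := R) (B := Normalization (PartGT R 1)) h
      (partGTToNormalization R))
  refine ⟨d, hd, fun t ht hdt ↦ ?_⟩
  have hinj := h t.asIdeal.ResidueField
    fun h ↦ hdt (Ideal.algebraMap_residueField_eq_zero.mp h)
  refine ⟨?_, ?_⟩
  · obtain ⟨-, -, h3, -⟩ := hc' t ht
    rw [h3, LinearMap.ker_eq_bot.mpr hinj, finrank_bot]
  · have := (isGoodAlgebra_fiber_normalization hfin hdim hcoker hker hfib t ht).isReduced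
    exact isReduced_of_injective (Algebra.TensorProduct.map
      (AlgHom.id t.asIdeal.ResidueField t.asIdeal.ResidueField)
      ((partGTToNormalization R).restrictScalars A)) hinj

include hker in
theorem exists_ne_zero_isReduced_fiber : ∃ d : A, d ≠ 0 ∧
    (¬ IsField A → IsReduced R →
      Algebra.IsSeparable (⊥ : PrimeSpectrum A).asIdeal.ResidueField
        (FiberRing (⊥ : PrimeSpectrum A) (PartEq R 1)) →
      ∀ t : PrimeSpectrum A, d ∉ t.asIdeal → IsReduced (FiberRing t (PartGT R 1)) →
        IsReduced (FiberRing t R)) := by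
  by_cases H : ¬ IsField A ∧ IsReduced R ∧
    Algebra.IsSeparable (⊥ : PrimeSpectrum A).asIdeal.ResidueField
      (FiberRing (⊥ : PrimeSpectrum A) (PartEq R 1))
  · obtain ⟨hA, hR, hsep⟩ := H
    have : IsFractionRing A (⊥ : PrimeSpectrum A).asIdeal.ResidueField :=
      inferInstanceAs (IsFractionRing A (⊥ : Ideal A).ResidueField)
    obtain ⟨d, hd, h⟩ := exists_ne_zero_isReduced_of_isSeparable hA (finite_dimGTIdeal_one hker)
      (⊥ : PrimeSpectrum A).asIdeal.ResidueField
    exact ⟨d, hd, fun _ _ _ t hdt ↦ h t.asIdeal.ResidueField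
      fun h ↦ hdt (Ideal.algebraMap_residueField_eq_zero.mp h)⟩
  · exact ⟨1, one_ne_zero, fun hA hR hsep ↦ (H ⟨hA, hR, hsep⟩).elim⟩

end Family

end INNS

end

/-! ### The theorem -/

open INNS in
theorem theorem2p5 {A : Type*} {R : Type*} [CommRing A] [IsDomain A] [IsPrincipalIdealRing A]
    [CommRing R] [IsNoetherianRing R] [Algebra A R] [Module.Flat A R]
    -- the normalization is finite
    (hfin : Module.Finite R (Normalization R))
    -- the cokernel of `R → R̄` and the kernel of `R → (R^{>1})‾` are finite over `A`
    (hcoker : Module.Finite A (NormCoker R))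
    (hker : Module.Finite A (RingHom.ker (algebraMap R (Normalization (PartGT R 1)))))
    (hfib : FibersHaveINNS A R)
    -- every closed point of `(X^{>1})‾` over a nonzero prime of `A` has codimension at least `2`
    (hdim : ∀ M : Ideal (Normalization (PartGT R 1)), M.IsMaximal →
      M.comap (algebraMap A (Normalization (PartGT R 1))) ≠ ⊥ → 2 ≤ M.height) :
    Module.Flat A (Normalization R) ∧
    Nonempty (Normalization (PartGT R 1) ≃ₐ[R] PartGT (Normalization R) 1) ∧
    (∀ s ∈ specImage A R,
      FiberInvariantsFinite s R ∧
      FiberInvariantsFinite s (Red R) ∧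
      FiberInvariantsFinite s (PartGT R 1) ∧
      FiberInvariantsFinite s (Normalization R) ∧
      FiberInvariantsFinite s (PartGT (Normalization R) 1) ∧
      FiberInvariantsFinite s (Normalization (PartGT R 1))) ∧
    (∀ s ∈ specImage A R, ∃ V : Set (PrimeSpectrum A), IsOpen V ∧ s ∈ V ∧
      -- (1)
      (∀ t ∈ V ∩ specImage A R,
        deltaFiber s R - deltaFiber t R
            = deltaFiber s (Red R) - deltaFiber t (Red R) ∧
        deltaFiber s R - deltaFiber t R
            = deltaFiber s (PartGT R 1) - deltaFiber t (PartGT R 1) ∧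
        deltaFiber s R - deltaFiber t R
            = deltaFiber s (Normalization R) - deltaFiber t (Normalization R) ∧
        deltaFiber s R - deltaFiber t R
            = deltaFiber s (PartGT (Normalization R) 1)
              - deltaFiber t (PartGT (Normalization R) 1)) ∧
      -- (2)
      (∀ t ∈ (V ∩ specImage A R) \ {s},
        IsNormalRing (FiberRing t (Normalization (PartGT R 1))) →
          deltaFiber s R - deltaFiber t R = deltaFiber s (Normalization (PartGT R 1)) ∧
          0 ≤ deltaFiber s (Normalization (PartGT R 1))) ∧
      -- (3)
      (⊥ ∈ V ∩ specImage A R ∧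
        deltaFiber s R - deltaFiber (⊥ : PrimeSpectrum A) R
            = deltaFiber s (Normalization (PartGT R 1)) ∧
        0 ≤ deltaFiber s (Normalization (PartGT R 1))) ∧
      -- (4)
      (∀ t ∈ (V ∩ specImage A R) \ {s},
        (epsilonFiber s R : ℤ) - (epsilonFiber t R : ℤ) = (epsilonFiber s (PartGT R 1) : ℤ) ∧
        0 ≤ (epsilonFiber s (PartGT R 1) : ℤ)) ∧
      -- (5)
      (∀ t ∈ V ∩ specImage A R,
        IsReduced (FiberRing t (Normalization (PartGT R 1))) ∧
        IsReduced (FiberRing t (PartGT (Normalization R) 1))) ∧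
      (∀ t ∈ (V ∩ specImage A R) \ {s}, IsReduced (FiberRing t (PartGT R 1))) ∧
      (IsReduced R →
        Algebra.IsSeparable (⊥ : PrimeSpectrum A).asIdeal.ResidueField
          (FiberRing (⊥ : PrimeSpectrum A) (PartEq R 1)) →
        ∀ t ∈ (V ∩ specImage A R) \ {s}, IsReduced (FiberRing t R))) := by
  have hN : IsNoetherianRing (Normalization R) := IsNoetherianRing.of_finite R (Normalization R)
  have hB : IsNoetherianRing (Normalization (PartGT R 1)) :=
    isNoetherianRing_normalization_partGT hfin
  obtain ⟨e⟩ := nonempty_normalization_partGT_algEquiv R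
  obtain ⟨f, -⟩ := exists_normalization_partGT_surjective R 1
  let g : Red R →ₐ[R] Normalization (PartGT R 1) :=
    Ideal.Quotient.liftₐ (nilradical R) (Algebra.ofId R _) fun x hx ↦
      ((mem_nilradical.mp hx).map (Algebra.ofId R (Normalization (PartGT R 1)))).eq_zero
  have hcokerB := finite_normalization_partGT_quotient_range (A := A) (R := R) hcoker
  have hcokerN : Module.Finite A (PartGT (Normalization R) 1 ⧸
      LinearMap.range (Algebra.linearMap R (PartGT (Normalization R) 1))) :=
    finite_quotient_range_of_surjective (A := A) (R := R) hcokerB e.toAlgHom e.surjective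
  obtain ⟨c₁, -, h₁⟩ := exists_delta_fiber_eq_normCokerRank_add hfin hdim hcoker hker hfib
    (C := R) (finite_quotient_range_of_surjective_algebraMap Function.surjective_id)
    (Algebra.ofId R _)
  obtain ⟨c₂, -, h₂⟩ := exists_delta_fiber_eq_normCokerRank_add hfin hdim hcoker hker hfib
    (C := Red R) (finite_quotient_range_of_surjective_algebraMap Ideal.Quotient.mk_surjective) g
  obtain ⟨c₃, -, h₃⟩ := exists_delta_fiber_eq_normCokerRank_add hfin hdim hcoker hker hfib
    (C := PartGT R 1) (finite_quotient_range_of_surjective_algebraMap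
      Ideal.Quotient.mk_surjective) (partGTToNormalization R)
  obtain ⟨c₄, -, h₄⟩ := exists_delta_fiber_eq_normCokerRank_add hfin hdim hcoker hker hfib
    (C := Normalization R) hcoker f
  obtain ⟨c₅, -, h₅⟩ := exists_delta_fiber_eq_normCokerRank_add hfin hdim hcoker hker hfib
    (C := PartGT (Normalization R) 1) hcokerN e.symm.toAlgHom
  obtain ⟨c₆, hc₆, h₆⟩ := exists_delta_fiber_eq_normCokerRank_add hfin hdim hcoker hker hfib
    (C := Normalization (PartGT R 1)) hcokerB (AlgHom.id R _)
  -- For C = B the comparison map is the identity, so δ of the fibre of B is exactly the dimension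
  -- of its normalization cokernel, hence nonnegative.
  obtain rfl := hc₆ Function.bijective_id
  obtain ⟨r, hr⟩ := exists_epsilon_fiber_eq_add hfin hdim hcoker hker hfib
  obtain ⟨d₁, hd₁, hε⟩ :=
    exists_ne_zero_epsilon_fiber_partGT_eq_zero hfin hdim hcoker hker hfib
  obtain ⟨d₂, hd₂, hred⟩ := exists_ne_zero_isReduced_fiber (A := A) (R := R) hker
  refine ⟨inferInstance, ⟨e⟩, fun s hs ↦ ⟨(h₁ s hs).1, (h₂ s hs).1, (h₃ s hs).1, (h₄ s hs).1,
    (h₅ s hs).1, (h₆ s hs).1⟩, fun s hs ↦ ?_⟩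
  -- One neighbourhood serves all claims: it avoids the zeros of d₁ (injectivity of R^{>1} → B on
  -- fibres) and of d₂ (reducedness of the fibres of R), except possibly s.
  obtain ⟨V, hVopen, hsV, hbotV, hV⟩ := exists_isOpen_forall_notMem s (mul_ne_zero hd₁ hd₂)
  have hbot : (⊥ : PrimeSpectrum A) ∈ specImage A R := by
    obtain ⟨p, -⟩ := hs
    have := p.nontrivial
    exact bot_mem_specImage
  have hδ (t : PrimeSpectrum A) (ht : t ∈ specImage A R) := (h₁ t ht).2.2.2
  have hδB : deltaFiber s (Normalization (PartGT R 1)) = normCokerRank s.asIdeal.ResidueField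
      (FiberRing s (Normalization (PartGT R 1))) := by
    rw [(h₆ s hs).2.2.2, add_zero]
  have hδB0 : 0 ≤ deltaFiber s (Normalization (PartGT R 1)) := by
    rw [hδB]
    exact Int.natCast_nonneg _
  have hdiff (t : PrimeSpectrum A) (ht : t ∈ specImage A R)
      (h0 : normCokerRank t.asIdeal.ResidueField
        (FiberRing t (Normalization (PartGT R 1))) = 0) :
      deltaFiber s R - deltaFiber t R = deltaFiber s (Normalization (PartGT R 1)) := by
    rw [hδ s hs, hδ t ht, hδB, h0]
    simp
  have hredB (t : PrimeSpectrum A) (ht : t ∈ specImage A R) :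
      IsReduced (FiberRing t (Normalization (PartGT R 1))) :=
    (isGoodAlgebra_fiber_normalization hfin hdim hcoker hker hfib t ht).isReduced
  have hd₁V (t : PrimeSpectrum A) (ht : t ∈ V) (hts : t ≠ s) : d₁ ∉ t.asIdeal :=
    fun h ↦ hV t ht hts (t.asIdeal.mul_mem_right _ h)
  have hd₂V (t : PrimeSpectrum A) (ht : t ∈ V) (hts : t ≠ s) : d₂ ∉ t.asIdeal :=
    fun h ↦ hV t ht hts (t.asIdeal.mul_mem_left _ h)
  refine ⟨V, hVopen, hsV, fun t ⟨_, ht⟩ ↦ ?_, fun t ⟨⟨_, ht⟩, _⟩ hnormal ↦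
    ⟨hdiff t ht (normCokerRank_eq_zero _ hnormal.subsingleton_normCoker), hδB0⟩,
    ⟨⟨hbotV, hbot⟩, hdiff ⊥ hbot normCokerRank_fiber_bot, hδB0⟩,
    fun t ⟨⟨htV, ht⟩, hts⟩ ↦ ⟨?_, Int.natCast_nonneg _⟩, fun t ⟨_, ht⟩ ↦ ⟨hredB t ht, ?_⟩,
    fun t ⟨⟨htV, ht⟩, hts⟩ ↦ (hε t ht (hd₁V t htV hts)).2,
    fun hR hsep t ⟨⟨htV, ht⟩, hts⟩ ↦ ?_⟩
  · rw [hδ s hs, hδ t ht, (h₂ s hs).2.2.2, (h₂ t ht).2.2.2, (h₃ s hs).2.2.2, (h₃ t ht).2.2.2,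
      (h₄ s hs).2.2.2, (h₄ t ht).2.2.2, (h₅ s hs).2.2.2, (h₅ t ht).2.2.2]
    simp only [add_sub_add_right_eq_sub, and_self]
  · rw [hr s hs, hr t ht, (hε t ht (hd₁V t htV hts)).1]
    simp
  · have := hredB t ht
    exact isReduced_tensor_of_algEquiv (e.symm.restrictScalars A) t.asIdeal.ResidueField
  -- If A is a field its spectrum is a single point, so there is no t ≠ s to consider.
  · refine hred (fun hA ↦ hts ?_) hR hsep t (hd₂V t htV hts) (hε t ht (hd₁V t htV hts)).2
    have hbot_eq (q : PrimeSpectrum A) : q.asIdeal = ⊥ :=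
      letI := hA.toField
      (Ideal.eq_bot_or_top q.asIdeal).resolve_right q.isPrime.ne_top
    exact PrimeSpectrum.ext ((hbot_eq t).trans (hbot_eq s).symm)
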